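/- Let $n\ge 3$ and let $A\subseteq \mathbb{F}_5^n$ be sum-free, i.e. there are no $x,y,z\in A$ (not necessarily distinct) with $x+y=z$. Suppose that $|A|\ge 28\cdot 5^{n-3}$ and that there is an affine subspace $T$ of $\mathbb{F}_5^n$ of codimension $2$ such that $$|A\cap T|+|A\cap(-T)|>28\cdot 5^{n-4}.$$ Then at least one of the following holds. 1. $A$ is normal, i.e. there is an affine hyperplane $H\subseteq\mathbb{F}_5^n$ not containing the origin such that $A\subseteq H\cup(-H)$. 2. $A$ is a VL-set, i.e. there is a linear automorphism of $\mathbb{F}_5^n$ mapping $\Lambda\times\mathbb{F}_5^{n-3}$ onto $A$, where $\Lambda\subseteq\mathbb{F}_5^3$ is the $28$-element set $$\begin{aligned}\Lambda=\;&\{(1,0),(-1,0),(0,1),(0,-1)\}\times\mathbb{F}_5\\&\cup\{(-1,2,0),(-1,2,1),(2,1,1),(2,1,2),(1,-2,0),(1,-2,-1),(-2,-1,-1),(-2,-1,-2)\}.\end{aligned}$$ -/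

import Mathlib

open scoped Pointwise

/-- A subset of an additive group is sum-free if it contains no solution of `a + b = c`. -/
def IsSumFree {G : Type*} [AddGroup G] (A : Set G) : Prop :=
  (A + A) ∩ A = ∅

/-- `T` is a (nonempty) affine subspace of `𝔽₅ⁿ` of codimension `k`. -/
def HasCodim {n : ℕ} (T : AffineSubspace (ZMod 5) (Fin n → ZMod 5)) (k : ℕ) : Prop :=
  (T : Set (Fin n → ZMod 5)).Nonempty ∧ Module.finrank (ZMod 5) T.direction + k = n

/-- `A` is normal if `A ⊆ H ∪ (-H)` for an affine hyperplane `H` not containing the origin.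
Such an `A` is automatically sum-free. -/
def IsNormal {n : ℕ} (A : Set (Fin n → ZMod 5)) : Prop :=
  ∃ H : AffineSubspace (ZMod 5) (Fin n → ZMod 5),
    HasCodim H 1 ∧ 0 ∉ H ∧ A ⊆ (H : Set (Fin n → ZMod 5)) ∪ -(H : Set (Fin n → ZMod 5))

/-- The explicit set `Λ ⊆ 𝔽₅³` with `28` elements. -/
def vlLambda : Set (ZMod 5 × ZMod 5 × ZMod 5) :=
  {p | (p.1, p.2.1) ∈ ({(1, 0), (-1, 0), (0, 1), (0, -1)} : Set (ZMod 5 × ZMod 5))} ∪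
    {(-1, 2, 0), (-1, 2, 1), (2, 1, 1), (2, 1, 2),
      (1, -2, 0), (1, -2, -1), (-2, -1, -1), (-2, -1, -2)}

/-- The set `Λ × 𝔽₅ⁿ⁻³`, as a subset of `𝔽₅ⁿ` (`n ≥ 3`): the first three coordinates
form an element of `Λ`, the others are arbitrary. -/
def vlModel (n : ℕ) (hn : 3 ≤ n) : Set (Fin n → ZMod 5) :=
  {x | (x ⟨0, by omega⟩, x ⟨1, by omega⟩, x ⟨2, by omega⟩) ∈ vlLambda}

/-- A VL-set is the image of `Λ × 𝔽₅ⁿ⁻³` (`n ≥ 3`) under a linear automorphism of `𝔽₅ⁿ`. -/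
def IsVLSet {n : ℕ} (A : Set (Fin n → ZMod 5)) : Prop :=
  ∃ (hn : 3 ≤ n) (e : (Fin n → ZMod 5) ≃ₗ[ZMod 5] (Fin n → ZMod 5)), A = e '' vlModel n hn

/-! Map `𝔽₅ⁿ` onto `𝔽₅²` and record the density of `A` in each of the 25 fibres (cells). A node is
the total density of two opposite cells `u`, `-u`. The hypotheses say that the cell densities add up
to at least `28/5` and that, for some map, a node exceeds `28/25 = 1.12`. Kneser's theorem controls
three nonempty cells over `u`, `v`, `u + v`: the index `M` of the period in the kernel is a power of
`5` other than `1`, and the densities are at most `x'/M`, `y'/M`, `z'/M` with `x' + y' + z' ≤ M +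
1`. So they add up to at most `6/5`, and to at most `26/25` unless `M = 5`.

Choose the map so that the node `P` at `(1, 0)` is as large as possible over all maps, and
coordinates so that `(0, 1)` carries the densest node off that axis. The proof bounds by some `K`
the sum of two nonempty nodes differing by `(1, 0)`. Then a finite collection of linear programs,
one for each support pattern (`nodes_cases`, assembled in `shape_cases`), leaves four shapes: the
support lies on two opposite lines, so `A` is normal; two full nodes and two nodes of density `4/5`;
and two borderline shapes with `P = 8/5`.

For `P > 8/5` the bound `K = 12/5 - P` follows from Kneser alone. The second shape is then rigid:
equality in Kneser makes its partial cells unions of cosets of one common hyperplane of the kernel,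
and sum-freeness in `𝔽₅` determines which cosets, giving `Λ` (`exists_vlLambda_of_dens`). This
proves the dense case `normal_or_vlLambda_of_lt`.

For `P ≤ 8/5` one needs `K = max (4/5) (56/25 - P)`. If one of the two axis cells has density above
`3/5`, Kneser again suffices. Otherwise `P ≤ 6/5`, and Kneser is applied to the union of one axis
cell and the negative of the other (`inline_le`). This union cannot lie in three cosets of a
hyperplane of the kernel: a popular coset would make `A` very dense on a pair of opposite subspaces
of codimension three, the dense case would bound `A` in each of the six hyperplanes of a pencil
through it, and `A` would be too small (`card_pencil`, `three_lt_card_image`). The two borderline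
shapes are refuted by rigidity (`false_of_full_row`, `false_of_six_nodes`). -/

set_option linter.unusedSectionVars false

/-! ### Kneser's theorem -/

/-- `C` is a union of cosets of some subgroup `H` with `m ≤ |C| + |H|`. -/
def HasLargePeriod {G : Type*} [AddCommGroup G] (C : Finset G) (m : ℕ) : Prop :=
  ∃ H : AddSubgroup G, (∀ c ∈ C, ∀ h ∈ H, c + h ∈ C) ∧ m ≤ C.card + Nat.card H

section Kneser

variable {G : Type*} [AddCommGroup G] [Fintype G] [DecidableEq G]

open Classical in
lemma card_subgroup_eq_filter (H : AddSubgroup G) :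
    Nat.card H = (Finset.univ.filter (· ∈ H)).card := by
  rw [Nat.card_eq_fintype_card, Fintype.card_subtype]

open Classical in
-- Inspect `x + H₁ + H₂`. If `W ⊆ H₁` is where `x + ·` lies in `C₂` and `U' ⊆ H₂` where it avoids
-- `C₁`, periodicity puts `x + W + U'` inside `C₂ \ C₁`; the complements `W'`, `U` do the same for
-- `C₁ \ C₂`. The two product bounds are incompatible if `W'` and `U` are both nonempty, and the
-- remaining cases give the claim.
lemma card_lt_of_mem_sdiff {C₁ C₂ : Finset G} {H₁ H₂ : AddSubgroup G}
    (h₁ : ∀ c ∈ C₁, ∀ h ∈ H₁, c + h ∈ C₁) (h₂ : ∀ c ∈ C₂, ∀ h ∈ H₂, c + h ∈ C₂)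
    (hs : (C₂ \ C₁).card + Nat.card (H₁ ⊓ H₂ : AddSubgroup G) < Nat.card H₁)
    (ht : (C₁ \ C₂).card + Nat.card (H₁ ⊓ H₂ : AddSubgroup G) < Nat.card H₂)
    {x : G} (hx : x ∈ C₂ \ C₁) : Nat.card H₂ < Nat.card H₁ := by
  rw [card_subgroup_eq_filter, card_subgroup_eq_filter] at hs ht ⊢
  set D := Finset.univ.filter (· ∈ H₁ ⊓ H₂) with hD
  set F₁ := Finset.univ.filter (· ∈ H₁) with hF₁
  set F₂ := Finset.univ.filter (· ∈ H₂) with hF₂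
  obtain ⟨hx2, hx1⟩ := Finset.mem_sdiff.1 hx
  set W := F₁.filter (fun g => x + g ∈ C₂) with hW
  set W' := F₁.filter (fun g => x + g ∉ C₂) with hW'
  set U := F₂.filter (fun g => x + g ∈ C₁) with hU
  set U' := F₂.filter (fun g => x + g ∉ C₁) with hU'
  have n₁ : ∀ c, c ∉ C₁ → ∀ h ∈ H₁, c + h ∉ C₁ := fun c hc h hh hm => hc (by
    simpa using h₁ _ hm _ (H₁.neg_mem hh))
  have n₂ : ∀ c, c ∉ C₂ → ∀ h ∈ H₂, c + h ∉ C₂ := fun c hc h hh hm => hc (by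
    simpa using h₂ _ hm _ (H₂.neg_mem hh))
  have cW : W.card + W'.card = F₁.card := Finset.card_filter_add_card_filter_not ..
  have cU : U.card + U'.card = F₂.card := Finset.card_filter_add_card_filter_not ..
  have trans : ∀ S : Finset G, (∀ g ∈ S, ∀ k ∈ H₁ ⊓ H₂, g + k ∈ S) → S.Nonempty →
      D.card ≤ S.card := by
    rintro S hS ⟨g, hg⟩
    refine Finset.card_le_card_of_injOn (fun k => g + k) (fun k hk => ?_)
      (fun a _ b _ h => by simpa using h)
    exact hS g hg k (by simpa [hD] using hk)
  have dW : D.card ≤ W.card := by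
    refine Finset.card_le_card fun k hk => ?_
    simp only [hD, hW, hF₁, Finset.mem_filter, Finset.mem_univ, true_and, AddSubgroup.mem_inf] at hk ⊢
    exact ⟨hk.1, h₂ _ hx2 _ hk.2⟩
  have dU' : D.card ≤ U'.card := by
    refine Finset.card_le_card fun k hk => ?_
    simp only [hD, hU', hF₂, Finset.mem_filter, Finset.mem_univ, true_and,
      AddSubgroup.mem_inf] at hk ⊢
    exact ⟨hk.2, n₁ _ hx1 _ hk.1⟩
  have dU : U.Nonempty → D.card ≤ U.card := trans _ fun g hg k hk => by
    simp only [hU, hF₂, Finset.mem_filter, Finset.mem_univ, true_and, AddSubgroup.mem_inf]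
      at hg hk ⊢
    exact ⟨H₂.add_mem hg.1 hk.2, by simpa [add_assoc] using h₁ _ hg.2 _ hk.1⟩
  have dW' : W'.Nonempty → D.card ≤ W'.card := trans _ fun g hg k hk => by
    simp only [hW', hF₁, Finset.mem_filter, Finset.mem_univ, true_and, AddSubgroup.mem_inf]
      at hg hk ⊢
    exact ⟨H₁.add_mem hg.1 hk.1, by simpa [add_assoc] using n₂ _ hg.2 _ hk.2⟩
  -- Two representations `x + a + b` of the same point differ by an element of `H₁ ⊓ H₂`, so each
  -- point has at most `|D|` of them.
  have fib : ∀ (S T R : Finset G), S ⊆ F₁ → T ⊆ F₂ →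
      (∀ a ∈ S, ∀ b ∈ T, x + a + b ∈ R) → S.card * T.card ≤ D.card * R.card := by
    intro S T R hS hT hR
    rw [← Finset.card_product]
    refine Finset.card_le_mul_card_image_of_maps_to (f := fun q : G × G => x + q.1 + q.2)
      (fun q hq => ?_) _ (fun r _ => ?_)
    · rw [Finset.mem_product] at hq
      exact hR _ hq.1 _ hq.2
    · rcases (Finset.filter (fun q : G × G => x + q.1 + q.2 = r) (S ×ˢ T)).eq_empty_or_nonempty
        with he | ⟨q, hq⟩
      · simp [he]
      · refine Finset.card_le_card_of_injOn (fun q' => q'.1 - q.1) (fun q' hq' => ?_) ?_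
        · simp only [Finset.coe_filter, Finset.mem_filter, Finset.mem_product,
            Set.mem_ofPred_eq] at hq hq'
          have e : q'.1 - q.1 = q.2 - q'.2 := by
            have := hq'.2.trans hq.2.symm
            rw [add_assoc, add_assoc, add_right_inj] at this
            rw [sub_eq_sub_iff_add_eq_add, this, add_comm]
          simp only [hD, Finset.coe_filter, Finset.mem_univ, true_and, Set.mem_ofPred_eq,
            AddSubgroup.mem_inf]
          have a1 := hS hq'.1.1
          have a2 := hS hq.1.1
          have a3 := hT hq'.1.2
          have a4 := hT hq.1.2
          simp only [hF₁, hF₂, Finset.mem_filter, Finset.mem_univ, true_and] at a1 a2 a3 a4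
          exact ⟨H₁.sub_mem a1 a2, e ▸ H₂.sub_mem a4 a3⟩
        · intro q₁ hq₁ q₂ hq₂ h
          simp only [Finset.coe_filter, Finset.mem_product, Set.mem_ofPred_eq] at hq₁ hq₂
          have e1 : q₁.1 = q₂.1 := by simpa using h
          have e2 := hq₁.2.trans hq₂.2.symm
          rw [e1, add_right_inj] at e2
          exact Prod.ext e1 e2
  have b1 := fib W U' (C₂ \ C₁) (Finset.filter_subset ..) (Finset.filter_subset ..) (by
    intro a ha b hb
    simp only [hW, hU', hF₁, hF₂, Finset.mem_filter, Finset.mem_univ, true_and] at ha hb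
    refine Finset.mem_sdiff.2 ⟨h₂ _ ha.2 _ hb.1, ?_⟩
    rw [add_right_comm]
    exact n₁ _ hb.2 _ ha.1)
  have b2 := fib W' U (C₁ \ C₂) (Finset.filter_subset ..) (Finset.filter_subset ..) (by
    intro a ha b hb
    simp only [hW', hU, hF₁, hF₂, Finset.mem_filter, Finset.mem_univ, true_and] at ha hb
    refine Finset.mem_sdiff.2 ⟨?_, n₂ _ ha.2 _ hb.1⟩
    rw [add_right_comm]
    exact h₁ _ hb.2 _ ha.1)
  have Dpos : 0 < D.card := Finset.card_pos.2 ⟨0, by simp [hD]⟩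
  rcases W'.eq_empty_or_nonempty with hW0 | hW0
  · have : W.card = F₁.card := by rw [← cW, hW0]; simp
    rw [this] at b1
    nlinarith
  · have e1 := dW' hW0
    rcases U.eq_empty_or_nonempty with hU0 | hU0
    · have : U'.card = F₂.card := by rw [← cU, hU0]; simp
      rw [this] at b1
      nlinarith
    · have e2 := dU hU0
      exfalso
      obtain ⟨w, hw⟩ := Nat.exists_eq_add_of_le dW
      obtain ⟨w', hw'⟩ := Nat.exists_eq_add_of_le e1
      obtain ⟨u, hu⟩ := Nat.exists_eq_add_of_le e2
      obtain ⟨u', hu'⟩ := Nat.exists_eq_add_of_le dU'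
      rw [hw, hu'] at b1
      rw [hw', hu] at b2
      rw [← cW, hw, hw'] at hs
      rw [← cU, hu, hu'] at ht
      generalize D.card = d at *
      generalize (C₂ \ C₁).card = s at *
      generalize (C₁ \ C₂).card = t at *
      have k1 : d * s + d ≤ d * (w + w' + d) := by nlinarith
      have k2 : d * t + d ≤ d * (u + u' + d) := by nlinarith
      nlinarith [Nat.zero_le (w * u'), Nat.zero_le (w' * u)]

/-- If `H₁ ⊓ H₂` is too small a period for the union and neither set contains the other,
`card_lt_of_mem_sdiff` applies in both directions and yields `|H₂| < |H₁| < |H₂|`. -/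
lemma HasLargePeriod.union {C₁ C₂ : Finset G} {m : ℕ} (g₁ : HasLargePeriod C₁ m)
    (g₂ : HasLargePeriod C₂ m) : HasLargePeriod (C₁ ∪ C₂) m := by
  obtain ⟨H₁, h₁, e₁⟩ := g₁
  obtain ⟨H₂, h₂, e₂⟩ := g₂
  by_contra hcon
  have hlt : (C₁ ∪ C₂).card + Nat.card (H₁ ⊓ H₂ : AddSubgroup G) < m := by
    by_contra hle
    refine hcon ⟨H₁ ⊓ H₂, fun c hc h hh => ?_, not_lt.1 hle⟩
    rcases Finset.mem_union.1 hc with hc | hc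
    · exact Finset.mem_union_left _ (h₁ c hc h hh.1)
    · exact Finset.mem_union_right _ (h₂ c hc h hh.2)
  have c1 : (C₁ ∪ C₂).card = C₁.card + (C₂ \ C₁).card := by
    rw [← Finset.union_sdiff_self_eq_union, Finset.card_union_of_disjoint Finset.disjoint_sdiff]
  have c2 : (C₁ ∪ C₂).card = C₂.card + (C₁ \ C₂).card := by
    rw [Finset.union_comm, ← Finset.union_sdiff_self_eq_union,
      Finset.card_union_of_disjoint Finset.disjoint_sdiff]
  rcases (C₂ \ C₁).eq_empty_or_nonempty with h | ⟨x, hx⟩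
  · rw [Finset.sdiff_eq_empty_iff_subset] at h
    exact hcon ⟨H₁, by rwa [Finset.union_eq_left.2 h], by rwa [Finset.union_eq_left.2 h]⟩
  rcases (C₁ \ C₂).eq_empty_or_nonempty with h | ⟨y, hy⟩
  · rw [Finset.sdiff_eq_empty_iff_subset] at h
    exact hcon ⟨H₂, by rwa [Finset.union_eq_right.2 h], by rwa [Finset.union_eq_right.2 h]⟩
  have l1 := card_lt_of_mem_sdiff h₁ h₂ (by omega) (by omega) hx
  have l2 := card_lt_of_mem_sdiff h₂ h₁ (by rw [inf_comm]; omega) (by rw [inf_comm]; omega) hy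
  omega

/-- Dyson's transform with `e = a' - b` moves elements from `B` to `A`, keeps `|A| + |B|`, and keeps
`a ∈ A` and `b ∈ B`. When no such transform shrinks `B`, translation by `B - b` preserves `A`, so `A
+ b` is periodic under the group generated by `B - b`, which has at least `|B|` elements. -/
lemma exists_hasLargePeriod_subset (n : ℕ) : ∀ (A B : Finset G), B.card = n → ∀ a ∈ A, ∀ b ∈ B,
    ∃ C ⊆ A + B, a + b ∈ C ∧ HasLargePeriod C (A.card + B.card) := by
  induction n using Nat.strong_induction_on with
  | _ n ih =>
    intro A B hB a ha b hb
    by_cases hex : ∃ a' ∈ A, ∃ b' ∈ B, a' - b + b' ∉ A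
    · obtain ⟨a', ha', b', hb', hn⟩ := hex
      set e := a' - b with he
      set A' := A ∪ B.image (e + ·) with hA'
      set B' := B.filter (fun y => e + y ∈ A) with hB'
      have hlt : B'.card < n := by
        rw [← hB]
        exact Finset.card_lt_card (Finset.filter_ssubset.2 ⟨b', hb', hn⟩)
      obtain ⟨C, hC, hab, hL⟩ := ih _ hlt A' B' rfl a (Finset.mem_union_left _ ha) b
        (Finset.mem_filter.2 ⟨hb, by simpa [he] using ha'⟩)
      refine ⟨C, hC.trans ?_, hab, ?_⟩
      · intro z hz
        obtain ⟨p, hp, q, hq, rfl⟩ := Finset.mem_add.1 hz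
        rw [hB', Finset.mem_filter] at hq
        rcases Finset.mem_union.1 hp with hp | hp
        · exact Finset.add_mem_add hp hq.1
        · obtain ⟨y, hy, rfl⟩ := Finset.mem_image.1 hp
          rw [add_right_comm]
          exact Finset.add_mem_add hq.2 hy
      · have hinter : (A ∩ B.image (e + ·)).card = B'.card := by
          rw [← Finset.card_image_of_injective B' (add_right_injective e)]
          congr 1
          ext z
          simp only [hB', Finset.mem_inter, Finset.mem_image, Finset.mem_filter]
          constructor
          · rintro ⟨hz, y, hy, rfl⟩
            exact ⟨y, ⟨hy, hz⟩, rfl⟩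
          · rintro ⟨y, ⟨hy, hz⟩, rfl⟩
            exact ⟨hz, y, hy, rfl⟩
        have := Finset.card_union_add_card_inter A (B.image (e + ·))
        rw [hinter, Finset.card_image_of_injective B (add_right_injective e)] at this
        rwa [← this]
    · push Not at hex
      set H := AddSubgroup.closure ((fun y => y - b) '' (B : Set G)) with hH
      have hstab : ∀ h ∈ H, ∀ x, x ∈ A ↔ x + h ∈ A := by
        intro h hh
        induction hh using AddSubgroup.closure_induction with
        | mem h hh =>
          obtain ⟨y, hy, rfl⟩ := hh
          have sub : A.image (· + (y - b)) ⊆ A := by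
            intro z hz
            obtain ⟨x, hx, rfl⟩ := Finset.mem_image.1 hz
            have := hex x hx y hy
            rwa [show x + (y - b) = x - b + y by abel]
          have eq := Finset.eq_of_subset_of_card_le sub
            (by rw [Finset.card_image_of_injective _ (add_left_injective (y - b))])
          intro x
          constructor
          · intro hx
            exact sub (Finset.mem_image_of_mem _ hx)
          · intro hx
            rw [← eq] at hx
            obtain ⟨x', hx', h⟩ := Finset.mem_image.1 hx
            rwa [← add_right_cancel h]
        | zero => simp
        | add p q _ _ hp hq =>
          intro x
          rw [hp x, hq (x + p), add_assoc]
        | neg p _ hp =>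
          intro x
          rw [hp (x + -p)]
          simp
      refine ⟨A.image (· + b), ?_, Finset.mem_image_of_mem _ ha, H, ?_, ?_⟩
      · intro z hz
        obtain ⟨x, hx, rfl⟩ := Finset.mem_image.1 hz
        exact Finset.add_mem_add hx hb
      · intro c hc h hh
        obtain ⟨x, hx, rfl⟩ := Finset.mem_image.1 hc
        refine Finset.mem_image.2 ⟨x + h, (hstab h hh x).1 hx, add_right_comm ..⟩
      · rw [Finset.card_image_of_injective _ (add_left_injective b)]
        have : B.card ≤ Nat.card H := by
          classical
          rw [card_subgroup_eq_filter]
          refine Finset.card_le_card_of_injOn (fun y => y - b) (fun y hy => ?_)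
            (fun p _ q _ h => by simpa using h)
          simp only [Finset.coe_filter, Finset.mem_univ, true_and, Set.mem_ofPred_eq]
          exact AddSubgroup.subset_closure ⟨y, hy, rfl⟩
        omega

lemma hasLargePeriod_add {A B : Finset G} (hA : A.Nonempty) (hB : B.Nonempty) :
    HasLargePeriod (A + B) (A.card + B.card) := by
  have key : ∀ S : Finset G, S.Nonempty → S ⊆ A + B →
      ∃ C ⊆ A + B, S ⊆ C ∧ HasLargePeriod C (A.card + B.card) := by
    intro S hS
    induction hS using Finset.Nonempty.cons_induction with
    | singleton z =>
      intro hz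
      obtain ⟨a, ha, b, hb, rfl⟩ := Finset.mem_add.1 (hz (Finset.mem_singleton_self z))
      obtain ⟨C, hC, hab, hL⟩ := exists_hasLargePeriod_subset _ A B rfl a ha b hb
      exact ⟨C, hC, by simpa using hab, hL⟩
    | cons z S hzS hS ih =>
      intro hsub
      rw [Finset.cons_eq_insert] at *
      obtain ⟨C, hC, hSC, hL⟩ := ih ((Finset.subset_insert _ _).trans hsub)
      obtain ⟨a, ha, b, hb, rfl⟩ := Finset.mem_add.1 (hsub (Finset.mem_insert_self ..))
      obtain ⟨C', hC', hab, hL'⟩ := exists_hasLargePeriod_subset _ A B rfl a ha b hb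
      refine ⟨C' ∪ C, Finset.union_subset hC' hC, ?_, hL'.union hL⟩
      exact Finset.insert_subset (Finset.mem_union_left _ hab)
        (hSC.trans Finset.subset_union_right)
  obtain ⟨C, hC, hS, hL⟩ := key (A + B) (hA.add hB) subset_rfl
  rwa [Finset.Subset.antisymm hS hC]

/-- The union of the cosets of `H` that meet `X`. -/
noncomputable def cosetHull (X : Finset G) (H : AddSubgroup G) : Finset G :=
  open Classical in Finset.univ.filter (fun g => ∃ x ∈ X, g - x ∈ H)

lemma mem_cosetHull {X : Finset G} {H : AddSubgroup G} {g : G} :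
    g ∈ cosetHull X H ↔ ∃ x ∈ X, g - x ∈ H := by
  classical
  simp [cosetHull]

lemma subset_cosetHull (X : Finset G) (H : AddSubgroup G) : X ⊆ cosetHull X H :=
  fun x hx => mem_cosetHull.2 ⟨x, hx, by simp [H.zero_mem]⟩

lemma add_mem_cosetHull {X : Finset G} {H : AddSubgroup G} {g h : G} (hg : g ∈ cosetHull X H)
    (hh : h ∈ H) : g + h ∈ cosetHull X H := by
  obtain ⟨x, hx, hgx⟩ := mem_cosetHull.1 hg
  exact mem_cosetHull.2 ⟨x, hx, by simpa [add_sub_right_comm] using H.add_mem hgx hh⟩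

/-- **Kneser's theorem** for finite abelian groups. -/
theorem kneser {A B : Finset G} (hA : A.Nonempty) (hB : B.Nonempty) :
    ∃ H : AddSubgroup G, (∀ c ∈ A + B, ∀ h ∈ H, c + h ∈ A + B) ∧
      (cosetHull A H).card + (cosetHull B H).card ≤ (A + B).card + Nat.card H := by
  set H : AddSubgroup G := AddAction.stabilizer G (A + B) with hH
  have hper : ∀ c ∈ A + B, ∀ h ∈ H, c + h ∈ A + B := by
    intro c hc h hh
    have : h +ᵥ (A + B) = A + B := hh
    have h2 := Finset.vadd_mem_vadd_finset (a := h) hc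
    rw [this] at h2
    rwa [vadd_eq_add, add_comm h c] at h2
  refine ⟨H, hper, ?_⟩
  -- Replacing both summands by their hulls leaves the sumset unchanged, so the weaker bound for the
  -- hulls is already the full Kneser inequality; its period lies in the stabilizer `H`.
  have hsum : cosetHull A H + cosetHull B H = A + B := by
    refine Finset.Subset.antisymm (fun z hz => ?_)
      (Finset.add_subset_add (subset_cosetHull ..) (subset_cosetHull ..))
    obtain ⟨p, hp, q, hq, rfl⟩ := Finset.mem_add.1 hz
    obtain ⟨a, ha, hpa⟩ := mem_cosetHull.1 hp
    obtain ⟨b, hb, hqb⟩ := mem_cosetHull.1 hq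
    have := hper _ (Finset.add_mem_add ha hb) _ (H.add_mem hpa hqb)
    rwa [show a + b + (p - a + (q - b)) = p + q by abel] at this
  obtain ⟨K, hK, hle⟩ := hasLargePeriod_add (hA.mono (subset_cosetHull A H))
    (hB.mono (subset_cosetHull B H))
  rw [hsum] at hK hle
  refine hle.trans (Nat.add_le_add_left ?_ _)
  refine Nat.card_mono (Set.toFinite _) fun k hk => ?_
  change k +ᵥ (A + B) = A + B
  refine Finset.eq_of_subset_of_card_le (fun z hz => ?_) (by rw [Finset.card_vadd_finset])
  obtain ⟨c, hc, rfl⟩ := Finset.mem_vadd_finset.1 hz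
  change k + c ∈ A + B
  rw [add_comm k c]
  exact hK c hc k hk

end Kneser

/-! ### Sum-free triples of fibres of a linear map -/

theorem fact_prime_five : Fact (Nat.Prime 5) := ⟨by norm_num⟩

section PrimeField

attribute [local instance] fact_prime_five

section Fibres

variable {G : Type*} [AddCommGroup G] [Fintype G] [DecidableEq G]

lemma exists_card_eq_mul_of_periodic (X : Finset G) (H : AddSubgroup G)
    (hX : ∀ x ∈ X, ∀ h ∈ H, x + h ∈ X) : ∃ k, X.card = k * Nat.card H := by
  classical
  refine ⟨(X.image (QuotientAddGroup.mk : G → G ⧸ H)).card, ?_⟩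
  rw [Finset.card_eq_sum_card_image (QuotientAddGroup.mk : G → G ⧸ H) X]
  refine Finset.sum_const_nat fun q hq => ?_
  obtain ⟨x, hx, rfl⟩ := Finset.mem_image.1 hq
  rw [card_subgroup_eq_filter]
  refine Finset.card_bij' (fun y _ => y - x) (fun h _ => x + h) ?_ ?_ (by simp) (by simp)
  · intro y hy
    rw [Finset.mem_filter, eq_comm, QuotientAddGroup.eq] at hy
    simpa [sub_eq_neg_add] using hy.2
  · intro h hh
    have : h ∈ H := by simpa using hh
    rw [Finset.mem_filter, eq_comm, QuotientAddGroup.eq]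
    exact ⟨hX x hx h this, by simpa using this⟩

lemma cosetHull_eq_self {X : Finset G} {H : AddSubgroup G} (h : (cosetHull X H).card ≤ X.card) :
    cosetHull X H = X :=
  (Finset.eq_of_subset_of_card_le (subset_cosetHull X H) h).symm

variable [Module (ZMod 5) G]

lemma exists_card_eq_mul_of_lt {H V : Submodule (ZMod 5) G} (h : H < V) :
    ∃ M, Nat.card V = M * Nat.card H ∧ (M = 5 ∨ 25 ∣ M) := by
  have hf := Submodule.finrank_lt_finrank_of_lt h
  have hc : ∀ W : Submodule (ZMod 5) G, Nat.card W = 5 ^ Module.finrank (ZMod 5) W := fun W => by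
    rw [Module.natCard_eq_pow_finrank (K := ZMod 5), Nat.card_zmod]
  obtain ⟨k, hk⟩ := Nat.exists_eq_add_of_lt hf
  refine ⟨5 ^ (k + 1), ?_, ?_⟩
  · rw [hc, hc, hk, ← pow_add]; congr 1; ring
  · rcases k with _ | k
    · simp
    · exact Or.inr ⟨5 ^ k, by ring⟩

/-- Take the Kneser period of `X + Y`. It is a subspace because the field is prime, and lies in `ker
φ` because `X + Y` is in a single fibre. Saturating `Z` keeps it disjoint from the periodic set `X +
Y`, so both fit into one fibre; counting cosets gives `x' + y' + z' ≤ M + 1`. -/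
theorem exists_submodule_of_add_notMem {W : Type*} [AddCommGroup W] [Module (ZMod 5) W]
    (φ : G →ₗ[ZMod 5] W) {X Y Z : Finset G} {u v : W} (hX : X.Nonempty) (hY : Y.Nonempty)
    (hZ : Z.Nonempty) (hu : ∀ x ∈ X, φ x = u) (hv : ∀ y ∈ Y, φ y = v)
    (hw : ∀ z ∈ Z, φ z = u + v) (hd : ∀ x ∈ X, ∀ y ∈ Y, x + y ∉ Z) :
    ∃ (H : Submodule (ZMod 5) G) (M x' y' z' : ℕ), H ≤ LinearMap.ker φ ∧
      Nat.card (LinearMap.ker φ) = M * Nat.card H ∧ (M = 5 ∨ 25 ∣ M) ∧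
      1 ≤ x' ∧ 1 ≤ y' ∧ 1 ≤ z' ∧ (cosetHull X H.toAddSubgroup).card = x' * Nat.card H ∧
      (cosetHull Y H.toAddSubgroup).card = y' * Nat.card H ∧
      (cosetHull Z H.toAddSubgroup).card = z' * Nat.card H ∧ x' + y' + z' ≤ M + 1 ∧
      ∀ x ∈ cosetHull X H.toAddSubgroup, ∀ y ∈ cosetHull Y H.toAddSubgroup,
        x + y ∉ cosetHull Z H.toAddSubgroup := by
  obtain ⟨H₀, hper, hle⟩ := kneser hX hY
  set H : Submodule (ZMod 5) G := AddSubgroup.toZModSubmodule 5 H₀ with hH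
  have hH₀ : H.toAddSubgroup = H₀ := rfl
  have hcard : Nat.card H = Nat.card H₀ := rfl
  have hpos : 0 < Nat.card H := Nat.card_pos
  have hdis : ∀ x ∈ cosetHull X H₀, ∀ y ∈ cosetHull Y H₀, x + y ∉ cosetHull Z H₀ := by
    intro x hx y hy hz
    obtain ⟨a, ha, hxa⟩ := mem_cosetHull.1 hx
    obtain ⟨b, hb, hyb⟩ := mem_cosetHull.1 hy
    obtain ⟨c, hc, hzc⟩ := mem_cosetHull.1 hz
    have h1 := hper _ (Finset.add_mem_add ha hb) _
      (H₀.sub_mem (H₀.add_mem hxa hyb) hzc)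
    rw [show a + b + (x - a + (y - b) - (x + y - c)) = c by abel] at h1
    obtain ⟨p, hp, q, hq, hpq⟩ := Finset.mem_add.1 h1
    exact hd p hp q hq (hpq ▸ hc)
  have hHV : H ≤ LinearMap.ker φ := by
    intro h hh
    obtain ⟨x, hx⟩ := hX
    obtain ⟨y, hy⟩ := hY
    have h1 := hper _ (Finset.add_mem_add hx hy) h hh
    obtain ⟨p, hp, q, hq, hpq⟩ := Finset.mem_add.1 h1
    have := congrArg φ hpq
    simp only [map_add, hu _ hp, hv _ hq, hu _ hx, hv _ hy] at this
    simpa using this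
  have hhull : ∀ (T : Finset G) (w : W), (∀ t ∈ T, φ t = w) →
      ∀ t ∈ cosetHull T H₀, φ t = w := by
    intro T w hT t ht
    obtain ⟨a, ha, hta⟩ := mem_cosetHull.1 ht
    have : φ (t - a) = 0 := hHV hta
    rw [map_sub, hT a ha, sub_eq_zero] at this
    exact this
  -- the sumset and the hull of `Z` are disjoint subsets of one fibre
  have hfib : (X + Y).card + (cosetHull Z H₀).card ≤ Nat.card (LinearMap.ker φ) := by
    classical
    rw [← Finset.card_union_of_disjoint]
    · obtain ⟨x, hx⟩ := hX
      obtain ⟨y, hy⟩ := hY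
      rw [Nat.card_eq_fintype_card, Fintype.card_subtype]
      refine Finset.card_le_card_of_injOn (fun g => g - (x + y)) (fun g hg => ?_)
        (fun a _ b _ h => by simpa using h)
      have hg' : φ g = u + v := by
        rcases Finset.mem_union.1 hg with hg | hg
        · obtain ⟨p, hp, q, hq, rfl⟩ := Finset.mem_add.1 hg
          rw [map_add, hu _ hp, hv _ hq]
        · exact hhull Z _ hw g hg
      simp [hg', hu _ hx, hv _ hy]
    · rw [Finset.disjoint_left]
      intro g hg hgz
      obtain ⟨p, hp, q, hq, rfl⟩ := Finset.mem_add.1 hg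
      exact hdis p (subset_cosetHull _ _ hp) q (subset_cosetHull _ _ hq) hgz
  have hk : ∀ T : Finset G, T.Nonempty →
      ∃ k, 1 ≤ k ∧ (cosetHull T H₀).card = k * Nat.card H₀ := by
    intro T hT
    obtain ⟨k, hk⟩ := exists_card_eq_mul_of_periodic (cosetHull T H₀) H₀
      (fun x hx h hh => add_mem_cosetHull hx hh)
    refine ⟨k, Nat.one_le_iff_ne_zero.2 ?_, hk⟩
    rintro rfl
    have := (hT.mono (subset_cosetHull T H₀)).card_pos
    omega
  obtain ⟨x', hx1, hx'⟩ := hk X hX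
  obtain ⟨y', hy1, hy'⟩ := hk Y hY
  obtain ⟨z', hz1, hz'⟩ := hk Z hZ
  have hsum : (x' + y' + z') * Nat.card H₀ ≤
      Nat.card (LinearMap.ker φ) + Nat.card H₀ := by
    rw [add_mul, add_mul, ← hx', ← hy', ← hz']; omega
  -- A period equal to the whole kernel would give `x' + y' + z' ≤ 2`, but each is at least one.
  -- This excludes `M = 1`.
  have hlt : H < LinearMap.ker φ := by
    refine lt_of_le_of_ne hHV fun h => ?_
    rw [← h, hcard] at hsum
    rw [hcard] at hpos
    nlinarith
  obtain ⟨M, hM, hM5⟩ := exists_card_eq_mul_of_lt hlt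
  refine ⟨H, M, x', y', z', hHV, hM, hM5, hx1, hy1, hz1, hx', hy', hz', ?_, hdis⟩
  rw [hM, hcard] at hsum
  rw [hcard] at hpos
  refine Nat.le_of_mul_le_mul_right (c := Nat.card H₀) ?_ hpos
  linarith

end Fibres

/-! ### Kneser's theorem in terms of densities -/

/-- The relation between the densities `x`, `y`, `z` of nonempty `X`, `Y`, `Z` in three cosets of
an `𝔽₅`-space such that `X + Y` and `Z` are disjoint, obtained from Kneser's theorem. -/
def Tri (x y z : ℝ) : Prop :=
  ∃ M x' y' z' : ℕ, (M = 5 ∨ 25 ∣ M) ∧ 1 ≤ x' ∧ 1 ≤ y' ∧ 1 ≤ z' ∧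
    x * M ≤ x' ∧ y * M ≤ y' ∧ z * M ≤ z' ∧ x' + y' + z' ≤ M + 1

namespace Tri

variable {x y z : ℝ}

lemma rotate (h : Tri x y z) : Tri y z x := by
  obtain ⟨M, x', y', z', hM, h1, h2, h3, h4, h5, h6, h7⟩ := h
  exact ⟨M, y', z', x', hM, h2, h3, h1, h5, h6, h4, by omega⟩

lemma swap (h : Tri x y z) : Tri y x z := by
  obtain ⟨M, x', y', z', hM, h1, h2, h3, h4, h5, h6, h7⟩ := h
  exact ⟨M, y', x', z', hM, h2, h1, h3, h5, h4, h6, by omega⟩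

/-- Either the triple is small, or its members are bounded by fifths adding up to `6 / 5`. -/
lemma cases (h : Tri x y z) : (x + y + z ≤ 1.04 ∧ ∃ M x' y' z' : ℕ, 25 ∣ M ∧ 25 ≤ M ∧
      1 ≤ x' ∧ 1 ≤ y' ∧ 1 ≤ z' ∧
      x * M ≤ x' ∧ y * M ≤ y' ∧ z * M ≤ z' ∧ x' + y' + z' ≤ M + 1) ∨
    ∃ x' y' z' : ℕ, 1 ≤ x' ∧ 1 ≤ y' ∧ 1 ≤ z' ∧ 5 * x ≤ x' ∧ 5 * y ≤ y' ∧ 5 * z ≤ z' ∧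
      x' + y' + z' ≤ 6 := by
  obtain ⟨M, x', y', z', hM, h1, h2, h3, h4, h5, h6, h7⟩ := h
  rcases hM with rfl | hM
  · right
    exact ⟨x', y', z', h1, h2, h3, by push_cast at *; linarith, by push_cast at *; linarith,
      by push_cast at *; linarith, h7⟩
  · left
    have hM' : 25 ≤ M := Nat.le_of_dvd (by omega) hM
    refine ⟨?_, M, x', y', z', hM, hM', h1, h2, h3, h4, h5, h6, h7⟩
    have h8 : (x' : ℝ) + y' + z' ≤ M + 1 := by exact_mod_cast h7
    have h9 : (25 : ℝ) ≤ M := by exact_mod_cast hM'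
    by_contra! hc
    nlinarith

lemma add_add_le (h : Tri x y z) : x + y + z ≤ 1.2 := by
  rcases h.cases with ⟨h, -⟩ | ⟨x', y', z', -, -, -, h4, h5, h6, h7⟩
  · linarith
  · have : (x' : ℝ) + y' + z' ≤ 6 := by exact_mod_cast h7
    linarith

/-- If one density exceeds a multiple of `1 / 5`, the other two leave room for it. -/
lemma add_le_of_lt (h : Tri x y z) (k : ℕ) (hz : (k : ℝ) / 5 < z) : x + y ≤ 1 - k / 5 := by
  obtain ⟨M, x', y', z', hM, h1, h2, h3, h4, h5, h6, h7⟩ := h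
  have h5M : ∃ m, M = 5 * m := by
    rcases hM with rfl | ⟨m, rfl⟩
    · exact ⟨1, rfl⟩
    · exact ⟨5 * m, by ring⟩
  obtain ⟨m, rfl⟩ := h5M
  have hm : 0 < m := by omega
  have hm' : (0 : ℝ) < m := by exact_mod_cast hm
  push_cast at h4 h5 h6
  have : k * m < z' := by
    have : (k * m : ℝ) < z' := by nlinarith
    exact_mod_cast this
  have h8 : x' + y' + k * m ≤ 5 * m := by omega
  have h9 : (x' : ℝ) + y' + k * m ≤ 5 * m := by exact_mod_cast h8
  by_contra! hc
  nlinarith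

lemma one_of_pos (h : Tri x y z) (hz : 0 < z) : x + y ≤ 1 := by
  simpa using h.add_le_of_lt 0 (by simpa using hz)

end Tri

/-! ### Linear inequalities between densities -/

/-- Once a vertex of the five-cycle is empty, the nonempty vertices are covered by two edges, an
edge and a vertex, or two vertices. -/
lemma cycle_sum_le {c₀ c₁ c₂ c₃ c₄ K F : ℝ} (h₀ : 0 ≤ c₀) (h₁ : 0 ≤ c₁) (h₂ : 0 ≤ c₂)
    (h₃ : 0 ≤ c₃) (h₄ : 0 ≤ c₄) (f₀ : c₀ ≤ F) (f₁ : c₁ ≤ F) (f₂ : c₂ ≤ F) (f₃ : c₃ ≤ F)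
    (f₄ : c₄ ≤ F) (h₀₁ : 0 < c₀ → 0 < c₁ → c₀ + c₁ ≤ K) (h₁₂ : 0 < c₁ → 0 < c₂ → c₁ + c₂ ≤ K)
    (h₂₃ : 0 < c₂ → 0 < c₃ → c₂ + c₃ ≤ K) (h₃₄ : 0 < c₃ → 0 < c₄ → c₃ + c₄ ≤ K)
    (h₄₀ : 0 < c₄ → 0 < c₀ → c₄ + c₀ ≤ K) :
    (0 < c₀ ∧ 0 < c₁ ∧ 0 < c₂ ∧ 0 < c₃ ∧ 0 < c₄) ∨
      c₀ + c₁ + c₂ + c₃ + c₄ ≤ 2 * K ∨ c₀ + c₁ + c₂ + c₃ + c₄ ≤ 2 * F := by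
  by_cases hKF : K ≤ F
  all_goals
    rcases h₀.eq_or_lt' with e₀ | e₀ <;> rcases h₁.eq_or_lt' with e₁ | e₁ <;>
    rcases h₂.eq_or_lt' with e₂ | e₂ <;> rcases h₃.eq_or_lt' with e₃ | e₃ <;>
    rcases h₄.eq_or_lt' with e₄ | e₄ <;>
    simp only [e₀, e₁, e₂, e₃, e₄, lt_irrefl, IsEmpty.forall_iff, forall_const] at h₀₁ h₁₂ h₂₃ h₃₄ h₄₀ <;>
    first
    | exact Or.inl ⟨e₀, e₁, e₂, e₃, e₄⟩
    | (right; right; linarith)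
    | (right; left; linarith)

set_option maxHeartbeats 4000000 in
/-- The linear program for the nodes of `𝔽₅²`: `P` and `F` are the densities of the two axes, `g`
that of `±(0, 2)`, and `u₁, …, u₆` those of `±(2, 1)`, `±(2, -1)`, `±(1, 2)`, `±(1, -2)`,
`±(2, 2)`, `±(2, -2)`. -/
lemma nodes_cases {P F g u₁ u₂ u₃ u₄ u₅ u₆ K : ℝ} (hg : 0 ≤ g) (h₁ : 0 ≤ u₁) (h₂ : 0 ≤ u₂)
    (h₃ : 0 ≤ u₃) (h₄ : 0 ≤ u₄) (h₅ : 0 ≤ u₅) (h₆ : 0 ≤ u₆) (fg : g ≤ F) (f₁ : u₁ ≤ F)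
    (f₂ : u₂ ≤ F) (f₃ : u₃ ≤ F) (f₄ : u₄ ≤ F) (f₅ : u₅ ≤ F) (f₆ : u₆ ≤ F) (hFP : F ≤ P)
    (hP : P ≤ 2) (hF : 1.4 - P / 4 ≤ F)
    (htot : 5.6 ≤ P + F + g + u₁ + u₂ + u₃ + u₄ + u₅ + u₆)
    (kg₃ : 0 < g → 0 < u₃ → g + u₃ ≤ K) (kg₄ : 0 < g → 0 < u₄ → g + u₄ ≤ K)
    (k₁₂ : 0 < u₁ → 0 < u₂ → u₁ + u₂ ≤ K) (k₃₅ : 0 < u₃ → 0 < u₅ → u₃ + u₅ ≤ K)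
    (k₄₆ : 0 < u₄ → 0 < u₆ → u₄ + u₆ ≤ K) (k₅₆ : 0 < u₅ → 0 < u₆ → u₅ + u₆ ≤ K)
    (n₁₅ : 0 < u₁ → F + u₅ ≤ 2) (n₅₁ : 0 < u₅ → F + u₁ ≤ 2) (n₂₆ : 0 < u₂ → F + u₆ ≤ 2)
    (n₆₂ : 0 < u₆ → F + u₂ ≤ 2) (n₃₄ : 0 < u₃ → F + u₄ ≤ 2) (n₄₃ : 0 < u₄ → F + u₃ ≤ 2)
    (d₁₄ : 0 < u₁ → 0 < u₄ → 2 * u₁ + u₄ ≤ 2.4) (d₄₁ : 0 < u₁ → 0 < u₄ → 2 * u₄ + u₁ ≤ 2.4)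
    (d₂₃ : 0 < u₂ → 0 < u₃ → 2 * u₂ + u₃ ≤ 2.4) (d₃₂ : 0 < u₂ → 0 < u₃ → 2 * u₃ + u₂ ≤ 2.4)
    (m₄₁ : 0 < u₄ → u₁ ≤ 1)  (m₃₂ : 0 < u₃ → u₂ ≤ 1)
    (dg : 0 < g → 2 * F + g ≤ 2.4) (mg : 0 < g → F ≤ 1)
    (hK : (1.6 < P ∧ K = 2.4 - P) ∨ (1.12 < P ∧ P ≤ 1.44 ∧ K = 2.24 - P) ∨
      (1.44 ≤ P ∧ P ≤ 1.6 ∧ K = 0.8)) :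
    (g = 0 ∧ ((u₂ = 0 ∧ u₄ = 0 ∧ u₅ = 0) ∨ (u₁ = 0 ∧ u₃ = 0 ∧ u₆ = 0))) ∨
    (P = 2 ∧ u₁ = 0.8 ∧ u₄ = 0.8 ∧ F + u₃ + u₅ = 2 ∧ g = 0 ∧ u₂ = 0 ∧ u₆ = 0) ∨
    (P = 2 ∧ u₂ = 0.8 ∧ u₃ = 0.8 ∧ F + u₄ + u₆ = 2 ∧ g = 0 ∧ u₁ = 0 ∧ u₅ = 0) ∨
    (P = 1.6 ∧ 0 < g ∧ 0 < u₃ ∧ 0 < u₄ ∧ 0 < u₅ ∧ 0 < u₆ ∧ 2 ≤ g + u₃ + u₄ + u₅ + u₆) ∨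
    (P = 1.6 ∧ F = 1.6 ∧ 0 < u₁ ∧ 0 < u₂ ∧ 0 < u₃ ∧ 0 < u₄ ∧ 0 < u₅ ∧ 0 < u₆) := by
  -- On each of the three ranges `K` is affine in `P`. Fixing which of the seven nodes vanish then
  -- makes every constraint linear.
  rcases hK with ⟨hK, rfl⟩ | ⟨hK, hK', rfl⟩ | ⟨hK, hK', rfl⟩
  all_goals
    rcases hg.eq_or_lt' with eg | eg <;> rcases h₁.eq_or_lt' with e₁ | e₁ <;>
    rcases h₂.eq_or_lt' with e₂ | e₂ <;> rcases h₃.eq_or_lt' with e₃ | e₃ <;>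
    rcases h₄.eq_or_lt' with e₄ | e₄ <;> rcases h₅.eq_or_lt' with e₅ | e₅ <;>
    rcases h₆.eq_or_lt' with e₆ | e₆ <;>
    first
    | exact Or.inl ⟨eg, Or.inl ⟨e₂, e₄, e₅⟩⟩
    | exact Or.inl ⟨eg, Or.inr ⟨e₁, e₃, e₆⟩⟩
    | (simp only [eg, e₁, e₂, e₃, e₄, e₅, e₆, lt_irrefl, IsEmpty.forall_iff, forall_const]
         at kg₃ kg₄ k₁₂ k₃₅ k₄₆ k₅₆ n₁₅ n₅₁ n₂₆ n₆₂ n₃₄ n₄₃ d₁₄ d₄₁ d₂₃ d₃₂ m₄₁ m₃₂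
           dg mg
       first
       | (exfalso; linarith)
       | exact Or.inr (Or.inl ⟨by linarith, by linarith, by linarith, by linarith, eg, e₂, e₆⟩)
       | exact Or.inr (Or.inr (Or.inl
           ⟨by linarith, by linarith, by linarith, by linarith, eg, e₁, e₅⟩))
       | exact Or.inr (Or.inr (Or.inr (Or.inl
           ⟨by linarith, eg, e₃, e₄, e₅, e₆, by linarith⟩)))
       | exact Or.inr (Or.inr (Or.inr (Or.inr
           ⟨by linarith, by linarith, e₁, e₂, e₃, e₄, e₅, e₆⟩))))

/-! ### Density profiles -/

/-- The properties of the densities of a sum-free set in the fibres of a linear map to `W`. -/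
structure IsProfile {W : Type*} [AddCommGroup W] (a : W → ℝ) : Prop where
  nonneg : ∀ u, 0 ≤ a u
  le_one : ∀ u, a u ≤ 1
  tri_add : ∀ u v, 0 < a u → 0 < a v → 0 < a (u + v) → Tri (a u) (a v) (a (u + v))

/-- The total density of the fibres over `u` and `-u`. -/
def node {W : Type*} [AddCommGroup W] (a : W → ℝ) (u : W) : ℝ := a u + a (-u)

namespace IsProfile

section General

variable {W : Type*} [AddCommGroup W] {a : W → ℝ} {u v w : W}

lemma node_neg : node a (-u) = node a u := by simp [node, add_comm]

lemma node_nonneg (h : IsProfile a) : 0 ≤ node a u := add_nonneg (h.nonneg _) (h.nonneg _)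

lemma node_le_two (h : IsProfile a) : node a u ≤ 2 := by
  unfold node; linarith [h.le_one u, h.le_one (-u)]

lemma tri (h : IsProfile a) (hw : u + v = w) (hu : 0 < a u) (hv : 0 < a v) (hp : 0 < a w) :
    Tri (a u) (a v) (a w) := by subst hw; exact h.tri_add _ _ hu hv hp

/-- The cell inequalities on two nodes opposite to a nonempty third cell. -/
lemma add_le_one (h : IsProfile a) (hw : u + v = w) (hp : 0 < a w) : a u + a v ≤ 1 := by
  rcases (h.nonneg u).eq_or_lt with hu | hu
  · linarith [h.le_one v]
  rcases (h.nonneg v).eq_or_lt with hv | hv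
  · linarith [h.le_one u]
  exact (h.tri hw hu hv hp).one_of_pos hp

lemma add_le_one' (h : IsProfile a) (hw : u + v = w) (hp : 0 < a v) : a u + a w ≤ 1 := by
  rcases (h.nonneg u).eq_or_lt with hu | hu
  · linarith [h.le_one w]
  rcases (h.nonneg w).eq_or_lt with hv | hv
  · linarith [h.le_one u]
  linarith [(h.tri hw hu hp hv).rotate.rotate.one_of_pos hp]

/-- A nonempty cell over `w` lies in a triangle with `u`, `-v` and in one with `v`, `-u`; each of
these two pairs has density at most one. -/
lemma node_add_node_le_two (h : IsProfile a) (hsum : u + v + w = 0) (hw : 0 < node a w) :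
    node a u + node a v ≤ 2 := by
  have h1 : u + w = -v := by rw [eq_neg_iff_add_eq_zero, ← hsum]; abel
  have h2 : v + w = -u := by rw [eq_neg_iff_add_eq_zero, ← hsum]; abel
  have h3 : -u + -w = v := by rw [← neg_add, h1, neg_neg]
  have h4 : -v + -w = u := by rw [← neg_add, h2, neg_neg]
  unfold node at *
  have hw' : 0 < a w ∨ 0 < a (-w) := by
    by_contra! hc; linarith [hc.1, hc.2]
  rcases hw' with hw' | hw'
  · linarith [h.add_le_one' h1 hw', h.add_le_one' h2 hw']
  · linarith [h.add_le_one' h3 hw', h.add_le_one' h4 hw']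

/-- The triangles `u, v, -w` and `-u, -v, w` partition the six cells, and each has density at most
`6/5` when its cells are nonempty. If some cell is empty, one of the other triangles together with a
two-cell bound does the same. -/
lemma node_add_node_add_node_le (h : IsProfile a) (hsum : u + v + w = 0) (hu : 0 < a u)
    (hu' : 0 < a (-u)) (hv : 0 < node a v) (hw : 0 < node a w) :
    node a u + node a v + node a w ≤ 2.4 := by
  have h1 : u + v = -w := by rw [eq_neg_iff_add_eq_zero, ← hsum]
  have h2 : u + w = -v := by rw [eq_neg_iff_add_eq_zero, ← hsum]; abel
  have h3 : v + w = -u := by rw [eq_neg_iff_add_eq_zero, ← hsum]; abel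
  have h4 : -u + -v = w := by rw [← neg_add, h1, neg_neg]
  have h5 : -u + -w = v := by rw [← neg_add, h2, neg_neg]
  have h6 : -v + -w = u := by rw [← neg_add, h3, neg_neg]
  unfold node at *
  have key : ∀ {p q r : W}, p + q = r → 0 < a p → 0 < a q → 0 < a r → a p + a q + a r ≤ 1.2 :=
    fun e k1 k2 k3 => (h.tri e k1 k2 k3).add_add_le
  have := h.le_one u
  have := h.le_one (-u)
  rcases (h.nonneg v).eq_or_lt' with hv1 | hv1 <;>
  rcases (h.nonneg (-v)).eq_or_lt' with hv2 | hv2 <;>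
  rcases (h.nonneg w).eq_or_lt' with hw1 | hw1 <;>
  rcases (h.nonneg (-w)).eq_or_lt' with hw2 | hw2
  all_goals
    first
    | (exfalso; linarith)
    | linarith [key h1 hu hv1 hw2, key h4 hu' hv2 hw1]
    | linarith [key h3 hv1 hw1 hu']
    | linarith [key h1 hu hv1 hw2]
    | linarith [key h4 hu' hv2 hw1]
    | linarith [key h6 hv2 hw2 hu]
    | linarith [key h2 hu hw1 hv2, h.add_le_one' h3 hw1]
    | linarith [key h5 hu' hw2 hv1, h.add_le_one' h6 hw2]
    | linarith [key h1 hu hv1 hw2, h.add_le_one' ((add_comm _ _).trans h3) hv1]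
    | linarith [key h4 hu' hv2 hw1, h.add_le_one' ((add_comm _ _).trans h6) hv2]

/-- If both cells of `u` are nonempty this is the three-node bound with `v = u`. If only one is, the
triangles `w + w = u` and `u + u = -w`, or their negatives, suffice. -/
lemma two_mul_node_add_node_le (h : IsProfile a) (hsum : u + u + w = 0) (hww : w + w = u)
    (hu : 0 < node a u) (hw : 0 < node a w) : 2 * node a u + node a w ≤ 2.4 := by
  have h1 : u + u = -w := by rw [eq_neg_iff_add_eq_zero, ← hsum]
  have h2 : u + w = -u := by rw [eq_neg_iff_add_eq_zero, ← hsum]; abel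
  have h3 : -u + -w = u := by rw [← neg_add, h2, neg_neg]
  have h4 : -u + -u = w := by rw [← neg_add, h1, neg_neg]
  have h5 : -w + -w = -u := by rw [← neg_add, hww]
  have key : ∀ {p q r : W}, p + q = r → 0 < a p → 0 < a q → 0 < a r → a p + a q + a r ≤ 1.2 :=
    fun e k1 k2 k3 => (h.tri e k1 k2 k3).add_add_le
  by_cases hu1 : 0 < a u <;> by_cases hu2 : 0 < a (-u)
  · linarith [h.node_add_node_add_node_le hsum hu1 hu2 hu hw]
  all_goals
    unfold node at *
    have := h.le_one u
    have := h.le_one (-u)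
    have := h.nonneg u
    have := h.nonneg (-u)
    rcases (h.nonneg w).eq_or_lt' with k3 | k3 <;>
    rcases (h.nonneg (-w)).eq_or_lt' with k4 | k4
  all_goals
    first
    | linarith
    | linarith [key hww k3 k3 hu1, key h1 hu1 hu1 k4]
    | linarith [key hww k3 k3 hu1]
    | linarith [key h1 hu1 hu1 k4]
    | linarith [key h5 k4 k4 hu2, key h4 hu2 hu2 k3]
    | linarith [key h5 k4 k4 hu2]
    | linarith [key h4 hu2 hu2 k3]

/-- On a line, two nodes of total density at least `8 / 5` consist of four cells of density
`2 / 5`. -/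
lemma eq_of_le_node_add_node (h : IsProfile a) (hsum : u + u + w = 0) (hww : w + w = u)
    (hu : 0 < node a u) (hw : 0 < node a w) (h16 : 1.6 ≤ node a u + node a w) :
    a u = 0.4 ∧ a (-u) = 0.4 ∧ a w = 0.4 ∧ a (-w) = 0.4 := by
  have h1 : u + u = -w := by rw [eq_neg_iff_add_eq_zero, ← hsum]
  have h2 : u + w = -u := by rw [eq_neg_iff_add_eq_zero, ← hsum]; abel
  have h3 : -u + -w = u := by rw [← neg_add, h2, neg_neg]
  have h4 : -u + -u = w := by rw [← neg_add, h1, neg_neg]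
  have h5 : -w + -w = -u := by rw [← neg_add, hww]
  have h6 : -u + w = -w := by rw [← h5, neg_add_cancel_right]
  have h7 : u + -w = w := by rw [← hww, add_neg_cancel_right]
  have key : ∀ {p q r : W}, p + q = r → 0 < a p → 0 < a q → 0 < a r → a p + a q + a r ≤ 1.2 :=
    fun e k1 k2 k3 => (h.tri e k1 k2 k3).add_add_le
  unfold node at *
  have := h.le_one u
  have := h.le_one (-u)
  have := h.le_one w
  have := h.le_one (-w)
  rcases (h.nonneg u).eq_or_lt' with k1 | k1 <;>
  rcases (h.nonneg (-u)).eq_or_lt' with k2 | k2 <;>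
  rcases (h.nonneg w).eq_or_lt' with k3 | k3 <;>
  rcases (h.nonneg (-w)).eq_or_lt' with k4 | k4
  all_goals
    first
    | (exfalso; linarith)
    -- The four doubling triangles add up to `3 · total ≤ 24/5`, so total `8/5` forces equality in
    -- all of them, and the resulting linear system has the unique solution `2/5`.
    | (have := key h1 k1 k1 k4
       have := key h4 k2 k2 k3
       have := key hww k3 k3 k1
       have := key h5 k4 k4 k2
       refine ⟨?_, ?_, ?_, ?_⟩ <;> linarith)
    | exfalso
  all_goals
    first
    | linarith [key h1 k1 k1 k4]
    | linarith [key h4 k2 k2 k3]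
    | linarith [key hww k3 k3 k1]
    | linarith [key h5 k4 k4 k2]
    | linarith [key h2 k1 k3 k2]
    | linarith [key h3 k2 k4 k1]
    | linarith [key h6 k2 k3 k4]
    | linarith [key h7 k1 k4 k3]

end General

end IsProfile

namespace IsProfile

section General

variable {W : Type*} [AddCommGroup W] {a : W → ℝ} {u v w : W}

lemma node_congr (h : u = v ∨ u = -v) : node a u = node a v := by
  rcases h with rfl | rfl
  · rfl
  · exact node_neg

lemma eq_zero_of_node (h : IsProfile a) (hn : node a v = 0) (hu : u = v ∨ u = -v) : a u = 0 := by
  rw [← node_congr hu] at hn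
  unfold node at hn
  linarith [h.nonneg u, h.nonneg (-u)]

lemma pos_of_one_lt_node (h : IsProfile a) (hn : 1 < node a u) : 0 < a u ∧ 0 < a (-u) := by
  unfold node at hn
  constructor <;> linarith [h.le_one u, h.le_one (-u)]

end General

lemma sum_eq_nodes (a : ZMod 5 × ZMod 5 → ℝ) : ∑ u, a u = a 0 + node a (1, 0) + node a (2, 0) +
    (node a (0, 1) + node a (1, 1) + node a (2, 1) + node a (2, -1) + node a (1, -1)) +
    (node a (0, 2) + node a (1, 2) + node a (2, 2) + node a (2, -2) + node a (1, -2)) := by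
  have : (Finset.univ : Finset (ZMod 5 × ZMod 5)) = {0, (1, 0), -(1, 0), (2, 0), -(2, 0),
    (0, 1), -(0, 1), (1, 1), -(1, 1), (2, 1), -(2, 1), (2, -1), -(2, -1), (1, -1), -(1, -1),
    (0, 2), -(0, 2), (1, 2), -(1, 2), (2, 2), -(2, 2), (2, -2), -(2, -2), (1, -2), -(1, -2)} := by
    decide
  rw [this]
  repeat rw [Finset.sum_insert (by decide)]
  rw [Finset.sum_singleton]
  unfold node
  ring

lemma sum_row (a : ZMod 5 × ZMod 5 → ℝ) (v : ZMod 5 × ZMod 5) :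
    ∑ i, node a (v + (i, 0)) = node a v + node a (v + (1, 0)) + node a (v + (2, 0)) +
      node a (v + (3, 0)) + node a (v + (4, 0)) := by
  have : (Finset.univ : Finset (ZMod 5)) = {0, 1, 2, 3, 4} := by decide
  rw [this]
  repeat rw [Finset.sum_insert (by decide)]
  rw [Finset.sum_singleton, Prod.mk_zero_zero, add_zero]
  ring

variable {a : ZMod 5 × ZMod 5 → ℝ}

/-- A nonempty cell at `0` or `±(2, 0)` would complete a triangle using the node `(1, 0)` twice and
force `2P ≤ 2`. -/
lemma axis_eq_zero (h : IsProfile a) (hP : 1 < node a (1, 0)) :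
    a 0 = 0 ∧ node a (2, 0) = 0 := by
  constructor
  · by_contra hc
    have h0 : 0 < node a 0 := by
      have := (h.nonneg 0).lt_of_ne' hc
      unfold node; rw [neg_zero]; linarith
    have := h.node_add_node_le_two (u := (1, 0)) (v := -(1, 0)) (by decide) h0
    rw [node_neg] at this
    linarith
  · by_contra hc
    have h0 := (h.node_nonneg (u := (2, 0))).lt_of_ne' hc
    rw [← node_neg] at h0
    linarith [h.node_add_node_le_two (u := (1, 0)) (v := (1, 0)) (by decide) h0]

/-- The inequality between the two axes forced by the bounds on the two remaining rows. -/
lemma axis_bound {P F K Q₁ Q₂ : ℝ} {f₁ f₂ : Prop} (hsum : 5.6 ≤ P + Q₁ + Q₂)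
    (hK : (1.6 < P ∧ K = 2.4 - P) ∨ (1.12 < P ∧ P ≤ 1.44 ∧ K = 2.24 - P) ∨
      (1.44 ≤ P ∧ P ≤ 1.6 ∧ K = 0.8))
    (h₁ : (f₁ ∧ Q₁ ≤ 2.5 * K ∧ (P ≤ 1.6 → Q₁ ≤ 2 ∨ P ≤ 1.2 ∧ Q₁ ≤ 2.2 ∧ (P = 1.2 → Q₁ < 2.2))) ∨ Q₁ ≤ 2 * K ∨ Q₁ ≤ 2 * F)
    (h₂ : (f₂ ∧ Q₂ ≤ 2.5 * K ∧ (P ≤ 1.6 → Q₂ ≤ 2 ∨ P ≤ 1.2 ∧ Q₂ ≤ 2.2 ∧ (P = 1.2 → Q₂ < 2.2))) ∨ Q₂ ≤ 2 * K ∨ Q₂ ≤ 2 * F) :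
    1.4 - P / 4 ≤ F ∨ (P = 1.6 ∧ f₂ ∧ 2 ≤ Q₂) := by
  -- The value `1.4 - P / 4` is what `F` must reach when both rows are bounded by `2F`. The other
  -- row bounds leave a total below `5.6`, apart from the tight case `P = 1.6`; at `P = 1.2` the
  -- strict inequality is needed.
  by_contra! hc
  obtain ⟨hF, hc⟩ := hc
  rcases hK with ⟨hK, rfl⟩ | ⟨hK, hK', rfl⟩ | ⟨hK, hK', rfl⟩
  · rcases h₁ with ⟨-, h₁, -⟩ | h₁ | h₁ <;> rcases h₂ with ⟨-, h₂, -⟩ | h₂ | h₂ <;> linarith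
  all_goals
    rcases h₁ with ⟨-, -, h₁⟩ | h₁ | h₁ <;> rcases h₂ with ⟨k₂, -, h₂⟩ | h₂ | h₂
  all_goals try have h1 := h₁ (by linarith)
  all_goals try have h2 := h₂ (by linarith)
  all_goals try rcases h1 with h1 | ⟨h1, h1', h1''⟩
  all_goals try rcases h2 with h2 | ⟨h2, h2', h2''⟩
  all_goals
    first
    | linarith
    | linarith [hc (by linarith) k₂]
    | linarith [h1'' (by linarith), h2'' (by linarith)]

/-- The possible shapes of a profile of total density at least `28 / 5`, once the sum of two
neighbouring nonempty nodes is bounded. -/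
theorem shape_cases (h : IsProfile a) (hsum : 5.6 ≤ ∑ u, a u)
    (hmax : ∀ v : ZMod 5 × ZMod 5, v.2 ≠ 0 → node a v ≤ node a (0, 1))
    (hle : node a (0, 1) ≤ node a (1, 0)) {K : ℝ}
    (hedge : ∀ v : ZMod 5 × ZMod 5, v.2 ≠ 0 → 0 < node a v → 0 < node a (v + (1, 0)) →
      node a v + node a (v + (1, 0)) ≤ K)
    (hfull : node a (1, 0) ≤ 1.6 → ∀ v : ZMod 5 × ZMod 5, v.2 ≠ 0 →
      (∀ i, 0 < node a (v + (i, 0))) → ∑ i, node a (v + (i, 0)) ≤ 2 ∨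
        node a (1, 0) ≤ 1.2 ∧ ∑ i, node a (v + (i, 0)) ≤ 2.2 ∧
          (node a (1, 0) = 1.2 → ∑ i, node a (v + (i, 0)) < 2.2))
    (hK : (1.6 < node a (1, 0) ∧ K = 2.4 - node a (1, 0)) ∨
      (1.12 < node a (1, 0) ∧ node a (1, 0) ≤ 1.6 ∧ K = max 0.8 (2.24 - node a (1, 0)))) :
    (∃ s : ZMod 5, ∀ u, a u ≠ 0 → u.1 + s * u.2 = 1 ∨ u.1 + s * u.2 = -1) ∨
    (∃ s : ZMod 5, (s = 1 ∨ s = -1) ∧ node a (1, 0) = 2 ∧ node a (0, 1) = 2 ∧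
      node a (2, s) = 0.8 ∧ node a (1, -2 * s) = 0.8 ∧
      ∀ u, a u ≠ 0 → u ∈ ({(1, 0), -(1, 0), (0, 1), -(0, 1), (2, s), -(2, s), (1, -2 * s),
        -(1, -2 * s)} : Finset (ZMod 5 × ZMod 5))) ∨
    (node a (1, 0) = 1.6 ∧ ∃ v : ZMod 5 × ZMod 5, v.2 ≠ 0 ∧ (∀ i, 0 < node a (v + (i, 0))) ∧
      2 ≤ ∑ i, node a (v + (i, 0))) ∨
    (node a (1, 0) = 1.6 ∧ node a (0, 1) = 1.6 ∧ ∀ v : ZMod 5 × ZMod 5,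
      v ∈ ({(2, 1), (2, -1), (1, 2), (1, -2), (2, 2), (2, -2)} : Finset (ZMod 5 × ZMod 5)) →
        0 < node a v) := by
  set P := node a (1, 0) with hPdef
  set F := node a (0, 1) with hFdef
  have hP2 : P ≤ 2 := h.node_le_two
  have hP : 1.12 < P := by rcases hK with hK | hK <;> linarith [hK.1]
  obtain ⟨z0, z2⟩ := h.axis_eq_zero (by linarith)
  have nn : ∀ v, 0 ≤ node a v := fun v => h.node_nonneg
  rw [sum_eq_nodes, z0, z2, ← hPdef, ← hFdef] at hsum
  -- rows as explicit five-cycles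
  have r12 : node a ((0, 1) + (1, 0)) = node a (1, 1) := node_congr (by decide)
  have r13 : node a ((0, 1) + (2, 0)) = node a (2, 1) := node_congr (by decide)
  have r14 : node a ((0, 1) + (3, 0)) = node a (2, -1) := node_congr (by decide)
  have r15 : node a ((0, 1) + (4, 0)) = node a (1, -1) := node_congr (by decide)
  have r22 : node a ((0, 2) + (1, 0)) = node a (1, 2) := node_congr (by decide)
  have r23 : node a ((0, 2) + (2, 0)) = node a (2, 2) := node_congr (by decide)
  have r24 : node a ((0, 2) + (3, 0)) = node a (2, -2) := node_congr (by decide)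
  have r25 : node a ((0, 2) + (4, 0)) = node a (1, -2) := node_congr (by decide)
  have edge : ∀ v w : ZMod 5 × ZMod 5, v.2 ≠ 0 → (v + (1, 0) = w ∨ v + (1, 0) = -w) →
      0 < node a v → 0 < node a w → node a v + node a w ≤ K := by
    intro v w hv hw h1 h2
    rw [← node_congr (a := a) hw] at h2 ⊢
    exact hedge v hv h1 h2
  have e11 := edge (0, 1) (1, 1) (by decide) (by decide)
  have e12 := edge (1, 1) (2, 1) (by decide) (by decide)
  have e13 := edge (2, 1) (2, -1) (by decide) (by decide)
  have e14 := edge (-(2, -1)) (1, -1) (by decide) (by decide)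
  have e15 := edge (-(1, -1)) (0, 1) (by decide) (by decide)
  have e21 := edge (0, 2) (1, 2) (by decide) (by decide)
  have e22 := edge (1, 2) (2, 2) (by decide) (by decide)
  have e23 := edge (2, 2) (2, -2) (by decide) (by decide)
  have e24 := edge (-(2, -2)) (1, -2) (by decide) (by decide)
  have e25 := edge (-(1, -2)) (0, 2) (by decide) (by decide)
  rw [node_neg] at e14 e15 e24 e25
  rw [← hFdef] at e11 e15
  have full1 : P ≤ 1.6 → 0 < F → 0 < node a (1, 1) → 0 < node a (2, 1) → 0 < node a (2, -1) →
      0 < node a (1, -1) →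
      F + node a (1, 1) + node a (2, 1) + node a (2, -1) + node a (1, -1) ≤ 2 ∨ P ≤ 1.2 ∧
      F + node a (1, 1) + node a (2, 1) + node a (2, -1) + node a (1, -1) ≤ 2.2 ∧ (P = 1.2 →
      F + node a (1, 1) + node a (2, 1) + node a (2, -1) + node a (1, -1) < 2.2) := by
    intro hp h1 h2 h3 h4 h5
    have := hfull hp (0, 1) (by decide) (by
      intro i; fin_cases i
      exacts [h1, h2, h3, h4.trans_eq r14.symm, h5.trans_eq r15.symm])
    rwa [sum_row, r12, r13, r14, r15] at this
  have full2 : P ≤ 1.6 → 0 < node a (0, 2) → 0 < node a (1, 2) → 0 < node a (2, 2) →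
      0 < node a (2, -2) → 0 < node a (1, -2) →
      node a (0, 2) + node a (1, 2) + node a (2, 2) + node a (2, -2) + node a (1, -2) ≤ 2 ∨
      P ≤ 1.2 ∧ node a (0, 2) + node a (1, 2) + node a (2, 2) + node a (2, -2) + node a (1, -2) ≤ 2.2 ∧
      (P = 1.2 →
      node a (0, 2) + node a (1, 2) + node a (2, 2) + node a (2, -2) + node a (1, -2) < 2.2) := by
    intro hp h1 h2 h3 h4 h5
    have := hfull hp (0, 2) (by decide) (by
      intro i; fin_cases i
      exacts [h1, h2, h3, h4.trans_eq r24.symm, h5.trans_eq r25.symm])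
    rwa [sum_row, r22, r23, r24, r25] at this
  have row1 := cycle_sum_le (nn (0, 1)) (nn (1, 1)) (nn (2, 1)) (nn (2, -1)) (nn (1, -1))
    (hmax _ (by decide)) (hmax _ (by decide)) (hmax _ (by decide)) (hmax _ (by decide))
    (hmax _ (by decide)) e11 e12 e13 e14 e15
  have row2 := cycle_sum_le (nn (0, 2)) (nn (1, 2)) (nn (2, 2)) (nn (2, -2)) (nn (1, -2))
    (hmax _ (by decide)) (hmax _ (by decide)) (hmax _ (by decide)) (hmax _ (by decide))
    (hmax _ (by decide)) e21 e22 e23 e24 e25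
  rw [← hFdef] at row1
  have hK' : (1.6 < P ∧ K = 2.4 - P) ∨ (1.12 < P ∧ P ≤ 1.44 ∧ K = 2.24 - P) ∨
      (1.44 ≤ P ∧ P ≤ 1.6 ∧ K = 0.8) := by
    rcases hK with hK | ⟨h1, h2, h3⟩
    · exact Or.inl hK
    · rcases max_cases (0.8 : ℝ) (2.24 - P) with ⟨h4, h5⟩ | ⟨h4, h5⟩
      · exact Or.inr (Or.inr ⟨by linarith, h2, h3.trans h4⟩)
      · exact Or.inr (Or.inl ⟨h1, by linarith, h3.trans h4⟩)
  clear hK hedge edge hfull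
  -- The premise will follow from `F ≥ 1.4 - P / 4` and `P > 1.12`, which give `P + F > 2.24`.
  have n11 : 2 < P + F → node a (1, 1) = 0 ∧ node a (1, -1) = 0 := by
    intro hPF
    constructor <;> by_contra hc
    · have h0 := (nn (1, 1)).lt_of_ne' hc
      rw [← node_neg] at h0
      linarith [h.node_add_node_le_two (u := (1, 0)) (v := (0, 1)) (by decide) h0]
    · have h0 := (nn (1, -1)).lt_of_ne' hc
      rw [← node_neg] at h0
      have := h.node_add_node_le_two (u := (1, 0)) (v := -(0, 1)) (by decide) h0
      rw [node_neg] at this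
      linarith
  have two : ∀ u v w : ZMod 5 × ZMod 5,
      (u + v + w = 0 ∨ u + v - w = 0 ∨ u - v + w = 0 ∨ u - v - w = 0) → 0 < node a w →
      node a u + node a v ≤ 2 := by
    rintro u v w (h1 | h1 | h1 | h1) hw
    · exact h.node_add_node_le_two h1 hw
    · exact h.node_add_node_le_two (w := -w) (by rw [← sub_eq_add_neg, h1]) (by rwa [node_neg])
    · rw [← node_neg (u := v)]
      exact h.node_add_node_le_two (by rw [← sub_eq_add_neg, h1]) hw
    · rw [← node_neg (u := v)]
      exact h.node_add_node_le_two (w := -w) (by rw [← sub_eq_add_neg, ← sub_eq_add_neg, h1])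
        (by rwa [node_neg])
  have dbl : ∀ u w : ZMod 5 × ZMod 5, u + u + w = 0 → w + w = u → 0 < node a u → 0 < node a w →
      2 * node a u + node a w ≤ 2.4 := fun u w h1 h2 => h.two_mul_node_add_node_le h1 h2
  have n15 := two (0, 1) (2, 2) (2, 1) (by decide)
  have n51 := two (0, 1) (2, 1) (2, 2) (by decide)
  have n26 := two (0, 1) (2, -2) (2, -1) (by decide)
  have n62 := two (0, 1) (2, -1) (2, -2) (by decide)
  have n34 := two (0, 1) (1, -2) (1, 2) (by decide)
  have n43 := two (0, 1) (1, 2) (1, -2) (by decide)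
  have d14 := dbl (2, 1) (1, -2) (by decide) (by decide)
  have d41 := dbl (1, -2) (-(2, 1)) (by decide) (by decide)
  have d23 := dbl (2, -1) (1, 2) (by decide) (by decide)
  have d32 := dbl (1, 2) (-(2, -1)) (by decide) (by decide)
  have dg := dbl (0, 1) (-(0, 2)) (by decide) (by decide)
  have mg := two (0, 1) (0, 1) (0, 2) (by decide)
  have m41 := two (2, 1) (2, 1) (1, -2) (by decide)
  have m32 := two (2, -1) (2, -1) (1, 2) (by decide)
  rw [node_neg] at d41 d32 dg
  rw [← hFdef] at n15 n51 n26 n62 n34 n43 dg mg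
  have u1F := hmax (2, 1) (by decide)
  have u2F := hmax (2, -1) (by decide)
  have u3F := hmax (1, 2) (by decide)
  have u4F := hmax (1, -2) (by decide)
  have u5F := hmax (2, 2) (by decide)
  have u6F := hmax (2, -2) (by decide)
  have gF := hmax (0, 2) (by decide)
  have toX : P = 1.6 → 0 < node a (0, 2) → 0 < node a (1, 2) → 0 < node a (2, 2) →
      0 < node a (2, -2) → 0 < node a (1, -2) →
      2 ≤ node a (0, 2) + node a (1, 2) + node a (2, 2) + node a (2, -2) + node a (1, -2) →
      (P = 1.6 ∧ ∃ v : ZMod 5 × ZMod 5, v.2 ≠ 0 ∧ (∀ i, 0 < node a (v + (i, 0))) ∧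
      2 ≤ ∑ i, node a (v + (i, 0))) := by
    intro hp h1 h2 h3 h4 h5 h6
    refine ⟨hp, (0, 2), by decide, ?_, ?_⟩
    · intro i; fin_cases i
      exacts [h1, h2, h3, h4.trans_eq r24.symm, h5.trans_eq r25.symm]
    · rwa [sum_row, r22, r23, r24, r25]
  -- For a row without an empty node, `5K/2` is the average of the five edge bounds.
  have hab := axis_bound (by linarith) hK'
    (row1.imp_left fun hr => ⟨hr, by
      linarith [e11 hr.1 hr.2.1, e12 hr.2.1 hr.2.2.1, e13 hr.2.2.1 hr.2.2.2.1,
        e14 hr.2.2.2.1 hr.2.2.2.2, e15 hr.2.2.2.2 hr.1],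
      fun hp => full1 hp hr.1 hr.2.1 hr.2.2.1 hr.2.2.2.1 hr.2.2.2.2⟩)
    (row2.imp_left fun hr => ⟨hr, by
      linarith [e21 hr.1 hr.2.1, e22 hr.2.1 hr.2.2.1, e23 hr.2.2.1 hr.2.2.2.1,
        e24 hr.2.2.2.1 hr.2.2.2.2, e25 hr.2.2.2.2 hr.1],
      fun hp => full2 hp hr.1 hr.2.1 hr.2.2.1 hr.2.2.2.1 hr.2.2.2.2⟩)
  rcases hab with hF | ⟨hp, hr, hq⟩
  swap
  · exact Or.inr (Or.inr (Or.inl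
      (toX hp hr.1 hr.2.1 hr.2.2.1 hr.2.2.2.1 hr.2.2.2.2 hq)))
  obtain ⟨z11, z14⟩ := n11 (by linarith)
  rw [z11, z14] at hsum
  clear row1 row2 full1 full2 e11 e12 e14 e15 two dbl n11
  rcases nodes_cases (nn (0, 2)) (nn (2, 1)) (nn (2, -1)) (nn (1, 2)) (nn (1, -2)) (nn (2, 2))
    (nn (2, -2)) gF u1F u2F u3F u4F u5F u6F hle hP2 hF (by linarith) e21
    (fun h1 h2 => by linarith [e25 h2 h1]) e13 e22 (fun h1 h2 => by linarith [e24 h2 h1])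
    e23 n15 n51 n26 n62 n34 n43 d14 (fun h1 h2 => d41 h2 h1) d23
    (fun h1 h2 => d32 h2 h1) (fun h1 => by linarith [m41 h1])
    (fun h1 => by linarith [m32 h1]) (fun h1 => dg (by linarith) h1)
    (fun h1 => by linarith [mg h1]) hK' with
    ⟨zg, ⟨y2, y4, y5⟩ | ⟨y1, y3, y6⟩⟩ | ⟨hp, y1, y4, hf, zg, y2, y6⟩ |
    ⟨hp, y2, y3, hf, zg, y1, y5⟩ | ⟨hp, y0, y3, y4, y5, y6, hq⟩ | ⟨hp, hf, y1, y2, y3, y4, y5, y6⟩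
  · refine Or.inl ⟨-1, fun u hu => ?_⟩
    have key : ∀ u : ZMod 5 × ZMod 5, (u.1 + (-1) * u.2 = 1 ∨ u.1 + (-1) * u.2 = -1) ∨ u = 0 ∨
      ∃ v ∈ ({(2, 0), (1, 1), (1, -1), (0, 2), (2, -1), (1, -2), (2, 2)} :
        Finset (ZMod 5 × ZMod 5)), u = v ∨ u = -v := by decide
    rcases key u with h1 | rfl | ⟨v, hv, huv⟩
    · exact h1
    · exact (hu z0).elim
    · refine (hu (h.eq_zero_of_node ?_ huv)).elim
      simp only [Finset.mem_insert, Finset.mem_singleton] at hv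
      rcases hv with rfl | rfl | rfl | rfl | rfl | rfl | rfl <;> assumption
  · refine Or.inl ⟨1, fun u hu => ?_⟩
    have key : ∀ u : ZMod 5 × ZMod 5, (u.1 + 1 * u.2 = 1 ∨ u.1 + 1 * u.2 = -1) ∨ u = 0 ∨
      ∃ v ∈ ({(2, 0), (1, 1), (1, -1), (0, 2), (2, 1), (1, 2), (2, -2)} :
        Finset (ZMod 5 × ZMod 5)), u = v ∨ u = -v := by decide
    rcases key u with h1 | rfl | ⟨v, hv, huv⟩
    · exact h1
    · exact (hu z0).elim
    · refine (hu (h.eq_zero_of_node ?_ huv)).elim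
      simp only [Finset.mem_insert, Finset.mem_singleton] at hv
      rcases hv with rfl | rfl | rfl | rfl | rfl | rfl | rfl <;> assumption
  · obtain ⟨c1, c1', c4, c4'⟩ := h.eq_of_le_node_add_node (u := (2, 1)) (w := (1, -2)) (by decide)
      (by decide) (by linarith) (by linarith) (by linarith)
    -- If nonempty, its triangle with `(1, -2)` and `(0, 1)` leaves at least `0.4` for `(2, 2)`;
    -- then the edge bound `K = 0.4` and the triangle with `(2, 1)` contradict `F + u₃ + u₅ = 2`.
    have y3 : node a (1, 2) = 0 := by
      by_contra hc
      have h0 := (nn (1, 2)).lt_of_ne' hc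
      have := h.node_add_node_add_node_le (u := (1, -2)) (v := (0, -1)) (w := -(1, 2)) (by decide)
        (by linarith) (by linarith)
      rw [node_neg, show ((0, -1) : ZMod 5 × ZMod 5) = -(0, 1) by decide, node_neg] at this
      have := this (by linarith) h0
      have := nn (2, 2)
      by_cases hu : 0 < node a (2, 2)
      · rcases hK' with hK' | hK' | hK' <;> linarith [n51 hu, e22 h0 hu]
      · linarith
    have y5 : node a (2, 2) = 0 := by
      by_contra hc
      have h0 := (nn (2, 2)).lt_of_ne' hc
      have := h.node_add_node_add_node_le (u := (2, 1)) (v := (0, 1)) (w := -(2, 2)) (by decide)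
        (by linarith) (by linarith)
      rw [node_neg] at this
      linarith [this (by linarith) h0]
    refine Or.inr (Or.inl ⟨1, Or.inl rfl, hp, by linarith, y1, by simpa using y4, fun u hu => ?_⟩)
    have key : ∀ u : ZMod 5 × ZMod 5, u ∈ ({(1, 0), -(1, 0), (0, 1), -(0, 1), (2, 1), -(2, 1),
        (1, -2 * 1), -(1, -2 * 1)} : Finset (ZMod 5 × ZMod 5)) ∨ u = 0 ∨
      ∃ v ∈ ({(2, 0), (1, 1), (1, -1), (0, 2), (2, -1), (1, 2), (2, 2), (2, -2)} :
        Finset (ZMod 5 × ZMod 5)), u = v ∨ u = -v := by decide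
    rcases key u with h1 | rfl | ⟨v, hv, huv⟩
    · exact h1
    · exact (hu z0).elim
    · refine (hu (h.eq_zero_of_node ?_ huv)).elim
      simp only [Finset.mem_insert, Finset.mem_singleton] at hv
      rcases hv with rfl | rfl | rfl | rfl | rfl | rfl | rfl | rfl <;> assumption
  · obtain ⟨c1, c1', c4, c4'⟩ := h.eq_of_le_node_add_node (u := (2, -1)) (w := (1, 2)) (by decide)
      (by decide) (by linarith) (by linarith) (by linarith)
    have y4 : node a (1, -2) = 0 := by
      by_contra hc
      have h0 := (nn (1, -2)).lt_of_ne' hc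
      have := h.node_add_node_add_node_le (u := (1, 2)) (v := (0, 1)) (w := -(1, -2)) (by decide)
        (by linarith) (by linarith)
      rw [node_neg] at this
      have := this (by linarith) h0
      have := nn (2, -2)
      by_cases hu : 0 < node a (2, -2)
      · rcases hK' with hK' | hK' | hK' <;> linarith [n62 hu, e24 hu h0]
      · linarith
    have y6 : node a (2, -2) = 0 := by
      by_contra hc
      have h0 := (nn (2, -2)).lt_of_ne' hc
      have := h.node_add_node_add_node_le (u := (2, -1)) (v := -(0, 1)) (w := -(2, -2)) (by decide)
        (by linarith) (by linarith)
      rw [node_neg, node_neg] at this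
      linarith [this (by linarith) h0]
    refine Or.inr (Or.inl ⟨-1, Or.inr rfl, hp, by linarith, y2, by simpa using y3, fun u hu => ?_⟩)
    have key : ∀ u : ZMod 5 × ZMod 5, u ∈ ({(1, 0), -(1, 0), (0, 1), -(0, 1), (2, -1), -(2, -1),
        (1, -2 * -1), -(1, -2 * -1)} : Finset (ZMod 5 × ZMod 5)) ∨ u = 0 ∨
      ∃ v ∈ ({(2, 0), (1, 1), (1, -1), (0, 2), (2, 1), (1, -2), (2, 2), (2, -2)} :
        Finset (ZMod 5 × ZMod 5)), u = v ∨ u = -v := by decide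
    rcases key u with h1 | rfl | ⟨v, hv, huv⟩
    · exact h1
    · exact (hu z0).elim
    · refine (hu (h.eq_zero_of_node ?_ huv)).elim
      simp only [Finset.mem_insert, Finset.mem_singleton] at hv
      rcases hv with rfl | rfl | rfl | rfl | rfl | rfl | rfl | rfl <;> assumption
  · exact Or.inr (Or.inr (Or.inl (toX hp y0 y3 y5 y6 y4 (by linarith))))
  · refine Or.inr (Or.inr (Or.inr ⟨hp, hf, fun v hv => ?_⟩))
    simp only [Finset.mem_insert, Finset.mem_singleton] at hv
    rcases hv with rfl | rfl | rfl | rfl | rfl | rfl <;> assumption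

end IsProfile

/-! ### Fibre densities -/

section Density

variable {G : Type*} [AddCommGroup G] [Module (ZMod 5) G]
variable {W : Type*} [AddCommGroup W] [Module (ZMod 5) W] [DecidableEq W]

/-- The part of `A` in the fibre of `φ` over `u`. -/
def cell (A : Finset G) (φ : G →ₗ[ZMod 5] W) (u : W) : Finset G :=
  A.filter (fun x => φ x = u)

/-- The density of `A` in the fibre of `φ` over `u`. -/
noncomputable def dens (A : Finset G) (φ : G →ₗ[ZMod 5] W) (u : W) : ℝ :=
  (cell A φ u).card / Nat.card (LinearMap.ker φ)

lemma mem_cell {A : Finset G} {φ : G →ₗ[ZMod 5] W} {u : W} {x : G} :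
    x ∈ cell A φ u ↔ x ∈ A ∧ φ x = u := Finset.mem_filter

variable [Fintype G]

lemma natCard_ker_pos (φ : G →ₗ[ZMod 5] W) : (0 : ℝ) < Nat.card (LinearMap.ker φ) := by
  exact_mod_cast Nat.card_pos

lemma dens_mul_card (A : Finset G) (φ : G →ₗ[ZMod 5] W) (u : W) :
    dens A φ u * Nat.card (LinearMap.ker φ) = (cell A φ u).card :=
  div_mul_cancel₀ _ (natCard_ker_pos φ).ne'

lemma dens_pos {A : Finset G} {φ : G →ₗ[ZMod 5] W} {u : W} :
    0 < dens A φ u ↔ (cell A φ u).Nonempty := by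
  rw [← Finset.card_pos, dens, div_pos_iff_of_pos_right (natCard_ker_pos φ), Nat.cast_pos]

lemma dens_ne_zero {A : Finset G} {φ : G →ₗ[ZMod 5] W} {x : G} (hx : x ∈ A) :
    dens A φ (φ x) ≠ 0 := (dens_pos.2 ⟨x, mem_cell.2 ⟨hx, rfl⟩⟩).ne'

variable [DecidableEq G]

/-- The fibre of `φ` through `x`. -/
lemma card_fibre (φ : G →ₗ[ZMod 5] W) (x : G) :
    (Finset.univ.filter (fun y => φ y = φ x)).card = Nat.card (LinearMap.ker φ) := by
  classical
  rw [Nat.card_eq_fintype_card, Fintype.card_subtype]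
  refine Finset.card_bij' (fun y _ => y - x) (fun h _ => h + x) ?_ ?_ (by simp) (by simp)
  · intro y hy
    simpa [sub_eq_zero] using hy
  · intro h hh
    simpa using hh

lemma card_cell_le (A : Finset G) (φ : G →ₗ[ZMod 5] W) (u : W) :
    (cell A φ u).card ≤ Nat.card (LinearMap.ker φ) := by
  rcases (cell A φ u).eq_empty_or_nonempty with he | ⟨x, hx⟩
  · simp [he]
  · rw [← card_fibre φ x]
    refine Finset.card_le_card fun y hy => ?_
    rw [mem_cell] at hx hy
    simp [hx.2, hy.2]

/-- A fibre of density one is full. -/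
lemma mem_of_dens_eq_one {A : Finset G} {φ : G →ₗ[ZMod 5] W} {u : W} (h : dens A φ u = 1) {x : G}
    (hx : φ x = u) : x ∈ A := by
  have h1 : ((cell A φ u).card : ℝ) = Nat.card (LinearMap.ker φ) := by
    rw [← dens_mul_card, h, one_mul]
  have h2 : cell A φ u = Finset.univ.filter (fun y => φ y = φ x) := by
    refine Finset.eq_of_subset_of_card_le (fun y hy => ?_) ?_
    · simp [(mem_cell.1 hy).2, hx]
    · rw [card_fibre]; exact_mod_cast h1.ge
  have h3 : x ∈ Finset.univ.filter (fun y => φ y = φ x) := by simp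
  rw [← h2] at h3
  exact (mem_cell.1 h3).1

lemma sum_dens [Fintype W] (A : Finset G) (φ : G →ₗ[ZMod 5] W) :
    ∑ u, dens A φ u = A.card / Nat.card (LinearMap.ker φ) := by
  unfold dens
  rw [← Finset.sum_div]
  congr 1
  rw [Finset.card_eq_sum_card_fiberwise (f := φ) (t := Finset.univ) (by simp)]
  push_cast
  rfl

lemma card_eq_card_mul_card_ker [Fintype W] {φ : G →ₗ[ZMod 5] W} (hφ : Function.Surjective φ) :
    Fintype.card G = Fintype.card W * Nat.card (LinearMap.ker φ) := by
  rw [← Finset.card_univ (α := G),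
    Finset.card_eq_sum_card_fiberwise (f := φ) (t := Finset.univ) (by simp)]
  rw [Finset.sum_const_nat (m := Nat.card (LinearMap.ker φ)), Finset.card_univ]
  intro u _
  obtain ⟨x, rfl⟩ := hφ u
  exact card_fibre φ x

/-- Sum-freeness enters the linear programs only through this: `M` is the index of the Kneser period
in the kernel, and a cell is no larger than its hull. -/
theorem isProfile_dens {A : Finset G} (hA : ∀ x ∈ A, ∀ y ∈ A, x + y ∉ A)
    (φ : G →ₗ[ZMod 5] W) : IsProfile (dens A φ) where
  nonneg _ := div_nonneg (Nat.cast_nonneg _) (Nat.cast_nonneg _)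
  le_one u := by
    rw [dens, div_le_one (natCard_ker_pos φ)]
    exact_mod_cast card_cell_le A φ u
  tri_add u v hu hv huv := by
    obtain ⟨H, M, x', y', z', -, hM, hM5, hx1, hy1, hz1, hx, hy, hz, hle, -⟩ :=
      exists_submodule_of_add_notMem φ (dens_pos.1 hu) (dens_pos.1 hv) (dens_pos.1 huv)
      (fun x hx => (mem_cell.1 hx).2) (fun x hx => (mem_cell.1 hx).2)
      (fun x hx => (mem_cell.1 hx).2)
      (fun x hx y hy hxy => hA x (mem_cell.1 hx).1 y (mem_cell.1 hy).1 (mem_cell.1 hxy).1)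
    have hpos : (0 : ℝ) < Nat.card H := by exact_mod_cast Nat.card_pos
    have key : ∀ (w : W) (k : ℕ), (cosetHull (cell A φ w) H.toAddSubgroup).card = k * Nat.card H →
        dens A φ w * M ≤ k := by
      intro w k hk
      refine le_of_mul_le_mul_right ?_ hpos
      rw [mul_assoc, ← Nat.cast_mul, ← hM, dens_mul_card, ← Nat.cast_mul, ← hk]
      exact_mod_cast Finset.card_le_card (subset_cosetHull _ _)
    exact ⟨M, x', y', z', hM5, hx1, hy1, hz1, key _ _ hx, key _ _ hy, key _ _ hz, hle⟩

/-- Change of coordinates. -/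
lemma dens_comp_equiv (A : Finset G) (φ : G →ₗ[ZMod 5] W) (σ : W ≃ₗ[ZMod 5] W) (u : W) :
    dens A (σ.toLinearMap ∘ₗ φ) u = dens A φ (σ.symm u) := by
  have h1 : LinearMap.ker (σ.toLinearMap ∘ₗ φ) = LinearMap.ker φ := by
    ext x; simp
  have h2 : cell A (σ.toLinearMap ∘ₗ φ) u = cell A φ (σ.symm u) := by
    ext x; simp [mem_cell, LinearEquiv.eq_symm_apply]
  unfold dens
  rw [h1, h2]

lemma node_dens_comp_equiv (A : Finset G) (φ : G →ₗ[ZMod 5] W) (σ : W ≃ₗ[ZMod 5] W) (u : W) :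
    node (dens A (σ.toLinearMap ∘ₗ φ)) u = node (dens A φ) (σ.symm u) := by
  simp only [node, dens_comp_equiv, map_neg]

end Density

/-! ### Changes of coordinates and the densest pair of opposite cells -/

/-- The automorphism of `𝔽₅²` with columns `(a, b)` and `(c, d)`. -/
noncomputable def planeEquiv (a b c d : ZMod 5) (h : a * d - b * c ≠ 0) :
    (ZMod 5 × ZMod 5) ≃ₗ[ZMod 5] ZMod 5 × ZMod 5 :=
  LinearEquiv.ofInjectiveEndo
    (LinearMap.prod (a • LinearMap.fst _ _ _ + c • LinearMap.snd _ _ _)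
      (b • LinearMap.fst _ _ _ + d • LinearMap.snd _ _ _)) (by
    rw [← LinearMap.ker_eq_bot, LinearMap.ker_eq_bot']
    rintro ⟨x, y⟩ hxy
    have h1 : a * x + c * y = 0 := congrArg Prod.fst hxy
    have h2 : b * x + d * y = 0 := congrArg Prod.snd hxy
    have hx : (a * d - b * c) * x = 0 := by linear_combination d * h1 - c * h2
    have hy : (a * d - b * c) * y = 0 := by linear_combination a * h2 - b * h1
    rw [mul_eq_zero, or_iff_right h] at hx hy
    simp [hx, hy])

lemma planeEquiv_apply {a b c d : ZMod 5} (h : a * d - b * c ≠ 0) (x y : ZMod 5) :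
    planeEquiv a b c d h (x, y) = (a * x + c * y, b * x + d * y) := rfl

lemma exists_linearEquiv_apply_eq {v : ZMod 5 × ZMod 5} (hv : v ≠ 0) :
    ∃ σ : (ZMod 5 × ZMod 5) ≃ₗ[ZMod 5] ZMod 5 × ZMod 5, σ (1, 0) = v := by
  obtain ⟨x, y⟩ := v
  by_cases hx : x = 0
  · have hy : y ≠ 0 := fun hy => hv (by rw [hx, hy]; rfl)
    exact ⟨planeEquiv x y 1 0 (by simpa using hy), by rw [planeEquiv_apply]; simp⟩
  · exact ⟨planeEquiv x y 0 1 (by simpa using hx), by rw [planeEquiv_apply]; simp⟩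

section Plane

variable {G : Type*} [AddCommGroup G] [Module (ZMod 5) G] [Fintype G] [DecidableEq G]

/-- `P` bounds the total density of `A` in all pairs `T`, `-T` of opposite affine subspaces of
codimension two. -/
def PairBound (A : Finset G) (P : ℝ) : Prop :=
  ∀ φ : G →ₗ[ZMod 5] ZMod 5 × ZMod 5, Function.Surjective φ → node (dens A φ) (1, 0) ≤ P

lemma exists_pairBound (A : Finset G) {φ₀ : G →ₗ[ZMod 5] ZMod 5 × ZMod 5}
    (h₀ : Function.Surjective φ₀) : ∃ φ : G →ₗ[ZMod 5] ZMod 5 × ZMod 5, Function.Surjective φ ∧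
      node (dens A φ₀) (1, 0) ≤ node (dens A φ) (1, 0) ∧
      PairBound A (node (dens A φ) (1, 0)) := by
  have hfin : Finite (G →ₗ[ZMod 5] ZMod 5 × ZMod 5) :=
    Finite.of_injective (fun f => (f : G → ZMod 5 × ZMod 5)) DFunLike.coe_injective
  obtain ⟨φ, hφ, hmax⟩ := Set.exists_max_image
    {φ : G →ₗ[ZMod 5] ZMod 5 × ZMod 5 | Function.Surjective φ}
    (fun φ => node (dens A φ) (1, 0)) (Set.toFinite _) ⟨φ₀, h₀⟩
  exact ⟨φ, hφ, hmax _ h₀, fun ψ hψ => hmax ψ hψ⟩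

lemma PairBound.node_le {A : Finset G} {P : ℝ} (hP : PairBound A P)
    {φ : G →ₗ[ZMod 5] ZMod 5 × ZMod 5} (hφ : Function.Surjective φ) {v : ZMod 5 × ZMod 5}
    (hv : v ≠ 0) : node (dens A φ) v ≤ P := by
  obtain ⟨σ, hσ⟩ := exists_linearEquiv_apply_eq hv
  have := hP (σ.symm.toLinearMap ∘ₗ φ) (σ.symm.surjective.comp hφ)
  rwa [node_dens_comp_equiv, LinearEquiv.symm_symm, hσ] at this

/-- Coordinates in which the densest node off the first axis is `(0, 1)`. -/
lemma exists_normalized (A : Finset G) {φ : G →ₗ[ZMod 5] ZMod 5 × ZMod 5}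
    (hφ : Function.Surjective φ) : ∃ ψ : G →ₗ[ZMod 5] ZMod 5 × ZMod 5, Function.Surjective ψ ∧
      dens A ψ (1, 0) = dens A φ (1, 0) ∧ dens A ψ (-(1, 0)) = dens A φ (-(1, 0)) ∧
      ∀ v : ZMod 5 × ZMod 5, v.2 ≠ 0 → node (dens A ψ) v ≤ node (dens A ψ) (0, 1) := by
  obtain ⟨⟨x, y⟩, hy, hmax⟩ := Set.exists_max_image {v : ZMod 5 × ZMod 5 | v.2 ≠ 0}
    (fun v => node (dens A φ) v) (Set.toFinite _) ⟨(0, 1), by decide⟩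
  have hdet : (1 : ZMod 5) * y - 0 * x ≠ 0 := by simpa using hy
  set σ := planeEquiv 1 0 x y hdet with hσ
  have h0 : σ (1, 0) = (1, 0) := by rw [planeEquiv_apply]; simp
  have h1 : σ (0, 1) = (x, y) := by rw [planeEquiv_apply]; simp
  refine ⟨σ.symm.toLinearMap ∘ₗ φ, σ.symm.surjective.comp hφ, ?_, ?_, ?_⟩
  · rw [dens_comp_equiv, LinearEquiv.symm_symm, h0]
  · rw [dens_comp_equiv, LinearEquiv.symm_symm, map_neg, h0]
  · rintro ⟨p, q⟩ hq
    rw [node_dens_comp_equiv, node_dens_comp_equiv, LinearEquiv.symm_symm, h1]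
    refine hmax _ ?_
    rw [planeEquiv_apply]
    simpa using ⟨hy, hq⟩

end Plane

/-! ### Rigidity -/

section Rigidity

variable {G : Type*} [AddCommGroup G] [Module (ZMod 5) G] [Fintype G] [DecidableEq G]
variable {W : Type*} [AddCommGroup W] [Module (ZMod 5) W] [DecidableEq W]

lemma five_mul_card_le_of_lt {H V : Submodule (ZMod 5) G} (h : H < V) :
    5 * Nat.card H ≤ Nat.card V := by
  obtain ⟨M, hM, hM5⟩ := exists_card_eq_mul_of_lt h
  have hpos : 0 < Nat.card V := Nat.card_pos
  rw [hM]
  refine Nat.mul_le_mul_right _ ?_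
  rcases hM5 with rfl | h5
  · exact le_rfl
  · have : M ≠ 0 := by rintro rfl; omega
    exact (by norm_num : 5 ≤ 25).trans (Nat.le_of_dvd (Nat.pos_of_ne_zero this) h5)

lemma exists_functional {V H : Submodule (ZMod 5) G} (hle : H ≤ V)
    (hcard : Nat.card V = 5 * Nat.card H) :
    ∃ ψ : G →ₗ[ZMod 5] ZMod 5, V ⊓ LinearMap.ker ψ = H ∧ ∃ x ∈ V, ψ x = 1 := by
  have hpos : 0 < Nat.card H := Nat.card_pos
  obtain ⟨x, hxV, hxH⟩ : ∃ x ∈ V, x ∉ H := by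
    by_contra! hc
    have : H = V := le_antisymm hle hc
    rw [this] at hcard hpos
    omega
  obtain ⟨f, hfx, hf⟩ := Submodule.exists_le_ker_of_notMem hxH
  refine ⟨(f x)⁻¹ • f, ?_, x, hxV, by simp [hfx]⟩
  have hker : LinearMap.ker ((f x)⁻¹ • f) = LinearMap.ker f := by
    ext y; simp [hfx]
  rw [hker]
  have hlt : V ⊓ LinearMap.ker f < V := by
    refine lt_of_le_of_ne inf_le_left fun h => hfx ?_
    rw [← h] at hxV
    exact hxV.2
  have hle' : H ≤ V ⊓ LinearMap.ker f := le_inf hle hf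
  have h5 := five_mul_card_le_of_lt hlt
  refine (SetLike.coe_injective (Set.eq_of_subset_of_ncard_le hle' ?_)).symm
  change Nat.card (V ⊓ LinearMap.ker f : Submodule (ZMod 5) G) ≤ Nat.card H
  omega

lemma exists_fibre_apply_eq {φ : G →ₗ[ZMod 5] W} (hφ : Function.Surjective φ)
    {ψ : G →ₗ[ZMod 5] ZMod 5} (hψ : ∃ x ∈ LinearMap.ker φ, ψ x = 1) (u : W) (t : ZMod 5) :
    ∃ x, φ x = u ∧ ψ x = t := by
  obtain ⟨y, rfl⟩ := hφ u
  obtain ⟨x, hx, hx1⟩ := hψ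
  refine ⟨y + (t - ψ y) • x, ?_, ?_⟩
  · rw [map_add, map_smul, LinearMap.mem_ker.1 hx, smul_zero, add_zero]
  · rw [map_add, map_smul, hx1, smul_eq_mul, mul_one, add_sub_cancel]

/-- Distinct periods of index five generate all of `V` or more, so `X` would contain a translate of
a set of at least `|V|` elements. -/
lemma periodic_subgroup_eq {V H₁ H₂ : Submodule (ZMod 5) G}
    (c₁ : Nat.card V = 5 * Nat.card H₁) (c₂ : Nat.card V = 5 * Nat.card H₂) {X : Finset G}
    (hX : X.Nonempty) (p₁ : ∀ x ∈ X, ∀ h ∈ H₁, x + h ∈ X) (p₂ : ∀ x ∈ X, ∀ h ∈ H₂, x + h ∈ X)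
    (hcard : X.card < Nat.card V) : H₁ = H₂ := by
  by_cases hlt : H₁ < H₁ ⊔ H₂
  · exfalso
    have h5 := five_mul_card_le_of_lt hlt
    obtain ⟨x, hx⟩ := hX
    have h3 : Nat.card (H₁ ⊔ H₂ : Submodule (ZMod 5) G) ≤ X.card := by
      classical
      rw [Nat.card_eq_fintype_card, Fintype.card_subtype]
      refine Finset.card_le_card_of_injOn (fun h => x + h) (fun h hh => ?_)
        (fun a _ b _ e => by simpa using e)
      have hh' : h ∈ H₁ ⊔ H₂ := by simpa using hh
      obtain ⟨a, ha, b, hb, rfl⟩ := Submodule.mem_sup.1 hh'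
      change x + (a + b) ∈ X
      rw [← add_assoc]
      exact p₂ _ (p₁ x hx a ha) b hb
    omega
  · have h3 : H₁ ⊔ H₂ = H₁ := by
      by_contra hne
      exact hlt (lt_of_le_of_ne le_sup_left (Ne.symm hne))
    refine (SetLike.coe_injective (Set.eq_of_subset_of_ncard_le (show H₂ ≤ H₁ from sup_eq_left.1 h3) ?_)).symm
    change Nat.card H₁ ≤ Nat.card H₂
    omega

/-- Three cells of total density `6 / 5` are unions of cosets of one hyperplane of the kernel. -/
lemma exists_periodic_of_sum_eq {A : Finset G} (hA : ∀ x ∈ A, ∀ y ∈ A, x + y ∉ A)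
    (φ : G →ₗ[ZMod 5] W) {u v w : W} (hw : u + v = w) (hu : 0 < dens A φ u) (hv : 0 < dens A φ v)
    (hp : 0 < dens A φ w) (hsum : 1.2 ≤ dens A φ u + dens A φ v + dens A φ w) :
    ∃ H ≤ LinearMap.ker φ, Nat.card (LinearMap.ker φ) = 5 * Nat.card H ∧
      (∀ x ∈ cell A φ u, ∀ h ∈ H, x + h ∈ cell A φ u) ∧
      (∀ x ∈ cell A φ v, ∀ h ∈ H, x + h ∈ cell A φ v) ∧
      (∀ x ∈ cell A φ w, ∀ h ∈ H, x + h ∈ cell A φ w) := by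
  subst hw
  obtain ⟨H, M, x', y', z', hH, hM, hM5, hx1, hy1, hz1, hx, hy, hz, hle, -⟩ :=
    exists_submodule_of_add_notMem φ (dens_pos.1 hu) (dens_pos.1 hv) (dens_pos.1 hp)
    (fun x hx => (mem_cell.1 hx).2) (fun x hx => (mem_cell.1 hx).2)
    (fun x hx => (mem_cell.1 hx).2)
    (fun x hx y hy hxy => hA x (mem_cell.1 hx).1 y (mem_cell.1 hy).1 (mem_cell.1 hxy).1)
  have hpos : (0 : ℝ) < Nat.card H := by exact_mod_cast Nat.card_pos
  have hMpos : 0 < M := by omega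
  have key : ∀ (w : W) (k : ℕ), (cosetHull (cell A φ w) H.toAddSubgroup).card = k * Nat.card H →
      dens A φ w * M ≤ k := by
    intro w k hk
    refine le_of_mul_le_mul_right ?_ hpos
    rw [mul_assoc, ← Nat.cast_mul, ← hM, dens_mul_card, ← Nat.cast_mul, ← hk]
    exact_mod_cast Finset.card_le_card (subset_cosetHull _ _)
  have kx := key _ _ hx
  have ky := key _ _ hy
  have kz := key _ _ hz
  have hle' : (x' : ℝ) + y' + z' ≤ M + 1 := by exact_mod_cast hle
  -- For `M ≥ 25` the total is at most `26/25 < 6/5`. With `M = 5` the total `6/5` leaves no slack,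
  -- so every cell equals its hull.
  have hM' : M = 5 := by
    rcases hM5 with h | h
    · exact h
    · exfalso
      have : (25 : ℝ) ≤ M := by exact_mod_cast Nat.le_of_dvd hMpos h
      nlinarith
  subst hM'
  push_cast at kx ky kz hle'
  have per : ∀ (w : W) (k : ℕ), (cosetHull (cell A φ w) H.toAddSubgroup).card = k * Nat.card H →
      (k : ℝ) ≤ dens A φ w * 5 → ∀ x ∈ cell A φ w, ∀ h ∈ H, x + h ∈ cell A φ w := by
    intro w k hk hkd
    have h1 : cosetHull (cell A φ w) H.toAddSubgroup = cell A φ w := by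
      refine cosetHull_eq_self ?_
      rw [hk]
      have := mul_le_mul_of_nonneg_right hkd hpos.le
      rw [mul_assoc, show (5 : ℝ) * Nat.card H = Nat.card (LinearMap.ker φ) by
        rw [hM]; push_cast; ring, dens_mul_card] at this
      exact_mod_cast this
    intro x hx h hh
    rw [← h1] at hx ⊢
    exact add_mem_cosetHull hx hh
  exact ⟨H, hH, hM, per _ _ hx (by linarith), per _ _ hy (by linarith), per _ _ hz (by linarith)⟩

/-- A periodic cell is determined by the values of a functional. -/
lemma mem_iff_of_periodic {A : Finset G} {φ : G →ₗ[ZMod 5] W} {ψ : G →ₗ[ZMod 5] ZMod 5} {u : W}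
    (hper : ∀ x ∈ cell A φ u, ∀ h ∈ LinearMap.ker φ ⊓ LinearMap.ker ψ, x + h ∈ cell A φ u) {x : G}
    (hx : φ x = u) : x ∈ A ↔ ψ x ∈ (cell A φ u).image ψ := by
  constructor
  · exact fun h => Finset.mem_image_of_mem _ (mem_cell.2 ⟨h, hx⟩)
  · intro h
    obtain ⟨y, hy, hyx⟩ := Finset.mem_image.1 h
    have := hper y hy (x - y) ⟨by
      rw [SetLike.mem_coe, LinearMap.mem_ker, map_sub, hx, (mem_cell.1 hy).2, sub_self], by
      rw [SetLike.mem_coe, LinearMap.mem_ker, map_sub, hyx, sub_self]⟩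
    rw [add_sub_cancel] at this
    exact (mem_cell.1 this).1

lemma card_image_of_periodic {A : Finset G} {φ : G →ₗ[ZMod 5] W} {ψ : G →ₗ[ZMod 5] ZMod 5} {u : W}
    (hcard : Nat.card (LinearMap.ker φ) =
      5 * Nat.card (LinearMap.ker φ ⊓ LinearMap.ker ψ : Submodule (ZMod 5) G))
    (hper : ∀ x ∈ cell A φ u, ∀ h ∈ LinearMap.ker φ ⊓ LinearMap.ker ψ, x + h ∈ cell A φ u) :
    (((cell A φ u).image ψ).card : ℝ) = 5 * dens A φ u := by
  have h1 : (cell A φ u).card = ((cell A φ u).image ψ).card *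
      Nat.card (LinearMap.ker φ ⊓ LinearMap.ker ψ : Submodule (ZMod 5) G) := by
    rw [Finset.card_eq_sum_card_image ψ (cell A φ u)]
    refine Finset.sum_const_nat fun t ht => ?_
    obtain ⟨x, hx, rfl⟩ := Finset.mem_image.1 ht
    classical
    rw [Nat.card_eq_fintype_card, Fintype.card_subtype]
    refine Finset.card_bij' (fun y _ => y - x) (fun h _ => x + h) ?_ ?_ (by simp) (by simp)
    · intro y hy
      rw [Finset.mem_filter] at hy
      simp [hy.2, (mem_cell.1 hy.1).2, (mem_cell.1 hx).2]
    · intro h hh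
      rw [Finset.mem_filter] at hh ⊢
      refine ⟨hper x hx h hh.2, ?_⟩
      rw [map_add, LinearMap.mem_ker.1 hh.2.2, add_zero]
  have hpos : (Nat.card (LinearMap.ker φ ⊓ LinearMap.ker ψ : Submodule (ZMod 5) G) : ℝ) ≠ 0 := by
    exact_mod_cast Nat.card_pos.ne'
  unfold dens
  rw [h1, hcard]
  push_cast
  field_simp

/-- Sum-freeness descends to the values of `ψ` in `𝔽₅`; only the target cell has to be periodic,
since the sum of representatives then lies in it. -/
lemma image_add_notMem {A : Finset G} (hA : ∀ x ∈ A, ∀ y ∈ A, x + y ∉ A) {φ : G →ₗ[ZMod 5] W}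
    {ψ : G →ₗ[ZMod 5] ZMod 5} {u v w : W} (hw : u + v = w)
    (hper : ∀ x ∈ cell A φ w, ∀ h ∈ LinearMap.ker φ ⊓ LinearMap.ker ψ, x + h ∈ cell A φ w) :
    ∀ p ∈ (cell A φ u).image ψ, ∀ q ∈ (cell A φ v).image ψ, p + q ∉ (cell A φ w).image ψ := by
  intro p hp q hq hpq
  obtain ⟨x, hx, rfl⟩ := Finset.mem_image.1 hp
  obtain ⟨y, hy, rfl⟩ := Finset.mem_image.1 hq
  rw [← map_add, ← mem_iff_of_periodic hper (by
    rw [map_add, (mem_cell.1 hx).2, (mem_cell.1 hy).2, hw])] at hpq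
  exact hA x (mem_cell.1 hx).1 y (mem_cell.1 hy).1 hpq

end Rigidity

/-! ### Sets with a very dense pair of opposite cells -/

section Extremal

variable {G : Type*} [AddCommGroup G] [Module (ZMod 5) G] [Fintype G] [DecidableEq G]

set_option synthInstance.maxHeartbeats 400000 in
set_option synthInstance.maxSize 2000 in
-- The doublings `(2,1) → (4,2) → (3,4) → (1,3)` are triangles of total exactly `6/5`, so the four
-- cells are unions of two cosets each of a common hyperplane. A functional becomes the third
-- coordinate of `Λ`, and each two-element value set determines the next.
lemma exists_vlLambda_of_dens {A : Finset G} (hA : ∀ x ∈ A, ∀ y ∈ A, x + y ∉ A)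
    {φ : G →ₗ[ZMod 5] ZMod 5 × ZMod 5} (hφ : Function.Surjective φ)
    (he : node (dens A φ) (1, 0) = 2) (hf : node (dens A φ) (0, 1) = 2)
    (h₁ : node (dens A φ) (2, 1) = 0.8) (h₂ : node (dens A φ) (1, -2) = 0.8)
    (hsupp : ∀ u, dens A φ u ≠ 0 → u ∈ ({(1, 0), -(1, 0), (0, 1), -(0, 1), (2, 1), -(2, 1),
      (1, -2), -(1, -2)} : Finset (ZMod 5 × ZMod 5))) :
    ∃ θ : G →ₗ[ZMod 5] ZMod 5 × ZMod 5 × ZMod 5, Function.Surjective θ ∧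
      ∀ x, x ∈ A ↔ θ x ∈ vlLambda := by
  have hprof := isProfile_dens hA φ
  have full : ∀ u : ZMod 5 × ZMod 5, node (dens A φ) u = 2 → dens A φ u = 1 ∧ dens A φ (-u) = 1 := by
    intro u hu
    unfold node at hu
    constructor <;> linarith [hprof.le_one u, hprof.le_one (-u)]
  obtain ⟨e1, e2⟩ := full _ he
  obtain ⟨f1, f2⟩ := full _ hf
  obtain ⟨a1, a3, a4, a2⟩ := hprof.eq_of_le_node_add_node (u := (2, 1)) (w := (1, -2)) (by decide)
    (by decide) (by linarith) (by linarith) (by linarith)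
  rw [show -((1, 0) : ZMod 5 × ZMod 5) = (4, 0) by decide] at e2
  rw [show -((0, 1) : ZMod 5 × ZMod 5) = (0, 4) by decide] at f2
  rw [show -((2, 1) : ZMod 5 × ZMod 5) = (3, 4) by decide] at a3
  rw [show ((1, -2) : ZMod 5 × ZMod 5) = (1, 3) by decide] at a4
  rw [show -((1, -2) : ZMod 5 × ZMod 5) = (4, 2) by decide] at a2
  obtain ⟨H, hH, hcard, p1, -, p2⟩ := exists_periodic_of_sum_eq hA φ (u := (2, 1)) (v := (2, 1))
    (w := (4, 2)) (by decide) (by linarith) (by linarith) (by linarith) (by linarith)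
  obtain ⟨H', hH', hcard', p2', -, p3'⟩ := exists_periodic_of_sum_eq hA φ (u := (4, 2))
    (v := (4, 2)) (w := (3, 4)) (by decide) (by linarith) (by linarith) (by linarith) (by linarith)
  obtain ⟨H'', hH'', hcard'', p3'', -, p4''⟩ := exists_periodic_of_sum_eq hA φ (u := (3, 4))
    (v := (3, 4)) (w := (1, 3)) (by decide) (by linarith) (by linarith) (by linarith) (by linarith)
  have hlt : ∀ u, dens A φ u = 0.4 → (cell A φ u).card < Nat.card (LinearMap.ker φ) := by
    intro u hu
    have := natCard_ker_pos φ
    have h1 := dens_mul_card A φ u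
    rw [hu] at h1
    have : ((cell A φ u).card : ℝ) < Nat.card (LinearMap.ker φ) := by linarith
    exact_mod_cast this
  have hne : ∀ u, dens A φ u = 0.4 → (cell A φ u).Nonempty := fun u hu =>
    dens_pos.1 (by rw [hu]; norm_num)
  obtain rfl := periodic_subgroup_eq hcard hcard' (hne _ a2) p2 p2' (hlt _ a2)
  obtain rfl := periodic_subgroup_eq hcard hcard'' (hne _ a3) p3' p3'' (hlt _ a3)
  -- a functional taking the values `1` and `2` on the first cell
  obtain ⟨ψ₀, hψ₀, k, hk, hk1⟩ := exists_functional hH hcard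
  have hcard₀ : (((cell A φ (2, 1)).image ψ₀).card : ℝ) = 5 * dens A φ (2, 1) :=
    card_image_of_periodic (by rw [hψ₀]; exact hcard) (by rw [hψ₀]; exact p1)
  obtain ⟨s, hs, t, ht, hst⟩ : ∃ s ∈ (cell A φ (2, 1)).image ψ₀,
      ∃ t ∈ (cell A φ (2, 1)).image ψ₀, s ≠ t := by
    refine Finset.one_lt_card.1 ?_
    rw [a1] at hcard₀
    have : (1 : ℝ) < ((cell A φ (2, 1)).image ψ₀).card := by rw [hcard₀]; norm_num
    exact_mod_cast this
  -- An affine map of `𝔽₅` takes the two values to `1` and `2`. The shift is realised linearly by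
  -- adding `m` times the first coordinate of `φ`, which is `2` on this cell.
  obtain ⟨c, m, hc, hcs, hct⟩ : ∃ c m : ZMod 5, c ≠ 0 ∧ c * s + m * 2 = 1 ∧ c * t + m * 2 = 2 := by
    clear hs ht
    revert s t
    decide
  set ψ : G →ₗ[ZMod 5] ZMod 5 := c • ψ₀ + m • (LinearMap.fst _ _ _ ∘ₗ φ) with hψdef
  have hψa : ∀ x, ψ x = c * ψ₀ x + m * (φ x).1 := fun x => rfl
  have hψ : LinearMap.ker φ ⊓ LinearMap.ker ψ = H := by
    rw [← hψ₀]
    ext x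
    simp only [Submodule.mem_inf, LinearMap.mem_ker]
    refine and_congr_right fun hx => ?_
    rw [hψa, hx]
    simp [hc]
  have hcard1 : Nat.card (LinearMap.ker φ) =
      5 * Nat.card (LinearMap.ker φ ⊓ LinearMap.ker ψ : Submodule (ZMod 5) G) := by rw [hψ, hcard]
  rw [← hψ] at p1 p2 p3' p4''
  have hcd : ∀ u, dens A φ u = 0.4 →
      (∀ x ∈ cell A φ u, ∀ h ∈ LinearMap.ker φ ⊓ LinearMap.ker ψ, x + h ∈ cell A φ u) →
      ((cell A φ u).image ψ).card = 2 := by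
    intro u hu hp
    have := card_image_of_periodic hcard1 hp
    rw [hu] at this
    have h2 : (((cell A φ u).image ψ).card : ℝ) = 2 := by rw [this]; norm_num
    exact_mod_cast h2
  have d1 := hcd _ a1 p1
  have d2 := hcd _ a2 p2
  have d3 := hcd _ a3 p3'
  have d4 := hcd _ a4 p4''
  have m1 : ∀ r ∈ (cell A φ (2, 1)).image ψ₀, c * r + m * 2 ∈ (cell A φ (2, 1)).image ψ := by
    intro r hr
    obtain ⟨x, hx, rfl⟩ := Finset.mem_image.1 hr
    exact Finset.mem_image.2 ⟨x, hx, by rw [hψa, (mem_cell.1 hx).2]⟩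
  have v1 : (1 : ZMod 5) ∈ (cell A φ (2, 1)).image ψ := by
    have := m1 s hs; rwa [hcs] at this
  have v2 : (2 : ZMod 5) ∈ (cell A φ (2, 1)).image ψ := by
    have := m1 t ht; rwa [hct] at this
  have s1 : (cell A φ (2, 1)).image ψ = {1, 2} := by
    symm
    refine Finset.eq_of_subset_of_card_le ?_ (by rw [d1]; decide)
    intro r hr
    simp only [Finset.mem_insert, Finset.mem_singleton] at hr
    rcases hr with rfl | rfl <;> assumption
  -- A two-element `S ⊆ 𝔽₅` has `|S + S| = 3`, so a two-element set disjoint from `S + S` is its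
  -- complement.
  have step : ∀ S T U : Finset (ZMod 5), S.card = 2 → T.card = 2 →
      (∀ p ∈ S, ∀ q ∈ S, p + q ∉ T) → U.card = 2 → (∀ p ∈ S, ∀ q ∈ S, p + q ∉ U) → T = U := by
    have hc : ∀ S : Finset (ZMod 5), S.card = 2 → (S + S)ᶜ.card = 2 := by decide
    have key : ∀ S T : Finset (ZMod 5), S.card = 2 → T.card = 2 →
        (∀ p ∈ S, ∀ q ∈ S, p + q ∉ T) → T = (S + S)ᶜ := by
      intro S T hS hT h
      refine Finset.eq_of_subset_of_card_le (fun r hr => ?_) (by rw [hc S hS, hT])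
      rw [Finset.mem_compl, Finset.mem_add]
      rintro ⟨p, hp, q, hq, rfl⟩
      exact h p hp q hq hr
    intro S T U hS hT h1 hU h2
    rw [key S T hS hT h1, key S U hS hU h2]
  have s2 : (cell A φ (4, 2)).image ψ = {0, 1} :=
    step _ _ _ d1 d2 (image_add_notMem hA (by decide) p2) (by decide) (by rw [s1]; decide)
  have s3 : (cell A φ (3, 4)).image ψ = {3, 4} :=
    step _ _ _ d2 d3 (image_add_notMem hA (by decide) p3') (by decide) (by rw [s2]; decide)
  have s4 : (cell A φ (1, 3)).image ψ = {0, 4} :=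
    step _ _ _ d3 d4 (image_add_notMem hA (by decide) p4'') (by decide) (by rw [s3]; decide)
  have b1 := fun x => mem_iff_of_periodic (x := x) p1
  have b2 := fun x => mem_iff_of_periodic (x := x) p2
  have b3 := fun x => mem_iff_of_periodic (x := x) p3'
  have b4 := fun x => mem_iff_of_periodic (x := x) p4''
  rw [s1] at b1
  rw [s2] at b2
  rw [s3] at b3
  rw [s4] at b4
  refine ⟨(LinearMap.fst _ _ _ ∘ₗ φ).prod ((LinearMap.snd _ _ _ ∘ₗ φ).prod ψ), ?_, fun x => ?_⟩
  · rintro ⟨u₁, u₂, t⟩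
    obtain ⟨x, hx, hxt⟩ := exists_fibre_apply_eq hφ (ψ := ψ) ⟨c⁻¹ • k, by
      rw [LinearMap.mem_ker, map_smul, LinearMap.mem_ker.1 hk, smul_zero], by
      rw [hψa, map_smul, map_smul, LinearMap.mem_ker.1 hk, hk1]; simp [hc]⟩ (u₁, u₂) t
    exact ⟨x, by simp [hx, hxt]⟩
  · change x ∈ A ↔ ((φ x).1, (φ x).2, ψ x) ∈ vlLambda
    have hv : ((φ x).1, (φ x).2, ψ x) ∈ vlLambda ↔
        (φ x = (1, 0) ∨ φ x = (4, 0) ∨ φ x = (0, 1) ∨ φ x = (0, 4)) ∨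
        (φ x = (2, 1) ∧ ψ x ∈ ({1, 2} : Finset (ZMod 5))) ∨
        (φ x = (4, 2) ∧ ψ x ∈ ({0, 1} : Finset (ZMod 5))) ∨
        (φ x = (3, 4) ∧ ψ x ∈ ({3, 4} : Finset (ZMod 5))) ∨
        (φ x = (1, 3) ∧ ψ x ∈ ({0, 4} : Finset (ZMod 5))) := by
      generalize φ x = u
      generalize ψ x = t
      obtain ⟨u₁, u₂⟩ := u
      simp only [vlLambda, Set.mem_union, Set.mem_ofPred_eq, Set.mem_insert_iff,
        Set.mem_singleton_iff, Prod.mk.injEq]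
      revert u₁ u₂ t
      decide
    rw [hv]
    constructor
    · intro hx
      have h5 := hsupp _ (dens_ne_zero hx)
      have key : ∀ u ∈ ({(1, 0), -(1, 0), (0, 1), -(0, 1), (2, 1), -(2, 1), (1, -2), -(1, -2)} :
          Finset (ZMod 5 × ZMod 5)), (u = (1, 0) ∨ u = (4, 0) ∨ u = (0, 1) ∨ u = (0, 4)) ∨
          u = (2, 1) ∨ u = (4, 2) ∨ u = (3, 4) ∨ u = (1, 3) := by decide
      rcases key _ h5 with h6 | h6 | h6 | h6 | h6
      · exact Or.inl h6
      · exact Or.inr (Or.inl ⟨h6, (b1 x h6).1 hx⟩)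
      · exact Or.inr (Or.inr (Or.inl ⟨h6, (b2 x h6).1 hx⟩))
      · exact Or.inr (Or.inr (Or.inr (Or.inl ⟨h6, (b3 x h6).1 hx⟩)))
      · exact Or.inr (Or.inr (Or.inr (Or.inr ⟨h6, (b4 x h6).1 hx⟩)))
    · rintro ((h6 | h6 | h6 | h6) | ⟨h6, h7⟩ | ⟨h6, h7⟩ | ⟨h6, h7⟩ | ⟨h6, h7⟩)
      · exact mem_of_dens_eq_one e1 h6
      · exact mem_of_dens_eq_one e2 h6
      · exact mem_of_dens_eq_one f1 h6
      · exact mem_of_dens_eq_one f2 h6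
      · exact (b1 x h6).2 h7
      · exact (b2 x h6).2 h7
      · exact (b3 x h6).2 h7
      · exact (b4 x h6).2 h7

/-- The extremal shape has exactly the threshold density, which provides the upper bound required
when such a set occurs inside a hyperplane. -/
lemma sum_dens_of_dens {A : Finset G} {φ : G →ₗ[ZMod 5] ZMod 5 × ZMod 5}
    (he : node (dens A φ) (1, 0) = 2) (hf : node (dens A φ) (0, 1) = 2)
    (h₁ : node (dens A φ) (2, 1) = 0.8) (h₂ : node (dens A φ) (1, -2) = 0.8)
    (hsupp : ∀ u, dens A φ u ≠ 0 → u ∈ ({(1, 0), -(1, 0), (0, 1), -(0, 1), (2, 1), -(2, 1),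
      (1, -2), -(1, -2)} : Finset (ZMod 5 × ZMod 5))) :
    ∑ u, dens A φ u = 5.6 := by
  have hz : ∀ u : ZMod 5 × ZMod 5, u ∉ ({(1, 0), -(1, 0), (0, 1), -(0, 1), (2, 1), -(2, 1),
      (1, -2), -(1, -2)} : Finset (ZMod 5 × ZMod 5)) → dens A φ u = 0 := by
    intro u hu
    by_contra hc
    exact hu (hsupp u hc)
  have hn : ∀ u : ZMod 5 × ZMod 5, (u ∉ ({(1, 0), -(1, 0), (0, 1), -(0, 1), (2, 1), -(2, 1),
      (1, -2), -(1, -2)} : Finset (ZMod 5 × ZMod 5)) ∧ -u ∉ ({(1, 0), -(1, 0), (0, 1), -(0, 1),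
      (2, 1), -(2, 1), (1, -2), -(1, -2)} : Finset (ZMod 5 × ZMod 5))) →
      node (dens A φ) u = 0 := by
    rintro u ⟨h1, h2⟩
    rw [node, hz u h1, hz _ h2, add_zero]
  rw [IsProfile.sum_eq_nodes, he, hf, h₁, h₂, hz 0 (by decide), hn (2, 0) (by decide),
    hn (1, 1) (by decide), hn (2, -1) (by decide), hn (1, -1) (by decide), hn (0, 2) (by decide),
    hn (1, 2) (by decide), hn (2, 2) (by decide), hn (2, -2) (by decide)]
  norm_num

lemma card_eq_mul_natCard_ker {φ : G →ₗ[ZMod 5] ZMod 5 × ZMod 5} (hφ : Function.Surjective φ) :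
    (Fintype.card G : ℝ) = 25 * Nat.card (LinearMap.ker φ) := by
  rw [card_eq_card_mul_card_ker hφ, Fintype.card_prod, ZMod.card]
  push_cast
  ring

lemma sum_dens_mul {A : Finset G} {φ : G →ₗ[ZMod 5] ZMod 5 × ZMod 5}
    (hφ : Function.Surjective φ) : (∑ u, dens A φ u) * Fintype.card G = 25 * A.card := by
  rw [sum_dens, card_eq_mul_natCard_ker hφ]
  have := (natCard_ker_pos φ).ne'
  field_simp

lemma le_sum_dens {A : Finset G} {φ : G →ₗ[ZMod 5] ZMod 5 × ZMod 5}
    (hφ : Function.Surjective φ) (hcard : 28 * Fintype.card G ≤ 125 * A.card) :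
    5.6 ≤ ∑ u, dens A φ u := by
  have h1 := sum_dens_mul (A := A) hφ
  have h2 : (28 : ℝ) * Fintype.card G ≤ 125 * A.card := by exact_mod_cast hcard
  have h3 : (0 : ℝ) < Fintype.card G := by exact_mod_cast Fintype.card_pos
  refine le_of_mul_le_mul_right ?_ h3
  linarith

lemma exists_functional_of_dens {A : Finset G} {φ : G →ₗ[ZMod 5] ZMod 5 × ZMod 5}
    (hφ : Function.Surjective φ) {s : ZMod 5}
    (hs : ∀ u, dens A φ u ≠ 0 → u.1 + s * u.2 = 1 ∨ u.1 + s * u.2 = -1) :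
    ∃ f : G →ₗ[ZMod 5] ZMod 5, f ≠ 0 ∧ ∀ x ∈ A, f x = 1 ∨ f x = -1 := by
  refine ⟨LinearMap.fst _ _ _ ∘ₗ φ + s • (LinearMap.snd _ _ _ ∘ₗ φ), fun h => ?_,
    fun x hx => hs _ (dens_ne_zero hx)⟩
  obtain ⟨x, hx⟩ := hφ (1, 0)
  have h1 : (φ x).1 + s * (φ x).2 = 0 := DFunLike.congr_fun h x
  rw [hx] at h1
  simp at h1

/-- A sum-free set of density at least `28 / 125` which is very dense on a pair of opposite
subspaces of codimension two is normal or extremal. -/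
theorem normal_or_vlLambda_of_lt {A : Finset G} (hA : ∀ x ∈ A, ∀ y ∈ A, x + y ∉ A)
    {φ₀ : G →ₗ[ZMod 5] ZMod 5 × ZMod 5} (hφ₀ : Function.Surjective φ₀)
    (h₀ : 1.6 < node (dens A φ₀) (1, 0)) (hcard : 28 * Fintype.card G ≤ 125 * A.card) :
    (∃ f : G →ₗ[ZMod 5] ZMod 5, f ≠ 0 ∧ ∀ x ∈ A, f x = 1 ∨ f x = -1) ∨
    ((∃ θ : G →ₗ[ZMod 5] ZMod 5 × ZMod 5 × ZMod 5, Function.Surjective θ ∧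
      ∀ x, x ∈ A ↔ θ x ∈ vlLambda) ∧ 28 * Fintype.card G = 125 * A.card) := by
  obtain ⟨φ₁, hφ₁, hle, hmax⟩ := exists_pairBound A hφ₀
  obtain ⟨φ, hφ, hd, hd', hF⟩ := exists_normalized A hφ₁
  have hnode : node (dens A φ₁) (1, 0) = node (dens A φ) (1, 0) := by
    rw [node, node, hd, hd']
  rw [hnode] at hle hmax
  have h16 : 1.6 < node (dens A φ) (1, 0) := h₀.trans_le hle
  have hprof := isProfile_dens hA φ
  obtain ⟨p1, p2⟩ := hprof.pos_of_one_lt_node (u := (1, 0)) (by linarith)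
  rcases hprof.shape_cases (le_sum_dens hφ hcard) hF (hmax.node_le hφ (by decide))
    (K := 2.4 - node (dens A φ) (1, 0)) (fun v _ h1 h2 => by
      rw [← IsProfile.node_neg (u := v + (1, 0))] at h2 ⊢
      linarith [hprof.node_add_node_add_node_le (u := (1, 0)) (v := v) (w := -(v + (1, 0)))
        (by abel) p1 p2 h1 h2])
    (fun h => by linarith) (Or.inl ⟨h16, rfl⟩) with
    ⟨s, hs⟩ | ⟨s, hs, h1, h2, h3, h4, h5⟩ | ⟨h1, -⟩ | ⟨h1, -⟩
  · exact Or.inl (exists_functional_of_dens hφ hs)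
  · right
    -- The reflection `diag(1, s)` reduces `s = -1` to `s = 1`.
    have hdet : (1 : ZMod 5) * s - 0 * 0 ≠ 0 := by rcases hs with rfl | rfl <;> decide
    have hss : s * s = 1 := by rcases hs with rfl | rfl <;> decide
    set σ := planeEquiv 1 0 0 s hdet with hσ
    have hsym : ∀ x y, σ.symm.symm (x, y) = (x, s * y) := fun x y => by
      rw [LinearEquiv.symm_symm, planeEquiv_apply]; simp
    have hφ' : Function.Surjective (σ.symm.toLinearMap ∘ₗ φ) := σ.symm.surjective.comp hφ
    have g1 : node (dens A (σ.symm.toLinearMap ∘ₗ φ)) (1, 0) = 2 := by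
      rw [node_dens_comp_equiv, hsym, mul_zero, h1]
    have g2 : node (dens A (σ.symm.toLinearMap ∘ₗ φ)) (0, 1) = 2 := by
      rw [node_dens_comp_equiv, hsym, ← h2]
      refine IsProfile.node_congr ?_
      rcases hs with rfl | rfl <;> decide
    have g3 : node (dens A (σ.symm.toLinearMap ∘ₗ φ)) (2, 1) = 0.8 := by
      rw [node_dens_comp_equiv, hsym, mul_one, h3]
    have g4 : node (dens A (σ.symm.toLinearMap ∘ₗ φ)) (1, -2) = 0.8 := by
      rw [node_dens_comp_equiv, hsym, mul_comm, h4]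
    have g5 : ∀ u, dens A (σ.symm.toLinearMap ∘ₗ φ) u ≠ 0 → u ∈ ({(1, 0), -(1, 0), (0, 1),
        -(0, 1), (2, 1), -(2, 1), (1, -2), -(1, -2)} : Finset (ZMod 5 × ZMod 5)) := by
      rintro ⟨x, y⟩ hu
      rw [dens_comp_equiv, hsym] at hu
      have := h5 _ hu
      clear hu h5
      revert x y
      rcases hs with rfl | rfl <;> decide
    refine ⟨exists_vlLambda_of_dens hA hφ' g1 g2 g3 g4 g5, ?_⟩
    have := sum_dens_mul (A := A) hφ'
    rw [sum_dens_of_dens g1 g2 g3 g4 g5] at this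
    have h6 : (28 : ℝ) * Fintype.card G = 125 * A.card := by linarith
    exact_mod_cast h6
  · linarith
  · linarith

end Extremal

/-! ### Neighbouring nodes when the axis is only moderately dense -/

namespace Tri

variable {x y z α β s p q : ℝ}

lemma swap₂₃ (h : Tri x y z) : Tri x z y := h.rotate.swap.rotate.rotate

lemma add_le_of_three_fifths_lt (h : Tri α x y) (hα : 0.6 < α) : x + y ≤ 0.4 := by
  have := h.rotate.add_le_of_lt 3 (by norm_num; linarith)
  norm_num at this
  linarith

/-- `M = 5` is impossible: `α > 4/5` would need `x' = 5`, while `y', z' ≥ 1` leave at most four. -/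
lemma add_add_le_of_four_fifths_lt (h : Tri α x y) (hα : 0.8 < α) : α + x + y ≤ 1.04 := by
  rcases h.cases with ⟨h, -⟩ | ⟨x', y', z', h1, h2, h3, h4, h5, h6, h7⟩
  · exact h
  · exfalso
    have : x' ≤ 4 := by omega
    have : (x' : ℝ) ≤ 4 := by exact_mod_cast this
    linarith

lemma le_of_four_fifths_le (h : Tri α x y) (hα : α = 0.8) (hxy : x + y = 0.4) :
    x = 0.2 ∧ y = 0.2 := by
  rcases h.cases with ⟨h, -⟩ | ⟨x', y', z', h1, h2, h3, h4, h5, h6, h7⟩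
  · linarith
  · have h8 : 4 ≤ x' := by
      have : (4 : ℝ) ≤ x' := by linarith
      exact_mod_cast this
    have h9 : y' = 1 := by omega
    have h10 : z' = 1 := by omega
    rw [h9] at h5
    rw [h10] at h6
    push_cast at h5 h6
    constructor <;> linarith

/-- Two triangles share the cell `s`, and `s + p ≤ 2/5`. If `q > 2/5`, then either one triangle has
index at least `25`, giving `26/25 + 6/5 = 2.24`, or the second has index five with hull sizes `2,
1, 3`, giving `0.8 + 0.4 + 0.4 + 0.6`. -/
lemma add_add_le_or (h₁ : Tri α s p) (h₂ : Tri β s q) (hα : 0.6 < α) (hs : 0 < s)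
    (hαβ : 1.12 < α + β) : s + p + q ≤ 0.8 ∨ α + β + s + p + q ≤ 2.24 := by
  have hsp := h₁.add_le_of_three_fifths_lt hα
  by_cases hq : q ≤ 0.4
  · left; linarith
  rcases h₂.cases with ⟨h, -⟩ | ⟨x', y', z', k1, k2, k3, k4, k5, k6, k7⟩
  · right; linarith [h₁.add_add_le]
  · have hz : 3 ≤ z' := by
      have : (2 : ℝ) < z' := by linarith
      exact_mod_cast this
    by_cases hα8 : 0.8 < α
    · right; linarith [h₁.add_add_le_of_four_fifths_lt hα8, h₂.add_add_le]
    · have hx : 2 ≤ x' := by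
        have : (1 : ℝ) < x' := by linarith
        exact_mod_cast this
      have hx' : x' = 2 := by omega
      have hz' : z' = 3 := by omega
      rw [hx'] at k4
      rw [hz'] at k6
      push_cast at k4 k6
      right; linarith

lemma add_add_lt (h₁ : Tri α s p) (h₂ : Tri β s q) (hs : 0 < s)
    (hαβ : α + β = 1.6) (hβα : β ≤ α) : s + p + q < 0.8 := by
  have hsp := h₁.add_le_of_three_fifths_lt (by linarith)
  by_cases hα8 : 0.8 < α
  · linarith [h₁.add_add_le_of_four_fifths_lt hα8, h₂.add_add_le]
  · linarith [h₂.add_le_of_three_fifths_lt (by linarith)]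

end Tri

namespace IsProfile

variable {W : Type*} [AddCommGroup W] {a : W → ℝ} {e u v : W}

lemma pos_or_pos (hv : 0 < node a v) : 0 < a v ∨ 0 < a (-v) := by
  unfold node at hv
  by_contra! hc
  linarith [hc.1, hc.2]

/-- Two neighbouring nodes are small if the axis is dense in one direction. -/
lemma edge_le (h : IsProfile a) (hα : 0.6 < a e) (hβ : 0 < a (-e)) (hP : 1.12 < node a e)
    (huv : e + u = v) (hu : 0 < node a u) (hv : 0 < node a v) :
    node a u + node a v ≤ 0.8 ∨ node a e + (node a u + node a v) ≤ 2.24 := by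
  have r1 : e + -v = -u := by rw [← huv]; abel
  have r2 : -v + u = -e := by rw [← huv]; abel
  have r3 : -u + v = e := by rw [← huv]; abel
  unfold node at hu hv hP ⊢
  have t1 : 0 < a u → 0 < a v → Tri (a e) (a u) (a v) := fun h1 h2 =>
    h.tri huv (by linarith) h1 h2
  have t2 : 0 < a (-u) → 0 < a (-v) → Tri (a e) (a (-v)) (a (-u)) := fun h1 h2 =>
    h.tri r1 (by linarith) h2 h1
  have t3 : 0 < a (-u) → 0 < a v → Tri (a e) (a (-u)) (a v) := fun h1 h2 =>
    (h.tri r3 h1 h2 (by linarith)).rotate.rotate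
  have t4 : 0 < a u → 0 < a (-v) → Tri (a (-e)) (a (-v)) (a u) := fun h1 h2 =>
    (h.tri r2 h2 h1 hβ).rotate.rotate
  have s1 : ∀ {x y}, Tri (a e) x y → x + y ≤ 0.4 := fun k => k.add_le_of_three_fifths_lt hα
  have := h.le_one e
  rcases (h.nonneg u).eq_or_lt' with k1 | k1 <;>
  rcases (h.nonneg (-u)).eq_or_lt' with k2 | k2 <;>
  rcases (h.nonneg v).eq_or_lt' with k3 | k3 <;>
  rcases (h.nonneg (-v)).eq_or_lt' with k4 | k4
  all_goals
    first
    | (exfalso; linarith)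
    | (left; linarith [s1 (t1 k1 k3), s1 (t2 k2 k4)])
    | (left; linarith [s1 (t1 k1 k3), s1 (t3 k2 k3)])
    | (left; linarith [s1 (t2 k2 k4), s1 (t3 k2 k3)])
    | (left; linarith [s1 (t1 k1 k3)])
    | (left; linarith [s1 (t2 k2 k4)])
    | (left; linarith [s1 (t3 k2 k3)])
    | (right; linarith [(t4 k1 k4).add_add_le])
    | skip
  -- What remains are the patterns with three nonempty cells in which two triangles share one of
  -- them.
  · rcases (t1 k1 k3).add_add_le_or (t4 k1 k4).swap₂₃ hα k1 hP with k | k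
    · left; linarith
    · right; linarith
  · rcases (t2 k2 k4).add_add_le_or (t4 k1 k4) hα k4 hP with k | k
    · left; linarith
    · right; linarith

/-- Only four nonempty cells can reach `4/5`, through two disjoint triangles with `e`, each
contributing `2/5`. Then `a e > 4/5` is impossible, and index five pins every cell. -/
lemma eq_of_le_edge (h : IsProfile a) (hP : node a e = 1.6) (hβα : a (-e) ≤ a e)
    (huv : e + u = v) (hu : 0 < node a u) (hv : 0 < node a v)
    (huv8 : 0.8 ≤ node a u + node a v) :
    a e = 0.8 ∧ a (-e) = 0.8 ∧ a u = 0.2 ∧ a (-u) = 0.2 ∧ a v = 0.2 ∧ a (-v) = 0.2 := by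
  have r1 : e + -v = -u := by rw [← huv]; abel
  have r2 : -v + u = -e := by rw [← huv]; abel
  have r3 : -u + v = e := by rw [← huv]; abel
  unfold node at hu hv hP huv8
  have hα : 0.6 < a e := by linarith
  have hβ : 0 < a (-e) := by linarith [h.le_one e]
  have t1 : 0 < a u → 0 < a v → Tri (a e) (a u) (a v) := fun h1 h2 =>
    h.tri huv (by linarith) h1 h2
  have t2 : 0 < a (-u) → 0 < a (-v) → Tri (a e) (a (-v)) (a (-u)) := fun h1 h2 =>
    h.tri r1 (by linarith) h2 h1
  have t3 : 0 < a (-u) → 0 < a v → Tri (a e) (a (-u)) (a v) := fun h1 h2 =>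
    (h.tri r3 h1 h2 (by linarith)).rotate.rotate
  have t4 : 0 < a u → 0 < a (-v) → Tri (a (-e)) (a (-v)) (a u) := fun h1 h2 =>
    (h.tri r2 h2 h1 hβ).rotate.rotate
  have s1 : ∀ {x y}, Tri (a e) x y → x + y ≤ 0.4 := fun k => k.add_le_of_three_fifths_lt hα
  have := h.le_one e
  rcases (h.nonneg u).eq_or_lt' with k1 | k1 <;>
  rcases (h.nonneg (-u)).eq_or_lt' with k2 | k2 <;>
  rcases (h.nonneg v).eq_or_lt' with k3 | k3 <;>
  rcases (h.nonneg (-v)).eq_or_lt' with k4 | k4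
  all_goals
    first
    | (exfalso; linarith)
    | (exfalso; linarith [s1 (t1 k1 k3), s1 (t3 k2 k3)])
    | (exfalso; linarith [s1 (t2 k2 k4), s1 (t3 k2 k3)])
    | (exfalso; linarith [s1 (t1 k1 k3)])
    | (exfalso; linarith [s1 (t2 k2 k4)])
    | (exfalso; linarith [s1 (t3 k2 k3)])
    | (exfalso; linarith [(t4 k1 k4).add_add_le])
    | skip
  · exfalso
    linarith [(t1 k1 k3).add_add_lt (t4 k1 k4).swap₂₃ k1 hP hβα]
  · exfalso
    linarith [(t2 k2 k4).add_add_lt (t4 k1 k4) k4 hP hβα]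
  · have b1 := s1 (t1 k1 k3)
    have b2 := s1 (t2 k2 k4)
    have hα8 : a e = 0.8 := by
      refine le_antisymm ?_ (by linarith)
      by_contra! hc
      linarith [(t1 k1 k3).add_add_le_of_four_fifths_lt hc]
    obtain ⟨c1, c2⟩ := (t1 k1 k3).le_of_four_fifths_le hα8 (by linarith)
    obtain ⟨c3, c4⟩ := (t2 k2 k4).le_of_four_fifths_le hα8 (by linarith)
    exact ⟨hα8, by linarith, c1, c4, c2, c3⟩

/-- The version of `IsProfile.edge_le` for a balanced axis, given the corresponding inequalities
between the cells on the same side. -/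
lemma edge_le_of_balanced (h : IsProfile a) (hα : 0.4 < a e) (hβ : 0.4 < a (-e))
    (hP : node a e ≤ 1.2)
    (hin : ∀ u v, e + u = v → 0 < a u → 0 < a v →
      a u + a v ≤ 0.44 ∧ a e + a u + a v ≤ 1.04 ∧ a (-e) + a u + a v ≤ 1.04)
    (huv : e + u = v) (hu : 0 < node a u) (hv : 0 < node a v) :
    node a e + (node a u + node a v) ≤ 2.24 := by
  have r1 : e + -v = -u := by rw [← huv]; abel
  have r2 : -v + u = -e := by rw [← huv]; abel
  have r3 : -u + v = e := by rw [← huv]; abel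
  unfold node at hu hv hP ⊢
  have t1 := hin u v huv
  have t2 := hin (-v) (-u) r1
  have t3 : 0 < a (-u) → 0 < a v → Tri (a e) (a (-u)) (a v) := fun h1 h2 =>
    (h.tri r3 h1 h2 (by linarith)).rotate.rotate
  have t4 : 0 < a u → 0 < a (-v) → Tri (a (-e)) (a (-v)) (a u) := fun h1 h2 =>
    (h.tri r2 h2 h1 (by linarith)).rotate.rotate
  have s2 : ∀ {w x y}, 0.4 < w → Tri w x y → x + y ≤ 0.6 := fun hw k => by
    have := k.rotate.add_le_of_lt 2 (by norm_num; linarith)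
    norm_num at this
    linarith
  rcases (h.nonneg u).eq_or_lt' with k1 | k1 <;>
  rcases (h.nonneg (-u)).eq_or_lt' with k2 | k2 <;>
  rcases (h.nonneg v).eq_or_lt' with k3 | k3 <;>
  rcases (h.nonneg (-v)).eq_or_lt' with k4 | k4
  all_goals
    first
    | (exfalso; linarith)
    | linarith [t1 k1 k3, t2 k4 k2]
    | linarith [t1 k1 k3, (t4 k1 k4).add_add_le]
    | linarith [t2 k4 k2, (t4 k1 k4).add_add_le]
    | linarith [t1 k1 k3, (t3 k2 k3).add_add_le]
    | linarith [t2 k4 k2, (t3 k2 k3).add_add_le]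
    | linarith [t1 k1 k3]
    | linarith [t2 k4 k2]
    | linarith [s2 hα (t3 k2 k3)]
    | linarith [s2 hβ (t4 k1 k4)]

end IsProfile

namespace IsProfile

/-! ### Rows without an empty node -/

/-- Sum the five edge inequalities. The cycle is odd, so equality throughout makes all values equal.
-/
lemma five_cycle {y : ZMod 5 → ℝ} {c : ℝ} (hy : ∀ i, y i + y (i + 1) ≤ c) :
    ∑ i, y i ≤ 5 * c / 2 ∧ (5 * c / 2 ≤ ∑ i, y i → ∀ i, y i = c / 2) := by
  have hu : (Finset.univ : Finset (ZMod 5)) = {0, 1, 2, 3, 4} := by decide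
  have hs : ∑ i, y i = y 0 + y 1 + y 2 + y 3 + y 4 := by
    rw [hu]
    repeat rw [Finset.sum_insert (by decide)]
    rw [Finset.sum_singleton]
    ring
  have h0 := hy 0
  have h1 := hy 1
  have h2 := hy 2
  have h3 := hy 3
  have h4 := hy 4
  rw [show (0 + 1 : ZMod 5) = 1 by decide] at h0
  rw [show (1 + 1 : ZMod 5) = 2 by decide] at h1
  rw [show (2 + 1 : ZMod 5) = 3 by decide] at h2
  rw [show (3 + 1 : ZMod 5) = 4 by decide] at h3
  rw [show (4 + 1 : ZMod 5) = 0 by decide] at h4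
  rw [hs]
  refine ⟨by linarith, fun h i => ?_⟩
  have hi : ∀ i : ZMod 5, i = 0 ∨ i = 1 ∨ i = 2 ∨ i = 3 ∨ i = 4 := by decide
  rcases hi i with rfl | rfl | rfl | rfl | rfl <;> linarith

variable {a : ZMod 5 × ZMod 5 → ℝ} {v : ZMod 5 × ZMod 5} {c : ℝ}

/-- The neighbouring node has a nonempty cell, of one sign or the other, and either sign makes a
triangle with this cell and `(1, 0)`. -/
lemma le_of_row (h : IsProfile a) (hrow : ∀ i, 0 < node a (v + (i, 0)))
    (i : ZMod 5) : a (v + (i, 0)) ≤ 1 - a (1, 0) ∧ a (-(v + (i, 0))) ≤ 1 - a (1, 0) := by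
  have e1 : ((1, 0) : ZMod 5 × ZMod 5) + (v + (i - 1, 0)) = v + (i, 0) := by
    ext <;> simp; ring
  have e2 : ((1, 0) : ZMod 5 × ZMod 5) + -(v + (i + 1, 0)) = -(v + (i, 0)) := by
    ext <;> simp; ring
  have e3 : v + (i, 0) + -(v + (i - 1, 0)) = ((1, 0) : ZMod 5 × ZMod 5) := by
    ext <;> simp; ring
  have e4 : -(v + (i, 0)) + (v + (i + 1, 0)) = ((1, 0) : ZMod 5 × ZMod 5) := by
    ext <;> simp
  constructor
  · rcases pos_or_pos (hrow (i - 1)) with k | k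
    · linarith [h.add_le_one' e1 k]
    · linarith [h.add_le_one' e3 k]
  · rcases pos_or_pos (hrow (i + 1)) with k | k
    · linarith [h.add_le_one' e4 k]
    · linarith [h.add_le_one' e2 k]

/-- The cells `v + (i, 0)` and their negatives form two separate five-cycles; `hαc` covers edges
with an empty end. -/
lemma sum_row_le (h : IsProfile a) (hαc : 1 - a (1, 0) ≤ c)
    (hin : ∀ u w : ZMod 5 × ZMod 5, (1, 0) + u = w → 0 < a u → 0 < a w → a u + a w ≤ c)
    (hrow : ∀ i, 0 < node a (v + (i, 0))) :
    ∑ i, node a (v + (i, 0)) ≤ 5 * c ∧ (5 * c ≤ ∑ i, node a (v + (i, 0)) →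
      ∀ i, a (v + (i, 0)) = c / 2 ∧ a (-(v + (i, 0))) = c / 2) := by
  have hs : ∑ i, node a (v + (i, 0)) = ∑ i, a (v + (i, 0)) + ∑ i, a (-(v + (i, 0))) := by
    simp only [node, Finset.sum_add_distrib]
  have pair : ∀ u w : ZMod 5 × ZMod 5, (1, 0) + u = w → a u ≤ 1 - a (1, 0) →
      a w ≤ 1 - a (1, 0) → a u + a w ≤ c := by
    intro u w huw h1 h2
    rcases (h.nonneg u).eq_or_lt' with hu | hu
    · linarith
    rcases (h.nonneg w).eq_or_lt' with hw | hw
    · linarith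
    exact hin u w huw hu hw
  have c1 := five_cycle (y := fun i => a (v + (i, 0))) (c := c) (fun i =>
    pair _ _ (by ext <;> simp; ring) (h.le_of_row hrow i).1 (h.le_of_row hrow (i + 1)).1)
  have c2 := five_cycle (y := fun i => a (-(v + (i, 0)))) (c := c) (fun i => by
    rw [add_comm]
    exact pair _ _ (by ext <;> simp; ring) (h.le_of_row hrow (i + 1)).2 (h.le_of_row hrow i).2)
  rw [hs]
  refine ⟨by linarith [c1.1, c2.1], fun hc i => ⟨c1.2 (by linarith [c2.1]) i,
    c2.2 (by linarith [c1.1]) i⟩⟩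

lemma sum_row_le_two (h : IsProfile a) (hα : 0.6 < a (1, 0))
    (hrow : ∀ i, 0 < node a (v + (i, 0))) : ∑ i, node a (v + (i, 0)) ≤ 2 := by
  have := (h.sum_row_le (c := 0.4) (by linarith) (fun u w huw hu hw =>
    (h.tri huw (by linarith) hu hw).add_le_of_three_fifths_lt hα) hrow).1
  linarith

lemma eq_of_two_le_sum_row (h : IsProfile a) (hP : node a (1, 0) = 1.6)
    (hβα : a (-(1, 0)) ≤ a (1, 0)) (hrow : ∀ i, 0 < node a (v + (i, 0)))
    (h2 : 2 ≤ ∑ i, node a (v + (i, 0))) :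
    a (1, 0) = 0.8 ∧ a (-(1, 0)) = 0.8 ∧
      ∀ i, a (v + (i, 0)) = 0.2 ∧ a (-(v + (i, 0))) = 0.2 := by
  have hP' : a (1, 0) + a (-(1, 0)) = 1.6 := hP
  have hα : 0.6 < a (1, 0) := by linarith
  have h3 := (h.sum_row_le (c := 0.4) (by linarith) (fun u w huw hu hw =>
    (h.tri huw (by linarith) hu hw).add_le_of_three_fifths_lt hα) hrow).2 (by linarith)
  have h4 := (h.le_of_row hrow 0).1
  have h5 := (h3 0).1
  refine ⟨by linarith, by linarith, fun i => ⟨?_, ?_⟩⟩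
  · linarith [(h3 i).1]
  · linarith [(h3 i).2]

lemma sum_row_le_of_balanced (h : IsProfile a) (hα : 0.56 ≤ a (1, 0)) (hα' : a (1, 0) ≤ 0.6)
    (hβα : a (-(1, 0)) ≤ a (1, 0))
    (hin : ∀ u w : ZMod 5 × ZMod 5, (1, 0) + u = w → 0 < a u → 0 < a w → a u + a w ≤ 0.44)
    (hrow : ∀ i, 0 < node a (v + (i, 0))) :
    ∑ i, node a (v + (i, 0)) ≤ 2.2 ∧
      (node a (1, 0) = 1.2 → ∑ i, node a (v + (i, 0)) < 2.2) := by
  have h1 := h.sum_row_le (c := 0.44) (by linarith) hin hrow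
  refine ⟨by linarith [h1.1], fun hP => ?_⟩
  have hP' : a (1, 0) + a (-(1, 0)) = 1.2 := hP
  by_contra! hc
  -- Equality would give row cells of density `0.22` and `a (1, 0) = 0.6`. Rounding up then excludes
  -- both indices: `3 + 2 + 2 > 6` for `M = 5` and `15 + 6 + 6 > 26` for `M = 25`.
  have h2 := h1.2 (by linarith)
  have e0 : ((1, 0) : ZMod 5 × ZMod 5) + (v + (0, 0)) = v + (1, 0) := by
    ext <;> simp; ring
  have x0 := (h2 0).1
  have x1 := (h2 1).1
  rcases (h.tri e0 (by linarith) (by linarith) (by linarith)).cases with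
    ⟨-, M, x', y', z', hM, hM', k1, k2, k3, k4, k5, k6, k7⟩ |
    ⟨x', y', z', k1, k2, k3, k4, k5, k6, k7⟩
  · rw [x0] at k5
    rw [x1] at k6
    have hα6 : a (1, 0) = 0.6 := by linarith
    rw [hα6] at k4
    have k8 : (x' : ℝ) + y' + z' ≤ M + 1 := by exact_mod_cast k7
    have k9 : (M : ℝ) ≤ 25 := by linarith
    have : M ≤ 25 := by exact_mod_cast k9
    have hM25 : M = 25 := by omega
    subst hM25
    push_cast at k4 k5 k6
    have : 6 ≤ y' := by
      have : (5 : ℝ) < y' := by linarith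
      exact_mod_cast this
    have : 6 ≤ z' := by
      have : (5 : ℝ) < z' := by linarith
      exact_mod_cast this
    have : 15 ≤ x' := by
      have : (15 : ℝ) ≤ x' := by linarith
      exact_mod_cast this
    omega
  · have : 2 ≤ y' := by
      have : (1 : ℝ) < y' := by linarith
      exact_mod_cast this
    have : 2 ≤ z' := by
      have : (1 : ℝ) < z' := by linarith
      exact_mod_cast this
    have : 3 ≤ x' := by
      have : (2 : ℝ) < x' := by linarith
      exact_mod_cast this
    omega

end IsProfile

/-! ### Passing to hyperplanes through a dense pair of lines -/

section Hyperplane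

variable {G : Type*} [AddCommGroup G] [Module (ZMod 5) G] [Fintype G] [DecidableEq G]

lemma card_le_of_pairBound {A : Finset G} {P : ℝ} (hP : PairBound A P)
    {f L : G →ₗ[ZMod 5] ZMod 5} (hs : Function.Surjective (f.prod L))
    (hf : ∀ x ∈ A, L x = 0 → f x = 1 ∨ f x = -1) :
    ((A.filter (fun x => L x = 0)).card : ℝ) ≤ P * (Fintype.card G / 25) := by
  have h1 := hP _ hs
  have hN : (Fintype.card G : ℝ) / 25 = Nat.card (LinearMap.ker (f.prod L)) := by
    rw [card_eq_mul_natCard_ker hs]; ring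
  rw [hN]
  refine le_trans ?_ (mul_le_mul_of_nonneg_right h1 (natCard_ker_pos (f.prod L)).le)
  rw [node, add_mul, dens_mul_card, dens_mul_card, ← Nat.cast_add, Nat.cast_le]
  refine (Finset.card_le_card fun x hx => ?_).trans (Finset.card_union_le _ _)
  rw [Finset.mem_filter] at hx
  rw [Finset.mem_union, mem_cell, mem_cell]
  rcases hf x hx.1 hx.2 with h | h
  · exact Or.inl ⟨hx.1, by simp [h, hx.2]⟩
  · exact Or.inr ⟨hx.1, by simp [h, hx.2]⟩

/-- Inside the hyperplane `ker L` the pair of cells has node density above `8/5`, so the dense case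
applies there. A normal section lies in two opposite subspaces of codimension two and is bounded by
`P`; an extremal or sparse section has at most `1.12 · |G| / 25` elements. -/
lemma card_hyperplane_le {A : Finset G} (hA : ∀ x ∈ A, ∀ y ∈ A, x + y ∉ A) {P : ℝ}
    (hP : PairBound A P) (hP1 : 1.12 ≤ P) {χ : G →ₗ[ZMod 5] ZMod 5 × ZMod 5}
    {L : G →ₗ[ZMod 5] ZMod 5} (hs : Function.Surjective (χ.prod L))
    (h : 1.6 * (Fintype.card G : ℝ) < 125 * ((A.filter (fun x => χ x = (1, 0) ∧ L x = 0)).card +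
      (A.filter (fun x => χ x = -(1, 0) ∧ L x = 0)).card)) :
    ((A.filter (fun x => L x = 0)).card : ℝ) ≤ P * (Fintype.card G / 25) := by
  classical
  have hL : Function.Surjective L := fun t => by
    obtain ⟨x, hx⟩ := hs (0, t)
    exact ⟨x, congrArg Prod.snd hx⟩
  let _ : Fintype (LinearMap.ker L) := Fintype.ofFinite _
  set B : Finset (LinearMap.ker L) := Finset.univ.filter (fun x => (x : G) ∈ A) with hB
  set χ' : LinearMap.ker L →ₗ[ZMod 5] ZMod 5 × ZMod 5 := χ ∘ₗ (LinearMap.ker L).subtype with hχ'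
  have hχ's : Function.Surjective χ' := fun u => by
    obtain ⟨x, hx⟩ := hs (u, 0)
    exact ⟨⟨x, congrArg Prod.snd hx⟩, congrArg Prod.fst hx⟩
  have hBsum : ∀ x ∈ B, ∀ y ∈ B, x + y ∉ B := by
    intro x hx y hy hxy
    simp only [hB, Finset.mem_filter, Finset.mem_univ, true_and] at hx hy hxy
    exact hA _ hx _ hy hxy
  have hG : Fintype.card G = 5 * Fintype.card (LinearMap.ker L) := by
    rw [card_eq_card_mul_card_ker hL, ZMod.card, Nat.card_eq_fintype_card]
  have hGr : (Fintype.card G : ℝ) = 5 * Fintype.card (LinearMap.ker L) := by exact_mod_cast hG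
  have hBcard : B.card = (A.filter (fun x => L x = 0)).card := by
    rw [← Finset.card_image_of_injective B Subtype.val_injective]
    congr 1
    ext x
    simp [hB, and_comm]
  have hcell : ∀ u, (cell B χ' u).card = (A.filter (fun x => χ x = u ∧ L x = 0)).card := by
    intro u
    rw [← Finset.card_image_of_injective (cell B χ' u) Subtype.val_injective]
    congr 1
    ext x
    simp only [Finset.mem_image, mem_cell, hB, Finset.mem_filter, Finset.mem_univ, true_and]
    constructor
    · rintro ⟨y, ⟨h1, h2⟩, rfl⟩
      exact ⟨h1, h2, y.2⟩
    · rintro ⟨h1, h2, h3⟩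
      exact ⟨⟨x, h3⟩, ⟨h1, h2⟩, rfl⟩
  have hnode : 1.6 < node (dens B χ') (1, 0) := by
    have hk := natCard_ker_pos χ'
    have h1 := card_eq_mul_natCard_ker hχ's
    refine lt_of_mul_lt_mul_right ?_ hk.le
    rw [node, add_mul, dens_mul_card, dens_mul_card, hcell, hcell]
    linarith
  by_cases hsmall : 28 * Fintype.card (LinearMap.ker L) ≤ 125 * B.card
  · rcases normal_or_vlLambda_of_lt hBsum hχ's hnode hsmall with ⟨f, hf0, hf⟩ | ⟨-, heq⟩
    · obtain ⟨g, hg⟩ := LinearMap.exists_extend f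
      have hgf : ∀ x : LinearMap.ker L, g x = f x := fun x => DFunLike.congr_fun hg x
      refine card_le_of_pairBound hP (f := g) ?_ (fun x hx hLx => ?_)
      · obtain ⟨y, hy⟩ : ∃ y, f y ≠ 0 := by
          by_contra! hc
          exact hf0 (LinearMap.ext hc)
        rintro ⟨s, t⟩
        obtain ⟨x, hx1, hx2⟩ := exists_fibre_apply_eq hL (ψ := g) ⟨(f y)⁻¹ • (y : G),
          (LinearMap.ker L).smul_mem _ y.2, by simp [hgf, hy]⟩ t s
        exact ⟨x, by simp [hx1, hx2]⟩
      · have := hf ⟨x, hLx⟩ (by simp [hB, hx])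
        rwa [← hgf ⟨x, hLx⟩] at this
    · rw [← hBcard]
      have h1 : (28 : ℝ) * Fintype.card (LinearMap.ker L) = 125 * B.card := by exact_mod_cast heq
      have h2 : (0 : ℝ) ≤ Fintype.card (LinearMap.ker L) := Nat.cast_nonneg _
      rw [hGr]
      nlinarith
  · rw [← hBcard]
    have h1 : (125 : ℝ) * B.card < 28 * Fintype.card (LinearMap.ker L) := by
      exact_mod_cast not_le.1 hsmall
    have h2 : (0 : ℝ) ≤ Fintype.card (LinearMap.ker L) := Nat.cast_nonneg _
    rw [hGr]
    nlinarith

/-- The pencil of hyperplanes through a pair of opposite subspaces of codimension three. -/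
lemma card_pencil {A : Finset G} (hA : ∀ x ∈ A, ∀ y ∈ A, x + y ∉ A) {P : ℝ} (hP : PairBound A P)
    (hP1 : 1.12 ≤ P) {φ : G →ₗ[ZMod 5] ZMod 5 × ZMod 5} {ψ : G →ₗ[ZMod 5] ZMod 5}
    (hs : Function.Surjective (φ.prod ψ)) {b : ℕ}
    (hb : b = (A.filter (fun x => φ x = (1, 0) ∧ ψ x = 0)).card +
      (A.filter (fun x => φ x = -(1, 0) ∧ ψ x = 0)).card)
    (h : 1.6 * (Fintype.card G : ℝ) < 125 * b) :
    (A.card : ℝ) + 5 * b ≤ 6 * P * (Fintype.card G / 25) := by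
  have hsurj : ∀ u s t, ∃ x, φ x = (u, s) ∧ ψ x = t := by
    intro u s t
    obtain ⟨x, hx⟩ := hs ((u, s), t)
    exact ⟨x, congrArg Prod.fst hx, congrArg Prod.snd hx⟩
  have hr : ∀ r : ZMod 5, ((A.filter (fun x => ψ x - r * (φ x).2 = 0)).card : ℝ) ≤
      P * (Fintype.card G / 25) := by
    intro r
    refine card_hyperplane_le hA hP hP1 (χ := φ) (L := ψ - r • (LinearMap.snd _ _ _ ∘ₗ φ)) ?_ ?_
    · rintro ⟨⟨u, s⟩, t⟩
      obtain ⟨x, hx, hxt⟩ := hsurj u s (t + r * s)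
      exact ⟨x, by simp [hx, hxt]⟩
    · have e : ∀ u : ZMod 5 × ZMod 5, u.2 = 0 → A.filter (fun x => φ x = u ∧
          (ψ - r • (LinearMap.snd _ _ _ ∘ₗ φ)) x = 0) =
          A.filter (fun x => φ x = u ∧ ψ x = 0) := fun u hu =>
        Finset.filter_congr fun x _ => and_congr_right fun hx => by simp [hx, hu]
      rw [e _ rfl, e _ (by decide)]
      rw [hb] at h
      exact_mod_cast h
  have hinf : ((A.filter (fun x => (φ x).2 = 0)).card : ℝ) ≤ P * (Fintype.card G / 25) := by
    refine card_hyperplane_le hA hP hP1 (χ := (LinearMap.fst _ _ _ ∘ₗ φ).prod ψ)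
      (L := LinearMap.snd _ _ _ ∘ₗ φ) ?_ ?_
    · rintro ⟨⟨u, t⟩, s⟩
      obtain ⟨x, hx, hxt⟩ := hsurj u s t
      exact ⟨x, by simp [hx, hxt]⟩
    · have e : ∀ u : ZMod 5 × ZMod 5, u.2 = 0 →
          A.filter (fun x => ((LinearMap.fst _ _ _ ∘ₗ φ).prod ψ) x = u ∧
          (LinearMap.snd _ _ _ ∘ₗ φ) x = 0) = A.filter (fun x => φ x = u ∧ ψ x = 0) :=
        fun u hu => Finset.filter_congr fun x _ => by
          simp only [LinearMap.prod_apply, Prod.ext_iff, Function.prod, LinearMap.comp_apply,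
            LinearMap.fst_apply, LinearMap.snd_apply, hu]
          tauto
      rw [e _ rfl, e _ (by decide)]
      rw [hb] at h
      exact_mod_cast h
  -- A point with `(φ x).2 = ψ x = 0` lies on all six hyperplanes of the pencil, any other point on
  -- exactly one.
  have hcount : A.card + 5 * b ≤ ∑ r : ZMod 5, (A.filter (fun x => ψ x - r * (φ x).2 = 0)).card +
      (A.filter (fun x => (φ x).2 = 0)).card := by
    have hb' : b ≤ (A.filter (fun x => (φ x).2 = 0 ∧ ψ x = 0)).card := by
      rw [hb, ← Finset.card_union_of_disjoint]
      · refine Finset.card_le_card fun x hx => ?_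
        rw [Finset.mem_union, Finset.mem_filter, Finset.mem_filter] at hx
        rw [Finset.mem_filter]
        rcases hx with ⟨h1, h2, h3⟩ | ⟨h1, h2, h3⟩ <;> exact ⟨h1, by simp [h2], h3⟩
      · rw [Finset.disjoint_left]
        intro x hx hx'
        have h1 := (Finset.mem_filter.1 hx).2.1
        have h2 := (Finset.mem_filter.1 hx').2.1
        rw [h1] at h2
        exact absurd h2 (by decide)
    refine (Nat.add_le_add_left (Nat.mul_le_mul_left 5 hb') _).trans ?_
    simp only [Finset.card_filter]
    rw [Finset.sum_comm, Finset.card_eq_sum_ones, Finset.mul_sum, ← Finset.sum_add_distrib,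
      ← Finset.sum_add_distrib]
    refine Finset.sum_le_sum fun x _ => ?_
    generalize (φ x).2 = s
    generalize ψ x = t
    revert s t
    decide
  have hcount' : (A.card : ℝ) + 5 * b ≤
      ∑ r : ZMod 5, ((A.filter (fun x => ψ x - r * (φ x).2 = 0)).card : ℝ) +
      (A.filter (fun x => (φ x).2 = 0)).card := by exact_mod_cast hcount
  have hsum := Finset.sum_le_sum (fun r (_ : r ∈ (Finset.univ : Finset (ZMod 5))) => hr r)
  rw [Finset.sum_const, Finset.card_univ, ZMod.card, nsmul_eq_mul] at hsum
  push_cast at hsum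
  linarith

end Hyperplane

/-! ### Kneser's theorem for one axis cell joined with the negative of the other -/

section Inline

variable {G : Type*} [AddCommGroup G] [Module (ZMod 5) G] [Fintype G] [DecidableEq G]

/-- A subset of a fibre that is contained in `k` cosets of a hyperplane of the kernel. -/
lemma exists_functional_card_image_le {W : Type*} [AddCommGroup W] [Module (ZMod 5) W]
    [DecidableEq W] {φ : G →ₗ[ZMod 5] W} {H : Submodule (ZMod 5) G} (hH : H ≤ LinearMap.ker φ)
    (hcard : Nat.card (LinearMap.ker φ) = 5 * Nat.card H) {D : Finset G} {u : W}
    (hD : ∀ x ∈ D, φ x = u) {k : ℕ}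
    (hk : (cosetHull D H.toAddSubgroup).card = k * Nat.card H) :
    ∃ ψ : G →ₗ[ZMod 5] ZMod 5, (∃ x ∈ LinearMap.ker φ, ψ x = 1) ∧ (D.image ψ).card ≤ k := by
  obtain ⟨ψ, hψ, hψ1⟩ := exists_functional hH hcard
  refine ⟨ψ, hψ1, ?_⟩
  have hcell : cell (cosetHull D H.toAddSubgroup) φ u = cosetHull D H.toAddSubgroup := by
    refine Finset.filter_true_of_mem fun x hx => ?_
    obtain ⟨d, hd, hxd⟩ := mem_cosetHull.1 hx
    have : φ (x - d) = 0 := hH hxd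
    rw [map_sub, hD d hd, sub_eq_zero] at this
    exact this
  have h1 := card_image_of_periodic (A := cosetHull D H.toAddSubgroup) (φ := φ) (ψ := ψ) (u := u)
    (by rw [hψ, hcard]) (by
      rw [hψ, hcell]
      exact fun x hx h hh => add_mem_cosetHull hx hh)
  rw [dens, hcell, hk, hcard] at h1
  have hpos : (Nat.card H : ℝ) ≠ 0 := by exact_mod_cast Nat.card_pos.ne'
  have h2 : (((cosetHull D H.toAddSubgroup).image ψ).card : ℝ) = k := by
    rw [h1]; push_cast; field_simp
  have h3 : ((cosetHull D H.toAddSubgroup).image ψ).card = k := by exact_mod_cast h2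
  rw [← h3]
  exact Finset.card_le_card (Finset.image_subset_image (subset_cosetHull _ _))

/-- The cells over `e` and `-e` cannot be confined to three hyperplane cosets. -/
lemma three_lt_card_image {A : Finset G} (hA : ∀ x ∈ A, ∀ y ∈ A, x + y ∉ A)
    (hcard : 28 * Fintype.card G ≤ 125 * A.card) {φ : G →ₗ[ZMod 5] ZMod 5 × ZMod 5}
    (hφ : Function.Surjective φ) (hP : PairBound A (node (dens A φ) (1, 0)))
    (hP1 : 1.12 < node (dens A φ) (1, 0)) (hP2 : node (dens A φ) (1, 0) ≤ 1.2)
    {ψ : G →ₗ[ZMod 5] ZMod 5} (hψ : ∃ x ∈ LinearMap.ker φ, ψ x = 1) :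
    3 < ((cell A φ (1, 0) ∪ -cell A φ (-(1, 0))).image ψ).card := by
  by_contra! h3
  set P := node (dens A φ) (1, 0) with hPdef
  set S := (cell A φ (1, 0) ∪ -cell A φ (-(1, 0))).image ψ with hS
  set N : ℝ := (Nat.card (LinearMap.ker φ) : ℝ) with hN
  have hNpos : 0 < N := natCard_ker_pos φ
  have hGN : (Fintype.card G : ℝ) = 25 * N := card_eq_mul_natCard_ker hφ
  have hPN : P * N = (cell A φ (1, 0)).card + (cell A φ (-(1, 0))).card := by
    rw [hPdef, node, add_mul, dens_mul_card, dens_mul_card]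
  have c1 : (cell A φ (1, 0)).card =
      ∑ h ∈ S, ((cell A φ (1, 0)).filter (fun x => ψ x = h)).card :=
    Finset.card_eq_sum_card_fiberwise fun x hx =>
      Finset.mem_image_of_mem _ (Finset.mem_union_left _ hx)
  have c2 : (cell A φ (-(1, 0))).card =
      ∑ h ∈ S, ((cell A φ (-(1, 0))).filter (fun x => -ψ x = h)).card :=
    Finset.card_eq_sum_card_fiberwise fun x hx => by
      rw [← map_neg]
      exact Finset.mem_image_of_mem _ (Finset.mem_union_right _ (Finset.neg_mem_neg hx))
  -- Pigeonhole: one of at most three values carries a third of the axis node. As `P / 3 > 0.32`,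
  -- the pencil bound applies and gives `|A| ≤ (13/3) P N ≤ 5.2 N`, against `|A| ≥ 5.6 N`.
  obtain ⟨h, -, hh⟩ : ∃ h ∈ S, P * N / 3 ≤
      (((cell A φ (1, 0)).filter (fun x => ψ x = h)).card : ℝ) +
        ((cell A φ (-(1, 0))).filter (fun x => -ψ x = h)).card := by
    by_contra! hc
    have hSne : S.Nonempty := by
      rw [Finset.nonempty_iff_ne_empty]
      intro he
      rw [he] at c1 c2
      simp only [Finset.sum_empty] at c1 c2
      rw [c1, c2] at hPN
      push_cast at hPN
      nlinarith
    have h4 := Finset.sum_lt_sum_of_nonempty hSne hc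
    rw [Finset.sum_add_distrib, Finset.sum_const, nsmul_eq_mul] at h4
    have h5 : ((cell A φ (1, 0)).card : ℝ) + (cell A φ (-(1, 0))).card < S.card * (P * N / 3) := by
      rw [c1, c2]
      exact_mod_cast h4
    rw [← hPN] at h5
    have h6 : (S.card : ℝ) ≤ 3 := by exact_mod_cast h3
    have h7 : 0 < P * N / 3 := by positivity
    nlinarith
  -- Subtracting `h` times the first coordinate moves the slices `ψ = h` over `(1, 0)` and `ψ = -h`
  -- over `-(1, 0)` to the value zero together.
  have hs : Function.Surjective (φ.prod (ψ - h • (LinearMap.fst _ _ _ ∘ₗ φ))) := by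
    rintro ⟨u, t⟩
    obtain ⟨x, hx, hxt⟩ := exists_fibre_apply_eq hφ hψ u (t + h * u.1)
    exact ⟨x, by simp [hx, hxt]⟩
  have e1 : A.filter (fun x => φ x = (1, 0) ∧ (ψ - h • (LinearMap.fst _ _ _ ∘ₗ φ)) x = 0) =
      (cell A φ (1, 0)).filter (fun x => ψ x = h) := by
    rw [cell, Finset.filter_filter]
    refine Finset.filter_congr fun x _ => and_congr_right fun hx => ?_
    simp [hx, sub_eq_zero]
  have e2 : A.filter (fun x => φ x = -(1, 0) ∧ (ψ - h • (LinearMap.fst _ _ _ ∘ₗ φ)) x = 0) =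
      (cell A φ (-(1, 0))).filter (fun x => -ψ x = h) := by
    rw [cell, Finset.filter_filter]
    refine Finset.filter_congr fun x _ => and_congr_right fun hx => ?_
    simp [hx, neg_eq_iff_eq_neg, eq_neg_iff_add_eq_zero]
  have h8 := card_pencil hA hP hP1.le hs rfl (by
    rw [e1, e2, hGN]
    push_cast
    nlinarith)
  rw [e1, e2, hGN] at h8
  push_cast at h8
  have h9 : (28 : ℝ) * Fintype.card G ≤ 125 * A.card := by exact_mod_cast hcard
  rw [hGN] at h9
  nlinarith

/-- Both `x + y = z` and `z + x' = y` are forbidden in `A`, so `D`, one axis cell together with the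
negative of the other, satisfies `D + A_u` disjoint from `A_v`. Kneser is applied to this larger
set. -/
lemma inline_le {A : Finset G} (hA : ∀ x ∈ A, ∀ y ∈ A, x + y ∉ A)
    (hcard : 28 * Fintype.card G ≤ 125 * A.card) {φ : G →ₗ[ZMod 5] ZMod 5 × ZMod 5}
    (hφ : Function.Surjective φ) (hP : PairBound A (node (dens A φ) (1, 0)))
    (hP1 : 1.12 < node (dens A φ) (1, 0)) (hP2 : node (dens A φ) (1, 0) ≤ 1.2)
    (hα : 0.56 < dens A φ (1, 0)) (hα' : dens A φ (1, 0) ≤ 0.6)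
    (hβα : dens A φ (-(1, 0)) ≤ dens A φ (1, 0)) {u v : ZMod 5 × ZMod 5} (huv : (1, 0) + u = v)
    (hu : 0 < dens A φ u) (hv : 0 < dens A φ v) :
    dens A φ u + dens A φ v ≤ 0.44 ∧ dens A φ (1, 0) + dens A φ u + dens A φ v ≤ 1.04 ∧
      dens A φ (-(1, 0)) + dens A φ u + dens A φ v ≤ 1.04 := by
  subst huv
  set D := cell A φ (1, 0) ∪ -cell A φ (-(1, 0)) with hDdef
  have hDφ : ∀ x ∈ D, φ x = (1, 0) := by
    intro x hx
    rcases Finset.mem_union.1 hx with hx | hx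
    · exact (mem_cell.1 hx).2
    · have := (mem_cell.1 (Finset.mem_neg'.1 hx)).2
      rw [map_neg, neg_inj] at this
      exact this
  have hDadd : ∀ d ∈ D, ∀ x ∈ cell A φ u, d + x ∉ cell A φ ((1, 0) + u) := by
    intro d hd x hx hdx
    rcases Finset.mem_union.1 hd with hd | hd
    · exact hA d (mem_cell.1 hd).1 x (mem_cell.1 hx).1 (mem_cell.1 hdx).1
    · refine hA (d + x) (mem_cell.1 hdx).1 (-d) (mem_cell.1 (Finset.mem_neg'.1 hd)).1 ?_
      rw [add_neg_cancel_comm]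
      exact (mem_cell.1 hx).1
  have hDne : D.Nonempty := (dens_pos.1 (by linarith)).mono Finset.subset_union_left
  obtain ⟨H, M, x', y', z', hH, hM, hM5, hx1, hy1, hz1, hx, hy, hz, hle, -⟩ :=
    exists_submodule_of_add_notMem φ hDne (dens_pos.1 hu) (dens_pos.1 hv) hDφ
      (fun x hx => (mem_cell.1 hx).2) (fun x hx => (mem_cell.1 hx).2) hDadd
  have hpos : (0 : ℝ) < Nat.card H := by exact_mod_cast Nat.card_pos
  have key : ∀ (w : ZMod 5 × ZMod 5) (k : ℕ),
      (cosetHull (cell A φ w) H.toAddSubgroup).card = k * Nat.card H → dens A φ w * M ≤ k := by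
    intro w k hk
    refine le_of_mul_le_mul_right ?_ hpos
    rw [mul_assoc, ← Nat.cast_mul, ← hM, dens_mul_card, ← Nat.cast_mul, ← hk]
    exact_mod_cast Finset.card_le_card (subset_cosetHull _ _)
  have ky := key _ _ hy
  have kz := key _ _ hz
  have hDc := (Finset.card_le_card (subset_cosetHull D H.toAddSubgroup)).trans_eq hx
  have kx : dens A φ (1, 0) * M ≤ x' := by
    refine le_of_mul_le_mul_right ?_ hpos
    rw [mul_assoc, ← Nat.cast_mul, ← hM, dens_mul_card, ← Nat.cast_mul]
    exact_mod_cast (Finset.card_le_card Finset.subset_union_left).trans hDc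
  have hle' : (x' : ℝ) + y' + z' ≤ M + 1 := by exact_mod_cast hle
  rcases hM5 with rfl | hM25
  -- The hull of `D` needs at least four of the five cosets, leaving one each for `u` and `v`.
  · have hx4 : 4 ≤ x' := by
      by_contra! hc
      obtain ⟨ψ, hψ, hψD⟩ := exists_functional_card_image_le hH hM hDφ hx
      have := three_lt_card_image hA hcard hφ hP hP1 hP2 hψ
      rw [← hDdef] at this
      omega
    have hy' : y' = 1 := by omega
    have hz' : z' = 1 := by omega
    rw [hy'] at ky
    rw [hz'] at kz
    push_cast at ky kz
    refine ⟨?_, ?_, ?_⟩ <;> linarith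
  · have hM' : 0 < M := by omega
    obtain ⟨m, rfl⟩ := hM25
    have hm : 0 < m := by omega
    have hm' : (1 : ℝ) ≤ m := by exact_mod_cast hm
    push_cast at kx ky kz hle'
    -- `0.56 · 25 = 14`, so `y' + z' ≤ 11m` out of `25m`, which is the density `0.44`.
    have h14 : 14 * m < x' := by
      have : (14 : ℝ) * m < x' := by nlinarith
      exact_mod_cast this
    have hyz : y' + z' ≤ 11 * m := by omega
    have hyz' : (y' : ℝ) + z' ≤ 11 * m := by exact_mod_cast hyz
    have h1 : dens A φ u + dens A φ ((1, 0) + u) ≤ 0.44 := by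
      by_contra! hc
      nlinarith
    have h2 : dens A φ (1, 0) + dens A φ u + dens A φ ((1, 0) + u) ≤ 1.04 := by
      by_contra! hc
      nlinarith
    exact ⟨h1, h2, by linarith⟩

end Inline

/-! ### The two exceptional configurations -/

namespace IsProfile

variable {W : Type*} [AddCommGroup W] {a : W → ℝ} {e u v : W}

lemma edge_le_of_eq (h : IsProfile a) (hP : node a e = 1.6) (huv : e + u = v)
    (hu : 0 < node a u) (hv : 0 < node a v) : node a u + node a v ≤ 0.8 := by
  have hP' : a e + a (-e) = 1.6 := hP
  have hPn : node a (-e) = 1.6 := by rw [node_neg, hP]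
  have h1 := h.le_one e
  have h2 := h.le_one (-e)
  rcases le_total (a (-e)) (a e) with hle | hle
  · rcases h.edge_le (by linarith) (by linarith) (by linarith) huv hu hv with h3 | h3 <;> linarith
  · rcases h.edge_le (e := -e) (u := v) (v := u) (by linarith) (by rw [neg_neg]; linarith)
      (by linarith) (by rw [← huv, neg_add_cancel_left]) hv hu with h3 | h3 <;> linarith

lemma eq_of_le_edge' (h : IsProfile a) (hP : node a e = 1.6) (huv : e + u = v)
    (hu : 0 < node a u) (hv : 0 < node a v) (huv8 : 0.8 ≤ node a u + node a v) :
    a e = 0.8 ∧ a u = 0.2 ∧ a (-u) = 0.2 ∧ a v = 0.2 ∧ a (-v) = 0.2 := by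
  rcases le_total (a (-e)) (a e) with hle | hle
  · obtain ⟨h1, -, h2⟩ := h.eq_of_le_edge hP hle huv hu hv huv8
    exact ⟨h1, h2⟩
  · obtain ⟨-, h1, h2, h3, h4, h5⟩ := h.eq_of_le_edge (e := -e) (u := v) (v := u)
      (by rw [node_neg, hP]) (by rwa [neg_neg]) (by rw [← huv, neg_add_cancel_left]) hv hu
      (by linarith)
    rw [neg_neg] at h1
    exact ⟨h1, h4, h5, h2, h3⟩

/-- The two axes leave `2.4` for the six nodes, which pair up into three edges in direction `(1, 0)`
of at most `4/5` each. Hence equality holds on all three and fixes every cell; an edge in direction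
`(0, 1)` then fixes the second axis. -/
lemma eq_of_six_nodes {a : ZMod 5 × ZMod 5 → ℝ} (h : IsProfile a) (hsum : 5.6 ≤ ∑ u, a u)
    (hP : node a (1, 0) = 1.6) (hF : node a (0, 1) = 1.6)
    (hpos : ∀ v ∈ ({(2, 1), (2, -1), (1, 2), (1, -2), (2, 2), (2, -2)} :
      Finset (ZMod 5 × ZMod 5)), 0 < node a v) :
    a (1, 0) = 0.8 ∧ a (0, 1) = 0.8 ∧ a (3, 1) = 0.2 ∧ a (3, 2) = 0.2 ∧ a (3, 3) = 0.2 ∧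
      a (3, 4) = 0.2 ∧ a (2, 2) = 0.2 ∧ a (1, 2) = 0.2 := by
  obtain ⟨z0, z2⟩ := h.axis_eq_zero (by rw [hP]; norm_num)
  have zero : ∀ u v w : ZMod 5 × ZMod 5, u + v + w = 0 → node a u = 1.6 → node a v = 1.6 →
      node a w = 0 := by
    intro u v w huvw hu hv
    refine le_antisymm ?_ h.node_nonneg
    by_contra! hw
    linarith [h.node_add_node_le_two huvw hw]
  have n1 : node a (1, 1) = 0 := by
    rw [← node_neg]; exact zero (1, 0) (0, 1) _ (by decide) hP hF
  have n2 : node a (1, -1) = 0 := by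
    rw [← node_neg]; exact zero (1, 0) (-(0, 1)) _ (by decide) hP (by rw [node_neg, hF])
  have n3 : node a (0, 2) = 0 := by
    rw [← node_neg]; exact zero (0, 1) (0, 1) _ (by decide) hF hF
  rw [sum_eq_nodes, z0, z2, n1, n2, n3, hP, hF] at hsum
  have p1 := hpos (2, 1) (by decide)
  have p2 := hpos (2, -1) (by decide)
  have p3 := hpos (1, 2) (by decide)
  have p4 := hpos (1, -2) (by decide)
  have p5 := hpos (2, 2) (by decide)
  have p6 := hpos (2, -2) (by decide)
  have c2 : node a (3, 1) = node a (2, -1) := by rw [← node_neg]; rfl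
  rw [← c2] at p2 hsum
  have b1 := h.edge_le_of_eq hP (show (1, 0) + (2, 1) = (3, 1) by decide) p1 p2
  have b2 := h.edge_le_of_eq hP (show (1, 0) + (1, 2) = (2, 2) by decide) p3 p5
  have b3 := h.edge_le_of_eq hP (show (1, 0) + (1, -2) = (2, -2) by decide) p4 p6
  have b4 := h.edge_le_of_eq hF (show (0, 1) + (2, 1) = (2, 2) by decide) p1 p5
  obtain ⟨r0, -, r1, r2, -⟩ := h.eq_of_le_edge' hP (show (1, 0) + (2, 1) = (3, 1) by decide) p1 p2
    (by linarith)
  obtain ⟨-, r3, -, r5, r6⟩ := h.eq_of_le_edge' hP (show (1, 0) + (1, 2) = (2, 2) by decide) p3 p5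
    (by linarith)
  obtain ⟨-, -, -, -, r7⟩ := h.eq_of_le_edge' hP (show (1, 0) + (1, -2) = (2, -2) by decide) p4 p6
    (by linarith)
  have r8 := h.eq_of_le_edge' hF (show (0, 1) + (2, 1) = (2, 2) by decide) p1 p5 (by
    unfold node
    linarith [h.eq_of_le_edge' hP (show (1, 0) + (2, 1) = (3, 1) by decide) p1 p2 (by linarith)])
  exact ⟨r0, r8.1, r2, r7, r6, r1, r5, r3⟩

end IsProfile

section Exceptional

variable {G : Type*} [AddCommGroup G] [Module (ZMod 5) G] [Fintype G] [DecidableEq G]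
variable {W : Type*} [AddCommGroup W] [Module (ZMod 5) W] [DecidableEq W]

lemma dens_eq_one {A : Finset G} {φ : G →ₗ[ZMod 5] W} (hφ : Function.Surjective φ) {u : W}
    (h : ∀ x, φ x = u → x ∈ A) : dens A φ u = 1 := by
  obtain ⟨x, rfl⟩ := hφ u
  have : cell A φ (φ x) = Finset.univ.filter (fun y => φ y = φ x) := by
    ext y
    rw [mem_cell, Finset.mem_filter]
    exact ⟨fun hy => ⟨Finset.mem_univ _, hy.2⟩, fun hy => ⟨h y hy.2, hy.2⟩⟩
  rw [dens, this, card_fibre, div_self (natCard_ker_pos φ).ne']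

/-- Propagates a period along triangles of total `6/5`: a shared cell that is neither empty nor full
has only one period of index five. -/
lemma periodic_of_sum_eq {A : Finset G} (hA : ∀ x ∈ A, ∀ y ∈ A, x + y ∉ A)
    {φ : G →ₗ[ZMod 5] W} {H : Submodule (ZMod 5) G}
    (hcard : Nat.card (LinearMap.ker φ) = 5 * Nat.card H) {r : W} (hr : 0 < dens A φ r)
    (hr1 : dens A φ r < 1) (pr : ∀ x ∈ cell A φ r, ∀ h ∈ H, x + h ∈ cell A φ r)
    {u v w : W} (hw : u + v = w) (hu : 0 < dens A φ u) (hv : 0 < dens A φ v)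
    (hp : 0 < dens A φ w) (hsum : 1.2 ≤ dens A φ u + dens A φ v + dens A φ w)
    (hmem : r = u ∨ r = v ∨ r = w) :
    (∀ x ∈ cell A φ u, ∀ h ∈ H, x + h ∈ cell A φ u) ∧
      (∀ x ∈ cell A φ v, ∀ h ∈ H, x + h ∈ cell A φ v) ∧
      (∀ x ∈ cell A φ w, ∀ h ∈ H, x + h ∈ cell A φ w) := by
  obtain ⟨H', -, hcard', p1, p2, p3⟩ := exists_periodic_of_sum_eq hA φ hw hu hv hp hsum
  have hlt : (cell A φ r).card < Nat.card (LinearMap.ker φ) := by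
    have := natCard_ker_pos φ
    have h1 := dens_mul_card A φ r
    have : ((cell A φ r).card : ℝ) < Nat.card (LinearMap.ker φ) := by nlinarith
    exact_mod_cast this
  have pr' : ∀ x ∈ cell A φ r, ∀ h ∈ H', x + h ∈ cell A φ r := by
    rcases hmem with rfl | rfl | rfl <;> assumption
  obtain rfl := periodic_subgroup_eq hcard hcard' (dens_pos.1 hr) pr pr' hlt
  exact ⟨p1, p2, p3⟩

lemma image_eq_singleton {A : Finset G} {φ : G →ₗ[ZMod 5] W} {ψ : G →ₗ[ZMod 5] ZMod 5} {u : W}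
    (hcard : Nat.card (LinearMap.ker φ) =
      5 * Nat.card (LinearMap.ker φ ⊓ LinearMap.ker ψ : Submodule (ZMod 5) G))
    (hper : ∀ x ∈ cell A φ u, ∀ h ∈ LinearMap.ker φ ⊓ LinearMap.ker ψ, x + h ∈ cell A φ u)
    (hu : dens A φ u = 0.2) : ∃ c, (cell A φ u).image ψ = {c} := by
  have h1 := card_image_of_periodic hcard hper
  rw [hu] at h1
  have h2 : (((cell A φ u).image ψ).card : ℝ) = 1 := by rw [h1]; norm_num
  exact Finset.card_eq_one.1 (by exact_mod_cast h2)

lemma image_eq_compl {A : Finset G} {φ : G →ₗ[ZMod 5] W} {ψ : G →ₗ[ZMod 5] ZMod 5} {u : W}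
    (hcard : Nat.card (LinearMap.ker φ) =
      5 * Nat.card (LinearMap.ker φ ⊓ LinearMap.ker ψ : Submodule (ZMod 5) G))
    (hper : ∀ x ∈ cell A φ u, ∀ h ∈ LinearMap.ker φ ⊓ LinearMap.ker ψ, x + h ∈ cell A φ u)
    (hu : dens A φ u = 0.8) : ∃ c, (cell A φ u).image ψ = {c}ᶜ := by
  have h1 := card_image_of_periodic hcard hper
  rw [hu] at h1
  have h2 : (((cell A φ u).image ψ).card : ℝ) = 4 := by rw [h1]; norm_num
  have h3 : ((cell A φ u).image ψ).card = 4 := by exact_mod_cast h2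
  have h4 : (((cell A φ u).image ψ)ᶜ).card = 1 := by
    rw [Finset.card_compl, h3, ZMod.card]
  obtain ⟨c, hc⟩ := Finset.card_eq_one.1 h4
  exact ⟨c, by rw [← hc, compl_compl]⟩

/-- The values of a functional on a cell of density `4 / 5` and two of density `1 / 5`. -/
lemma eq_add_of_image {A : Finset G} (hA : ∀ x ∈ A, ∀ y ∈ A, x + y ∉ A)
    {φ : G →ₗ[ZMod 5] W} {ψ : G →ₗ[ZMod 5] ZMod 5} {e u v : W} {c p q : ZMod 5}
    (hw : e + u = v)
    (hper : ∀ x ∈ cell A φ v, ∀ h ∈ LinearMap.ker φ ⊓ LinearMap.ker ψ, x + h ∈ cell A φ v)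
    (he : (cell A φ e).image ψ = {c}ᶜ) (hu : (cell A φ u).image ψ = {p})
    (hv : (cell A φ v).image ψ = {q}) : q = c + p := by
  by_contra hne
  refine image_add_notMem hA hw hper (q - p) ?_ p (by rw [hu]; simp) (by rw [hv]; simp)
  rw [he, Finset.mem_compl, Finset.mem_singleton]
  rintro rfl
  exact hne (by ring)

lemma add_eq_of_image {A : Finset G} (hA : ∀ x ∈ A, ∀ y ∈ A, x + y ∉ A)
    {φ : G →ₗ[ZMod 5] W} {ψ : G →ₗ[ZMod 5] ZMod 5} {e u v : W} {c p q : ZMod 5}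
    (hw : u + v = e)
    (hper : ∀ x ∈ cell A φ e, ∀ h ∈ LinearMap.ker φ ⊓ LinearMap.ker ψ, x + h ∈ cell A φ e)
    (he : (cell A φ e).image ψ = {c}ᶜ) (hu : (cell A φ u).image ψ = {p})
    (hv : (cell A φ v).image ψ = {q}) : p + q = c := by
  have := image_add_notMem hA hw hper p (by rw [hu]; simp) q (by rw [hv]; simp)
  rw [he, Finset.mem_compl, Finset.mem_singleton, not_not] at this
  exact this

set_option maxHeartbeats 1000000 in
-- Cells of density `1/5` become single values of `ψ` and those of density `4/5` complements of one
-- value, so triangles become linear equations over `𝔽₅`. They force the value on `(1, 2)` to be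
-- twice that on `(3, 1)`, contradicting sum-freeness for `(3, 1) + (3, 1) = (1, 2)`.
lemma false_of_six_nodes {A : Finset G} (hA : ∀ x ∈ A, ∀ y ∈ A, x + y ∉ A)
    {φ : G →ₗ[ZMod 5] ZMod 5 × ZMod 5} (hsum : 5.6 ≤ ∑ u, dens A φ u)
    (hP : node (dens A φ) (1, 0) = 1.6) (hF : node (dens A φ) (0, 1) = 1.6)
    (hpos : ∀ v ∈ ({(2, 1), (2, -1), (1, 2), (1, -2), (2, 2), (2, -2)} :
      Finset (ZMod 5 × ZMod 5)), 0 < node (dens A φ) v) : False := by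
  obtain ⟨de, df, d0, d1, d2, d3, d4, d5⟩ := (isProfile_dens hA φ).eq_of_six_nodes hsum hP hF hpos
  obtain ⟨H, hH, hcard, pf, p0, p1⟩ := exists_periodic_of_sum_eq hA φ
    (show (0, 1) + (3, 1) = (3, 2) by decide) (by linarith) (by linarith) (by linarith)
    (by linarith)
  obtain ⟨ψ, hψ, -⟩ := exists_functional hH hcard
  rw [← hψ] at hcard pf p0 p1
  obtain ⟨-, -, p2⟩ := periodic_of_sum_eq hA hcard (by linarith) (by linarith) pf
    (show (0, 1) + (3, 2) = (3, 3) by decide) (by linarith) (by linarith) (by linarith)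
    (by linarith) (Or.inl rfl)
  obtain ⟨-, -, p3⟩ := periodic_of_sum_eq hA hcard (by linarith) (by linarith) pf
    (show (0, 1) + (3, 3) = (3, 4) by decide) (by linarith) (by linarith) (by linarith)
    (by linarith) (Or.inl rfl)
  obtain ⟨-, -, pe⟩ := periodic_of_sum_eq hA hcard (by linarith) (by linarith) p0
    (show (3, 4) + (3, 1) = (1, 0) by decide) (by linarith) (by linarith) (by linarith)
    (by linarith) (Or.inr (Or.inl rfl))
  obtain ⟨-, p4, -⟩ := periodic_of_sum_eq hA hcard (by linarith) (by linarith) pe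
    (show (1, 0) + (2, 2) = (3, 2) by decide) (by linarith) (by linarith) (by linarith)
    (by linarith) (Or.inl rfl)
  obtain ⟨-, p5, -⟩ := periodic_of_sum_eq hA hcard (by linarith) (by linarith) pe
    (show (1, 0) + (1, 2) = (2, 2) by decide) (by linarith) (by linarith) (by linarith)
    (by linarith) (Or.inl rfl)
  obtain ⟨ce, se⟩ := image_eq_compl hcard pe de
  obtain ⟨cf, sf⟩ := image_eq_compl hcard pf df
  obtain ⟨z0, s0⟩ := image_eq_singleton hcard p0 d0
  obtain ⟨z1, s1⟩ := image_eq_singleton hcard p1 d1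
  obtain ⟨z2, s2⟩ := image_eq_singleton hcard p2 d2
  obtain ⟨z3, s3⟩ := image_eq_singleton hcard p3 d3
  obtain ⟨y1, s4⟩ := image_eq_singleton hcard p4 d4
  obtain ⟨y2, s5⟩ := image_eq_singleton hcard p5 d5
  have e1 := eq_add_of_image hA (by decide) p1 sf s0 s1
  have e2 := eq_add_of_image hA (by decide) p2 sf s1 s2
  have e3 := eq_add_of_image hA (by decide) p3 sf s2 s3
  have e4 := add_eq_of_image hA (by decide) pe se s3 s0
  have e5 := eq_add_of_image hA (by decide) p1 se s4 s1
  have e6 := eq_add_of_image hA (by decide) p4 se s5 s4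
  refine image_add_notMem hA (show ((3, 1) : ZMod 5 × ZMod 5) + (3, 1) = (1, 2) by decide)
    p5 z0 (by rw [s0]; simp) z0 (by rw [s0]; simp) ?_
  rw [s5, Finset.mem_singleton]
  have h5 : (5 : ZMod 5) = 0 := by decide
  linear_combination e6 + e5 - e1 - 2 * e4 + 2 * (e3 + e2 + e1) + (z0 + cf) * h5

/-- Every cell of the row is a single coset, and the values of `ψ` grow linearly along the row.
Together the cosets fill a subspace of codimension two and its negative, a node of density `2` above
the maximum `8/5`. -/
lemma false_of_full_row {A : Finset G} (hA : ∀ x ∈ A, ∀ y ∈ A, x + y ∉ A)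
    {φ : G →ₗ[ZMod 5] ZMod 5 × ZMod 5} (hφ : Function.Surjective φ) (hbound : PairBound A 1.6)
    (hP : node (dens A φ) (1, 0) = 1.6) (hβα : dens A φ (-(1, 0)) ≤ dens A φ (1, 0))
    {v : ZMod 5 × ZMod 5} (hv : v.2 ≠ 0) (hrow : ∀ i, 0 < node (dens A φ) (v + (i, 0)))
    (h2 : 2 ≤ ∑ i, node (dens A φ) (v + (i, 0))) : False := by
  obtain ⟨de, -, d⟩ := (isProfile_dens hA φ).eq_of_two_le_sum_row hP hβα hrow h2
  have k1 : ∀ m : ZMod 5, (1, 0) + (v + (m, 0)) = v + (m + 1, 0) := fun m => by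
    ext <;> simp; ring
  have k2 : ∀ m : ZMod 5, (v + (m + 1, 0)) + -(v + (m, 0)) = (1, 0) := fun m => by
    ext <;> simp; ring
  obtain ⟨H, hH, hcard, pe, -, -⟩ := exists_periodic_of_sum_eq hA φ (k1 0)
    (by linarith) (by rw [(d _).1]; norm_num) (by rw [(d _).1]; norm_num)
    (by rw [(d _).1, (d _).1, de]; norm_num)
  obtain ⟨ψ, hψ, hψ1⟩ := exists_functional hH hcard
  rw [← hψ] at hcard pe
  have p := fun m => periodic_of_sum_eq hA hcard (by linarith) (by linarith) pe (k2 m)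
    (by rw [(d _).1]; norm_num) (by rw [(d _).2]; norm_num) (by linarith)
    (by rw [(d _).1, (d _).2, de]; norm_num)
    (Or.inr (Or.inr rfl))
  have p' : ∀ m, ∀ x ∈ cell A φ (v + (m, 0)), ∀ h ∈ LinearMap.ker φ ⊓ LinearMap.ker ψ,
      x + h ∈ cell A φ (v + (m, 0)) := fun m => by
    have := (p (m - 1)).1
    rwa [sub_add_cancel] at this
  obtain ⟨c, hc⟩ := image_eq_compl hcard pe de
  choose z hz using fun m => image_eq_singleton hcard (p' m) (d m).1
  choose z' hz' using fun m => image_eq_singleton hcard (p m).2.1 (d m).2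
  have hz1 : ∀ m, z (m + 1) = c + z m := fun m =>
    eq_add_of_image hA (k1 m) (p' (m + 1)) hc (hz m) (hz (m + 1))
  have hz2 : ∀ m, z' m = -z m := fun m => by
    have := add_eq_of_image hA (k2 m) pe hc (hz (m + 1)) (hz' m)
    rw [hz1] at this
    linear_combination this
  have hzm : ∀ m, z m = z 0 + m * c := by
    have h1 := hz1 0
    have h2 := hz1 1
    have h3 := hz1 2
    have h4 := hz1 3
    rw [show (0 + 1 : ZMod 5) = 1 by decide] at h1
    rw [show (1 + 1 : ZMod 5) = 2 by decide] at h2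
    rw [show (2 + 1 : ZMod 5) = 3 by decide] at h3
    rw [show (3 + 1 : ZMod 5) = 4 by decide] at h4
    have hi : ∀ i : ZMod 5, i = 0 ∨ i = 1 ∨ i = 2 ∨ i = 3 ∨ i = 4 := by decide
    intro m
    rcases hi m with rfl | rfl | rfl | rfl | rfl
    · ring
    · linear_combination h1
    · linear_combination h1 + h2
    · linear_combination h1 + h2 + h3
    · linear_combination h1 + h2 + h3 + h4
  -- Chosen so that `ψ = c · (φ x).1 + k · (φ x).2` describes all the cosets of the row at once.
  set k := (z 0 - c * v.1) / v.2 with hk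
  have hkv : k * v.2 = z 0 - c * v.1 := div_mul_cancel₀ _ hv
  set θ : G →ₗ[ZMod 5] ZMod 5 × ZMod 5 := (v.2⁻¹ • (LinearMap.snd _ _ _ ∘ₗ φ)).prod
    (ψ - c • (LinearMap.fst _ _ _ ∘ₗ φ) - k • (LinearMap.snd _ _ _ ∘ₗ φ)) with hθ
  have hθa : ∀ x, θ x = (v.2⁻¹ * (φ x).2, ψ x - c * (φ x).1 - k * (φ x).2) := fun x => rfl
  have hθs : Function.Surjective θ := by
    rintro ⟨s, t⟩
    obtain ⟨x, hx, hxt⟩ := exists_fibre_apply_eq hφ hψ1 (0, v.2 * s) (t + k * (v.2 * s))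
    refine ⟨x, ?_⟩
    rw [hθa, hx, hxt]
    ext
    · simp [hv]
    · simp
  have f1 : dens A θ (1, 0) = 1 := by
    refine dens_eq_one hθs fun x hx => ?_
    rw [hθa, Prod.mk.injEq] at hx
    have h2 : (φ x).2 = v.2 := by
      rw [inv_mul_eq_one₀ hv] at hx; exact hx.1.symm
    have h1 : φ x = v + ((φ x).1 - v.1, 0) := by ext <;> simp [h2]
    rw [mem_iff_of_periodic (p' _) h1, hz, Finset.mem_singleton, hzm]
    rw [h2] at hx
    linear_combination hx.2 + hkv
  have f2 : dens A θ (-(1, 0)) = 1 := by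
    refine dens_eq_one hθs fun x hx => ?_
    rw [hθa, Prod.neg_mk, Prod.mk.injEq] at hx
    have h2 : (φ x).2 = -v.2 := by
      have := hx.1
      rw [inv_mul_eq_iff_eq_mul₀ hv] at this
      rw [this]; ring
    have h1 : φ x = -(v + (-(φ x).1 - v.1, 0)) := by ext <;> simp [h2]
    rw [mem_iff_of_periodic (p _).2.1 h1, hz', Finset.mem_singleton, hz2, hzm]
    rw [h2, neg_zero] at hx
    linear_combination hx.2 - hkv
  have := hbound θ hθs
  rw [node, f1, f2] at this
  norm_num at this

end Exceptional

/-! ### The main case -/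

section Main

variable {G : Type*} [AddCommGroup G] [Module (ZMod 5) G] [Fintype G] [DecidableEq G]

/-- A sum-free set of density at least `28 / 125` which is dense on a pair of opposite
subspaces of codimension two is normal or extremal. -/
theorem normal_or_vlLambda {A : Finset G} (hA : ∀ x ∈ A, ∀ y ∈ A, x + y ∉ A)
    {φ₀ : G →ₗ[ZMod 5] ZMod 5 × ZMod 5} (hφ₀ : Function.Surjective φ₀)
    (h₀ : 1.12 < node (dens A φ₀) (1, 0)) (hcard : 28 * Fintype.card G ≤ 125 * A.card) :
    (∃ f : G →ₗ[ZMod 5] ZMod 5, f ≠ 0 ∧ ∀ x ∈ A, f x = 1 ∨ f x = -1) ∨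
    ∃ θ : G →ₗ[ZMod 5] ZMod 5 × ZMod 5 × ZMod 5, Function.Surjective θ ∧
      ∀ x, x ∈ A ↔ θ x ∈ vlLambda := by
  obtain ⟨φ₁, hφ₁, hle₁, hmax₁⟩ := exists_pairBound A hφ₀
  by_cases h16 : 1.6 < node (dens A φ₁) (1, 0)
  · exact (normal_or_vlLambda_of_lt hA hφ₁ h16 hcard).imp_right And.left
  -- Negating the plane if necessary puts the denser of the two axis cells over `(1, 0)`.
  obtain ⟨φ₂, hφ₂, hnode₂, hβα₂⟩ : ∃ φ₂ : G →ₗ[ZMod 5] ZMod 5 × ZMod 5, Function.Surjective φ₂ ∧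
      node (dens A φ₂) (1, 0) = node (dens A φ₁) (1, 0) ∧
      dens A φ₂ (-(1, 0)) ≤ dens A φ₂ (1, 0) := by
    rcases le_total (dens A φ₁ (-(1, 0))) (dens A φ₁ (1, 0)) with h | h
    · exact ⟨φ₁, hφ₁, rfl, h⟩
    · refine ⟨(LinearEquiv.neg (ZMod 5)).toLinearMap ∘ₗ φ₁,
        (LinearEquiv.neg (ZMod 5)).surjective.comp hφ₁, ?_, ?_⟩
      · rw [node_dens_comp_equiv]
        exact IsProfile.node_neg
      · rw [dens_comp_equiv, dens_comp_equiv]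
        simpa using h
  obtain ⟨φ, hφ, hd, hd', hF⟩ := exists_normalized A hφ₂
  have hnode : node (dens A φ) (1, 0) = node (dens A φ₁) (1, 0) := by
    rw [← hnode₂, node, node, hd, hd']
  rw [← hd, ← hd'] at hβα₂
  rw [← hnode] at h16 hle₁ hmax₁
  have hprof := isProfile_dens hA φ
  have hsum := le_sum_dens hφ hcard
  have hP : 1.12 < node (dens A φ) (1, 0) := h₀.trans_le hle₁
  have hP' : node (dens A φ) (1, 0) = dens A φ (1, 0) + dens A φ (-(1, 0)) := rfl
  have hedge : ∀ v : ZMod 5 × ZMod 5, v.2 ≠ 0 → 0 < node (dens A φ) v →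
      0 < node (dens A φ) (v + (1, 0)) → node (dens A φ) v + node (dens A φ) (v + (1, 0)) ≤
        max 0.8 (2.24 - node (dens A φ) (1, 0)) := by
    intro v _ h1 h2
    rw [le_max_iff]
    -- If not, both axis cells are at most `0.6`, so `P ≤ 1.2`, and the larger exceeds `1.12 / 2 =
    -- 0.56`, as `inline_le` requires.
    by_cases hα : 0.6 < dens A φ (1, 0)
    · rcases hprof.edge_le hα (by linarith [hprof.le_one (1, 0)]) hP (add_comm _ _) h1 h2 with h | h
      · exact Or.inl h
      · exact Or.inr (by linarith)
    · right
      have := hprof.edge_le_of_balanced (by linarith) (by linarith) (by linarith)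
        (fun u w huw hu hw => inline_le hA hcard hφ hmax₁ hP (by linarith) (by linarith)
          (by linarith) hβα₂ huw hu hw) (add_comm _ _) h1 h2
      linarith
  have hfull : node (dens A φ) (1, 0) ≤ 1.6 → ∀ v : ZMod 5 × ZMod 5, v.2 ≠ 0 →
      (∀ i, 0 < node (dens A φ) (v + (i, 0))) → ∑ i, node (dens A φ) (v + (i, 0)) ≤ 2 ∨
        node (dens A φ) (1, 0) ≤ 1.2 ∧ ∑ i, node (dens A φ) (v + (i, 0)) ≤ 2.2 ∧
          (node (dens A φ) (1, 0) = 1.2 → ∑ i, node (dens A φ) (v + (i, 0)) < 2.2) := by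
    intro _ v _ hrow
    by_cases hα : 0.6 < dens A φ (1, 0)
    · exact Or.inl (hprof.sum_row_le_two hα hrow)
    · right
      refine ⟨by linarith, hprof.sum_row_le_of_balanced (by linarith) (by linarith) hβα₂
        (fun u w huw hu hw => (inline_le hA hcard hφ hmax₁ hP (by linarith) (by linarith)
          (by linarith) hβα₂ huw hu hw).1) hrow⟩
  rcases hprof.shape_cases hsum hF (hmax₁.node_le hφ (by decide)) hedge hfull
    (Or.inr ⟨hP, not_lt.1 h16, rfl⟩) with
    ⟨s, hs⟩ | ⟨s, -, h1, -⟩ | ⟨h1, v, hv, hrow, h2⟩ | ⟨h1, h2, h3⟩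
  · exact Or.inl (exists_functional_of_dens hφ hs)
  · linarith
  · rw [h1] at hmax₁
    exact (false_of_full_row hA hφ hmax₁ h1 hβα₂ hv hrow h2).elim
  · exact (false_of_six_nodes hA hsum h1 h2 h3).elim

end Main

/-! ### Translation to subsets of `𝔽₅ⁿ` -/

/-- Two surjections onto the same space differ by an automorphism of the source. -/
lemma exists_linearEquiv_comp_eq {K V W : Type*} [Field K] [AddCommGroup V] [Module K V]
    [FiniteDimensional K V] [AddCommGroup W] [Module K W] {f g : V →ₗ[K] W}
    (hf : Function.Surjective f) (hg : Function.Surjective g) :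
    ∃ e : V ≃ₗ[K] V, ∀ x, f (e x) = g x := by
  have key : ∀ k : V →ₗ[K] W, Function.Surjective k →
      ∃ E : V ≃ₗ[K] W × LinearMap.ker k, ∀ x, (E x).1 = k x := by
    intro k hk
    obtain ⟨C, hC⟩ := (LinearMap.ker k).exists_isCompl
    exact ⟨LinearMap.equivProdOfSurjectiveOfIsCompl k (Submodule.projectionOnto _ C hC)
      (LinearMap.range_eq_top.2 hk) (Submodule.range_projectionOnto hC)
      (by rwa [Submodule.ker_projectionOnto]), fun x => rfl⟩
  obtain ⟨E, hE⟩ := key f hf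
  obtain ⟨F, hF⟩ := key g hg
  have hrank : Module.finrank K (LinearMap.ker g) = Module.finrank K (LinearMap.ker f) := by
    have h1 := LinearMap.finrank_range_add_finrank_ker f
    have h2 := LinearMap.finrank_range_add_finrank_ker g
    rw [LinearMap.range_eq_top.2 hf] at h1
    rw [LinearMap.range_eq_top.2 hg] at h2
    omega
  refine ⟨(F.trans ((LinearEquiv.refl K W).prodCongr (LinearEquiv.ofFinrankEq _ _ hrank))).trans
    E.symm, fun x => ?_⟩
  rw [← hE, ← hF]
  simp

section Coordinates

variable {n : ℕ}

/-- An affine subspace of codimension two is a fibre of a surjection to the plane. -/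
lemma exists_plane_of_hasCodim {T : AffineSubspace (ZMod 5) (Fin n → ZMod 5)}
    (hT : HasCodim T 2) : ∃ q : (Fin n → ZMod 5) →ₗ[ZMod 5] ZMod 5 × ZMod 5,
      Function.Surjective q ∧ ∃ c, ∀ x, x ∈ T ↔ q x = c := by
  obtain ⟨⟨p, hp⟩, hdim⟩ := hT
  have hq : Module.finrank (ZMod 5) ((Fin n → ZMod 5) ⧸ T.direction) =
      Module.finrank (ZMod 5) (ZMod 5 × ZMod 5) := by
    have := T.direction.finrank_quotient_add_finrank
    rw [Module.finrank_fin_fun] at this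
    rw [Module.finrank_prod, Module.finrank_self]
    omega
  let E := LinearEquiv.ofFinrankEq _ _ hq
  refine ⟨E.toLinearMap ∘ₗ T.direction.mkQ, E.surjective.comp T.direction.mkQ_surjective,
    E (T.direction.mkQ p), fun x => ?_⟩
  rw [LinearMap.comp_apply, LinearEquiv.coe_coe, E.injective.eq_iff, Submodule.mkQ_apply,
    Submodule.mkQ_apply, Submodule.Quotient.eq, ← vsub_eq_sub,
    AffineSubspace.vsub_right_mem_direction_iff_mem hp]

lemma isNormal_of_functional {A : Set (Fin n → ZMod 5)} {f : (Fin n → ZMod 5) →ₗ[ZMod 5] ZMod 5}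
    (hf : f ≠ 0) (hA : ∀ x ∈ A, f x = 1 ∨ f x = -1) : IsNormal A := by
  obtain ⟨p, hp⟩ := LinearMap.surjective hf 1
  have hmem : ∀ x, x ∈ AffineSubspace.mk' p (LinearMap.ker f) ↔ f x = 1 := fun x => by
    rw [AffineSubspace.mem_mk', vsub_eq_sub, LinearMap.mem_ker, map_sub, hp, sub_eq_zero]
  refine ⟨AffineSubspace.mk' p (LinearMap.ker f), ⟨⟨p, (hmem p).2 hp⟩, ?_⟩, ?_, fun x hx => ?_⟩
  · rw [AffineSubspace.direction_mk', Module.Dual.finrank_ker_add_one_of_ne_zero hf,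
      Module.finrank_fin_fun]
  · rw [hmem, map_zero]
    decide
  · refine (hA x hx).imp (hmem x).2 fun h => (hmem (-x)).2 ?_
    rw [map_neg, h, neg_neg]

lemma isVLSet_of_surjective (hn : 3 ≤ n) {A : Set (Fin n → ZMod 5)}
    {θ : (Fin n → ZMod 5) →ₗ[ZMod 5] ZMod 5 × ZMod 5 × ZMod 5} (hθ : Function.Surjective θ)
    (hA : ∀ x, x ∈ A ↔ θ x ∈ vlLambda) : IsVLSet A := by
  let π : (Fin n → ZMod 5) →ₗ[ZMod 5] ZMod 5 × ZMod 5 × ZMod 5 :=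
    (LinearMap.proj ⟨0, by omega⟩).prod ((LinearMap.proj ⟨1, by omega⟩).prod
      (LinearMap.proj ⟨2, by omega⟩))
  have hπ : Function.Surjective π := by
    rintro ⟨a, b, c⟩
    exact ⟨fun i => if i.1 = 0 then a else if i.1 = 1 then b else c, rfl⟩
  obtain ⟨e, he⟩ := exists_linearEquiv_comp_eq hθ hπ
  refine ⟨hn, e, Set.ext fun x => ?_⟩
  rw [hA, ← e.apply_symm_apply x, he, e.injective.mem_set_image]
  rfl

lemma isNormal_or_isVLSet (hn : 3 ≤ n) {A : Set (Fin n → ZMod 5)} (hA : IsSumFree A)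
    (hcard : 28 * 5 ^ (n - 3) ≤ A.ncard) {T : AffineSubspace (ZMod 5) (Fin n → ZMod 5)}
    (hT2 : HasCodim T 2) (hTA : (28 : ℝ) * (5 : ℝ) ^ ((n : ℤ) - 4) <
      ((A ∩ (T : Set (Fin n → ZMod 5))).ncard : ℝ) +
        ((A ∩ -(T : Set (Fin n → ZMod 5))).ncard : ℝ)) : IsNormal A ∨ IsVLSet A := by
  classical
  obtain ⟨q, hq, c, hTc⟩ := exists_plane_of_hasCodim hT2
  obtain ⟨B, rfl⟩ := A.toFinite.exists_finset_coe
  have hB : ∀ x ∈ B, ∀ y ∈ B, x + y ∉ B := fun x hx y hy hxy =>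
    Set.eq_empty_iff_forall_notMem.1 hA _ ⟨Set.add_mem_add hx hy, hxy⟩
  have e1 : (B : Set (Fin n → ZMod 5)) ∩ T = cell B q c := by
    ext x
    rw [Set.mem_inter_iff, SetLike.mem_coe, SetLike.mem_coe, hTc, SetLike.mem_coe, mem_cell]
  have e2 : (B : Set (Fin n → ZMod 5)) ∩ -(T : Set (Fin n → ZMod 5)) = cell B q (-c) := by
    ext x
    rw [Set.mem_inter_iff, Set.mem_neg, SetLike.mem_coe, SetLike.mem_coe, hTc, SetLike.mem_coe,
      mem_cell, map_neg, neg_eq_iff_eq_neg]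
  have hG : Fintype.card (Fin n → ZMod 5) = 5 ^ n := by
    rw [Fintype.card_fun, ZMod.card, Fintype.card_fin]
  have hN : (25 : ℝ) * Nat.card (LinearMap.ker q) = 5 ^ n := by
    rw [← card_eq_mul_natCard_ker hq, hG]
    push_cast
    rfl
  -- `1.12 = 28 · 5^(n-4) / 5^(n-2)`; for `n = 3` the exponent `n - 4` is negative, hence the
  -- integer power.
  have hnode : 1.12 < node (dens B q) c := by
    rw [e1, e2, Set.ncard_coe_finset, Set.ncard_coe_finset, ← dens_mul_card, ← dens_mul_card,
      ← add_mul, zpow_sub₀ (by norm_num), zpow_natCast, ← hN] at hTA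
    refine lt_of_mul_lt_mul_right ?_ (natCard_ker_pos q).le
    refine lt_of_eq_of_lt ?_ hTA
    norm_num
    ring
  -- The fibre over zero is closed under addition, so its density is at most `1/2` and its node at
  -- most one.
  have hc : c ≠ 0 := by
    rintro rfl
    have hprof := isProfile_dens hB q
    rw [node, neg_zero] at hnode
    linarith [hprof.add_le_one (add_zero (0 : ZMod 5 × ZMod 5)) (by linarith)]
  obtain ⟨φ, hφ, hφc⟩ : ∃ φ : (Fin n → ZMod 5) →ₗ[ZMod 5] ZMod 5 × ZMod 5,
      Function.Surjective φ ∧ node (dens B φ) (1, 0) = node (dens B q) c := by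
    obtain ⟨σ, hσ⟩ := exists_linearEquiv_apply_eq hc
    exact ⟨σ.symm.toLinearMap ∘ₗ q, σ.symm.surjective.comp hq, by
      rw [node_dens_comp_equiv, LinearEquiv.symm_symm, hσ]⟩
  rw [← hφc] at hnode
  rcases normal_or_vlLambda hB hφ hnode (by
    rw [Set.ncard_coe_finset] at hcard
    obtain ⟨m, rfl⟩ := Nat.exists_eq_add_of_le hn
    rw [Nat.add_sub_cancel_left] at hcard
    rw [hG, pow_add]
    omega) with ⟨f, hf, hfB⟩ | ⟨θ, hθ, hθB⟩
  · exact Or.inl (isNormal_of_functional hf hfB)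
  · exact Or.inr (isVLSet_of_surjective hn hθ hθB)

end Coordinates

end PrimeField

theorem proposition2p6 (n : ℕ) (hn : 3 ≤ n) (A : Set (Fin n → ZMod 5))
    (hA : IsSumFree A) (hcard : 28 * 5 ^ (n - 3) ≤ A.ncard)
    (hT : ∃ T : AffineSubspace (ZMod 5) (Fin n → ZMod 5), HasCodim T 2 ∧
      (28 : ℝ) * (5 : ℝ) ^ ((n : ℤ) - 4) <
        ((A ∩ (T : Set (Fin n → ZMod 5))).ncard : ℝ) +
          ((A ∩ -(T : Set (Fin n → ZMod 5))).ncard : ℝ)) :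
    IsNormal A ∨ IsVLSet A := by
  obtain ⟨T, hT2, hTA⟩ := hT
  exact isNormal_or_isVLSet hn hA hcard hT2 hTA
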